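/- Setting. For $n\in\mathbb N$ and $a>b>0$ let $V=V_1\cup V_2$ be a set of $2n$ vertices split into two blocks $V_1,V_2$ of size $n$ each. Let $G$ be the random graph on $V$ in which the pairs of vertices are edges independently, with probability $a/n$ if both vertices lie in the same block and $b/n$ if they lie in different blocks ($n$ large enough that these are probabilities). A partition of $V$ into two sets is called $\gamma$-correct if its parts can be numbered $V_1',V_2'$ so that $|V_i\cap V_i'|\ge(1-\gamma)n$ for $i=1,2$. The spectral algorithm "Partition" takes as input $G$, $a$ and $b$, and not the blocks: 1. Colour each edge of $G$ Red or Blue, independently and with probability $1/2$ each. 2. (Spectral Partition on the Red graph, with $d=a+b$.) Let $A$ be the adjacency matrix of the Red graph with the rows and columns of all vertices of Red degree bigger than $20d$ replaced by zero. Let $W$ be the eigenspace spanned by two orthonormal eigenvectors of $A$ for its two largest eigenvalues (counted with multiplicity), $v_1$ the orthogonal projection of the all-ones vector on $W$, and $v_2$ a unit vector in $W$ perpendicular to $v_1$. Let $T_1$ be the set of the $n$ vertices with the largest values in $v_2$ and $T_2$ the set of the remaining $n$ vertices. 3. (Correction on the Blue graph.) Call $u\in T_i$ bad if it has at least $\frac{a+b}{4}$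 Blue neighbours in $T_{3-i}$. Output $V_1',V_2'$, where $V_i'$ is obtained from $T_i$ by deleting its bad vertices and adding the bad vertices of $T_{3-i}$. Choices left open (sign of $v_2$, ties, multiple eigenvalues) may be made arbitrarily. Statement. There are absolute constants $C_0>0$ and $\epsilon>0$ such that the following holds. Let $a,b,\gamma$ be any real constants with $a>b>C_0$, $0<\gamma<\epsilon$ and $$\frac{(a-b)^2}{a+b}\ \ge\ 8.1\,\log\frac{2}{\gamma}$$ (natural logarithm). Then, with probability $1-o(1)$ as $n\to\infty$ (over $G$ and the colouring), the algorithm Partition has an output, and every possible output of it, whatever choices are made, is a $\gamma$-correct partition. -/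

import Mathlib

open MeasureTheory ProbabilityTheory Filter Topology

namespace BlockModel

/-! ### The random input -/

/-- The vertex set: two blocks of `n` vertices each. -/
abbrev Vertex (n : ℕ) : Type := Fin n ⊕ Fin n

/-- The planted block `V₁`. -/
def block₁ (n : ℕ) : Set (Vertex n) := Set.range Sum.inl

/-- The planted block `V₂`. -/
def block₂ (n : ℕ) : Set (Vertex n) := Set.range Sum.inr

/-- The law of a `Bool` that is `true` with probability `p` (with `p` clamped to `[0, 1]`). -/
noncomputable def coin (p : ℝ) : Measure Bool :=
  bernoulliMeasure true false (Set.projIcc (0 : ℝ) 1 zero_le_one p)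

open scoped Classical in
/-- The probability of the pair `e` being an edge: `a / n` if the two endpoints lie in the same
block and `b / n` otherwise. For fixed `a, b` these are numbers in `[0, 1]` for all large `n`. -/
noncomputable def edgeProb (n : ℕ) (a b : ℝ) (e : Sym2 (Vertex n)) : ℝ :=
  if (e.map Sum.isLeft).IsDiag then a / n else b / n

/-- The two-block stochastic block model, as the law of the indicator function of the edge set:
the pairs are edges independently. (Diagonal pairs are ignored by `graphOf`.) -/
noncomputable def sbm (n : ℕ) (a b : ℝ) : Measure (Sym2 (Vertex n) → Bool) :=
  Measure.pi fun e => coin (edgeProb n a b e)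

/-- The random colouring used by the algorithm: independent fair coins, one for each pair
(`true` is Red, `false` is Blue; only the colours of edges are used). -/
noncomputable def colouring (V : Type*) [Fintype V] : Measure (Sym2 V → Bool) :=
  Measure.pi fun _ => coin (1 / 2)

/-- The simple graph whose edges are the non-diagonal pairs `e` with `x e = true`. -/
def graphOf {V : Type*} (x : Sym2 V → Bool) : SimpleGraph V :=
  SimpleGraph.fromEdgeSet {e | x e = true}

/-- The subgraph of the edges that have colour `k`. -/
def colourClass {V : Type*} (G : SimpleGraph V) (c : Sym2 V → Bool) (k : Bool) : SimpleGraph V :=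
  SimpleGraph.fromEdgeSet {e | e ∈ G.edgeSet ∧ c e = k}

/-! ### The algorithm -/

section Algorithm

variable {V : Type*} [Fintype V]

open scoped Classical in
/-- The adjacency matrix of `G` with the rows and columns of all vertices of degree bigger than
`20 d` zeroed out. -/
noncomputable def trimmed (G : SimpleGraph V) (d : ℝ) : Matrix V V ℝ :=
  fun u v =>
    if 20 * d < ((G.neighborSet u).ncard : ℝ) ∨ 20 * d < ((G.neighborSet v).ncard : ℝ) then 0
    else if G.Adj u v then 1 else 0

/-- `W` is an eigenspace of the symmetric matrix `A` for its two largest eigenvalues, counted with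
multiplicity: it is spanned by orthonormal eigenvectors `x, y` with eigenvalues `l₁ ≥ l₂`, and
the eigenvectors of `A` that are orthogonal to `W` have eigenvalues at most `l₂`. -/
def IsTopTwoEigenspace (A : Matrix V V ℝ) (W : Submodule ℝ (EuclideanSpace ℝ V)) : Prop :=
  ∃ (x y : EuclideanSpace ℝ V) (l₁ l₂ : ℝ),
    Orthonormal ℝ ![x, y] ∧
    A.mulVec x.ofLp = l₁ • x.ofLp ∧ A.mulVec y.ofLp = l₂ • y.ofLp ∧ l₂ ≤ l₁ ∧
    W = Submodule.span ℝ {x, y} ∧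
    ∀ (z : EuclideanSpace ℝ V) (l : ℝ),
      z ∈ Wᗮ → z ≠ 0 → A.mulVec z.ofLp = l • z.ofLp → l ≤ l₂

/-- The all-ones vector. -/
def allOnes : EuclideanSpace ℝ V := WithLp.toLp 2 fun _ => 1

/-- `(U₁, U₂)` is a possible output of Spectral Partition on the graph `G` with parameter `d`:
`W` is the eigenspace of the trimmed adjacency matrix for the top two eigenvalues, `v₁` is the
projection of the all-ones vector on `W`, `v₂` is a unit vector in `W` perpendicular to `v₁`, `U₁`
is the half of the vertices with the top values in `v₂`, and `U₂` is the rest. This is a relation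
because of the arbitrary choices that are left open: the sign of `v₂`, the way in which ties are
broken, and `W` in the case of a multiple eigenvalue. -/
def IsSpectralPartition (G : SimpleGraph V) (d : ℝ) (U₁ U₂ : Set V) : Prop :=
  ∃ (W : Submodule ℝ (EuclideanSpace ℝ V)) (v₂ : EuclideanSpace ℝ V),
    IsTopTwoEigenspace (trimmed G d) W ∧
    v₂ ∈ W ∧ ‖v₂‖ = 1 ∧ inner ℝ (W.starProjection allOnes) v₂ = 0 ∧
    U₂ = U₁ᶜ ∧ 2 * U₁.ncard = Fintype.card V ∧
    ∀ u ∈ U₁, ∀ w ∈ U₂, v₂ w ≤ v₂ u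

/-- The bad vertices of the part `U`, when `U'` is the other part: those with at least `θ`
neighbours in `U'`. -/
def bad (B : SimpleGraph V) (θ : ℝ) (U U' : Set V) : Set V :=
  {u ∈ U | θ ≤ ((B.neighborSet u ∩ U').ncard : ℝ)}

/-- The corrected version of the part `U`, when `U'` is the other part: the bad vertices of `U`
are deleted and those of `U'` are added. -/
def corrected (B : SimpleGraph V) (θ : ℝ) (U U' : Set V) : Set V :=
  (U \ bad B θ U U') ∪ bad B θ U' U

/-- `(U₁, U₂)` is a possible output of Partition on the graph `G` with parameters `a, b` and
the colouring `c`: Spectral Partition with `d = a + b` is run on the Red graph, and its output is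
corrected on the Blue graph with the threshold `(a + b) / 4`. -/
def IsPartitionOutput (G : SimpleGraph V) (a b : ℝ) (c : Sym2 V → Bool) (U₁ U₂ : Set V) : Prop :=
  ∃ T₁ T₂ : Set V,
    IsSpectralPartition (colourClass G c true) (a + b) T₁ T₂ ∧
    U₁ = corrected (colourClass G c false) ((a + b) / 4) T₁ T₂ ∧
    U₂ = corrected (colourClass G c false) ((a + b) / 4) T₂ T₁

end Algorithm

/-! ### The quality of the output -/

/-- `|V_i ∩ U_i| ≥ (1 - γ) n` for `i = 1, 2`. -/
def IsCorrectLabelled (n : ℕ) (γ : ℝ) (U₁ U₂ : Set (Vertex n)) : Prop :=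
  (1 - γ) * n ≤ ((block₁ n ∩ U₁).ncard : ℝ) ∧ (1 - γ) * n ≤ ((block₂ n ∩ U₂).ncard : ℝ)

/-- The unordered collection `U₁, U₂` is a `γ`-correct partition: it is a partition of the vertex
set that is `γ`-correct for one of the two ways of numbering its parts. (The two blocks
are exchangeable, so no algorithm can tell which of them is called `V₁`.) -/
def IsCorrectPartition (n : ℕ) (γ : ℝ) (U₁ U₂ : Set (Vertex n)) : Prop :=
  U₁ ∪ U₂ = Set.univ ∧ Disjoint U₁ U₂ ∧
    (IsCorrectLabelled n γ U₁ U₂ ∨ IsCorrectLabelled n γ U₂ U₁)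

/-- The event, in the graph and the colouring, that Partition has an output and that every possible
output is a `γ`-correct partition. -/
def success (n : ℕ) (a b γ : ℝ) : Set ((Sym2 (Vertex n) → Bool) × (Sym2 (Vertex n) → Bool)) :=
  {ω | (∃ U₁ U₂, IsPartitionOutput (graphOf ω.1) a b ω.2 U₁ U₂) ∧
    ∀ U₁ U₂, IsPartitionOutput (graphOf ω.1) a b ω.2 U₁ U₂ → IsCorrectPartition n γ U₁ U₂}

end BlockModel

/-! Put d = a + b, m = (a - b)/2, x = (a - b)²/(a + b) = 4m²/d and N = 2n. Each colour class is
itself a block model with halved probabilities. Its mean matrix has the all-ones vector as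
eigenvector for d/2 and the block signs σ as eigenvector for m. With high probability the spectral
stage leaves fewer than N exp(-0.13x) errors on either side. The correction stage turns every
bisection of that quality into one with at most 4n exp(-0.124x) errors in each block. The correction
is the bottleneck. A vertex expects about d/4 - m/2 Blue neighbours across and is bad from d/4 on,
which has Chernoff exponent about x/8. The hypothesis says 2 exp(-x/8.1) ≤ γ, and 1/8.1 < 0.124 <
1/8. A small bound on γ makes x as large as needed. The noise Δ (trimmed Red adjacency matrix minus
its mean) has norm at most 17000 √d, a small multiple of m (`normBound_prob`). The proof is the
Kahn–Szemerédi argument: light pairs are handled by exponential moments on lattice vectors, heavy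
pairs by discrepancy (`heavy_sum_le`). Norm perturbation alone would only bound the fraction of
errors by a constant times 1/x, so the eigenvectors are studied entry by entry. A scaled eigenvector
satisfies X = a + bσ + ΔX/l. By `spectral_coefficients` the coefficients in the combination v₂ of
the two eigenvectors behave as if it were sσ + (s/m)Δσ with s = ±1. Let S contain the vertices of
wrong sign and those with a large eigenvector entry. Outside S, X is compared with the solution of
the eigenvector equation restricted to the complement, which does not depend on the edges that leave
S. Hence on S the noise ΔX is close in mean square to what the two block counts predict
(`IsEigen.restrict`). On most of S this forces σ_u Σ_{w ∉ S} σ_w (edge - mean) ≤ -0.9m, and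
`signBound_prob` excludes this simultaneously for all S with at least N exp(-0.13x) elements
(`card_wrong_sign_lt`). Red and Blue are not independent, but independence is not needed:
`fewBad_prob` treats all bisections with few errors at once. A bisection is determined by its two
error sets, and since 0.13 > 0.124 their number is negligible in the union bound. -/

namespace BlockModel

/-! ### Independent coins and exponential moments -/

/-- The law of independent coins with success probabilities `p e`. -/
noncomputable def coins {E : Type*} [Fintype E] (p : E → ℝ) : Measure (E → Bool) :=
  Measure.pi fun e => coin (p e)

instance (p : ℝ) : IsProbabilityMeasure (coin p) := by
  unfold coin; infer_instance

instance {E : Type*} [Fintype E] (p : E → ℝ) : IsProbabilityMeasure (coins p) := by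
  unfold coins; infer_instance

/-- The indicator of success, as a real number. -/
def ind (b : Bool) : ℝ := if b then 1 else 0

@[simp] lemma ind_true : ind true = 1 := rfl
@[simp] lemma ind_false : ind false = 0 := rfl

lemma ind_nonneg (b : Bool) : 0 ≤ ind b := by cases b <;> simp

/-- The remainder `exp z - 1 - z` of the exponential series. -/
noncomputable def expRem (z : ℝ) : ℝ := Real.exp z - 1 - z

lemma expRem_nonneg (z : ℝ) : 0 ≤ expRem z := by
  have := Real.add_one_le_exp z
  unfold expRem; linarith

@[simp] lemma expRem_zero : expRem 0 = 0 := by simp [expRem]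

lemma integral_coin {p : ℝ} (h0 : 0 ≤ p) (h1 : p ≤ 1) (f : Bool → ℝ) :
    ∫ z, f z ∂coin p = p * f true + (1 - p) * f false := by
  unfold coin
  rw [integral_bernoulliMeasure, Set.projIcc_of_mem _ ⟨h0, h1⟩]
  simp

/-- This is the Poisson form of the moment bound, from `1 + y ≤ exp y`. Keeping `expRem` instead of
a quadratic bound preserves the exact Chernoff exponent that the correction stage needs. -/
lemma integral_exp_coin_le {p : ℝ} (h0 : 0 ≤ p) (h1 : p ≤ 1) (c : ℝ) :
    ∫ z, Real.exp (c * (ind z - p)) ∂coin p ≤ Real.exp (p * expRem c) := by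
  rw [integral_coin h0 h1]
  have h : p * Real.exp (c * (ind true - p)) + (1 - p) * Real.exp (c * (ind false - p))
      = Real.exp (-(c * p)) * (p * (Real.exp c - 1) + 1) := by
    have e1 : Real.exp (c * (ind true - p)) = Real.exp (-(c * p)) * Real.exp c := by
      rw [← Real.exp_add]; congr 1; simp; ring
    have e2 : Real.exp (c * (ind false - p)) = Real.exp (-(c * p)) := by
      congr 1; simp
    rw [e1, e2]; ring
  rw [h]
  calc _ ≤ Real.exp (-(c * p)) * Real.exp (p * (Real.exp c - 1)) := by
        gcongr; exact Real.add_one_le_exp _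
    _ = _ := by rw [← Real.exp_add]; congr 1; unfold expRem; ring

lemma integral_exp_coins_le {E : Type*} [Fintype E] {p : E → ℝ} (h0 : ∀ e, 0 ≤ p e)
    (h1 : ∀ e, p e ≤ 1) (c : E → ℝ) :
    ∫ R, Real.exp (∑ e, c e * (ind (R e) - p e)) ∂coins p
      ≤ Real.exp (∑ e, p e * expRem (c e)) := by
  simp_rw [Real.exp_sum]
  unfold coins
  rw [integral_fintype_prod_eq_prod (f := fun e z => Real.exp (c e * (ind z - p e)))]
  exact Finset.prod_le_prod (fun e _ => integral_nonneg fun _ => (Real.exp_pos _).le)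
    fun e _ => integral_exp_coin_le (h0 e) (h1 e) _

/-- The exponential moment bound for coefficients that depend on some of the coins, and vanish on
these coins. -/
lemma integral_exp_coins_cond_le {E : Type*} [Fintype E] {p : E → ℝ} (h0 : ∀ e, 0 ≤ p e)
    (h1 : ∀ e, p e ≤ 1) (D : Set E) (c : (E → Bool) → E → ℝ)
    (hdep : ∀ R R' : E → Bool, (∀ e ∈ D, R e = R' e) → c R = c R')
    (hzero : ∀ R, ∀ e ∈ D, c R e = 0) {K : ℝ} (hK : ∀ R, ∑ e, p e * expRem (c R e) ≤ K) :
    ∫ R, Real.exp (∑ e, c R e * (ind (R e) - p e)) ∂coins p ≤ Real.exp K := by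
  classical
  -- Fubini: once the coins in `D` are fixed, the coefficients are constants, and the bound for
  -- constant coefficients applies to the remaining coins. Uniformity of `K` removes the outer
  -- integral.
  have hmp := measurePreserving_piEquivPiSubtypeProd (fun e => coin (p e)) (· ∈ D)
  set φ := MeasurableEquiv.piEquivPiSubtypeProd (fun _ : E => Bool) (· ∈ D)
  have key := hmp.integral_comp'
    (fun y => Real.exp (∑ e, c (φ.symm y) e * (ind (φ.symm y e) - p e)))
  simp only [MeasurableEquiv.symm_apply_apply] at key
  unfold coins
  rw [key, integral_prod _ Integrable.of_finite]
  have hin : ∀ y : {e // e ∈ D} → Bool,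
      ∫ z : {e // e ∉ D} → Bool, Real.exp (∑ e, c (φ.symm (y, z)) e *
        (ind (φ.symm (y, z) e) - p e)) ∂(Measure.pi fun e : {e // e ∉ D} => coin (p e))
        ≤ Real.exp K := by
    intro y
    have hval : ∀ z, ∀ e, φ.symm (y, z) e = if h : e ∈ D then y ⟨e, h⟩ else z ⟨e, h⟩ :=
      fun z e => rfl
    have hc : ∀ z, c (φ.symm (y, z)) = c (φ.symm (y, fun _ => false)) := by
      intro z
      apply hdep
      intro e he
      simp [hval, he]
    set c0 := c (φ.symm (y, fun _ => false)) with hc0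
    have hsum : ∀ z, (∑ e, c (φ.symm (y, z)) e * (ind (φ.symm (y, z) e) - p e))
        = ∑ e : {e // e ∉ D}, c0 e * (ind (z e) - p e) := by
      intro z
      rw [hc z]
      have h1 : ∑ e, c0 e * (ind (φ.symm (y, z) e) - p e)
          = ∑ e ∈ Finset.univ.filter (fun e => e ∉ D), c0 e * (ind (φ.symm (y, z) e) - p e) := by
        rw [Finset.sum_filter]
        refine Finset.sum_congr rfl fun e _ => ?_
        by_cases h : e ∈ D
        · rw [hc0, hzero _ e h]; simp
        · simp [h]
      rw [h1, Finset.sum_subtype (Finset.univ.filter fun e => e ∉ D) (p := fun e => e ∉ D)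
        (by simp) (fun e => c0 e * (ind (φ.symm (y, z) e) - p e))]
      refine Finset.sum_congr rfl fun e _ => ?_
      rw [hval, dif_neg e.2]
    simp_rw [hsum]
    refine (integral_exp_coins_le (p := fun e : {e // e ∉ D} => p e) (fun e => h0 e)
      (fun e => h1 e) (fun e => c0 e)).trans ?_
    refine Real.exp_le_exp.2 (le_trans ?_ (hK (φ.symm (y, fun _ => false))))
    rw [← Finset.sum_subtype (Finset.univ.filter fun e => e ∉ D) (by simp)
      (fun e => p e * expRem (c0 e))]
    exact Finset.sum_le_sum_of_subset_of_nonneg (Finset.filter_subset _ _)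
      fun e _ _ => mul_nonneg (h0 e) (expRem_nonneg _)
  calc _ ≤ ∫ _ : {e // e ∈ D} → Bool, Real.exp K ∂(Measure.pi fun e : {e // e ∈ D} => coin (p e)) :=
        integral_mono Integrable.of_finite Integrable.of_finite hin
    _ = _ := by simp

/-- The Chernoff bound for coefficients that depend on some of the coins, and vanish on these. -/
lemma coins_chernoff {E : Type*} [Fintype E] {p : E → ℝ} (h0 : ∀ e, 0 ≤ p e)
    (h1 : ∀ e, p e ≤ 1) (D : Set E) (c : (E → Bool) → E → ℝ)
    (hdep : ∀ R R' : E → Bool, (∀ e ∈ D, R e = R' e) → c R = c R')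
    (hzero : ∀ R, ∀ e ∈ D, c R e = 0) {K : ℝ} (hK : ∀ R, ∑ e, p e * expRem (c R e) ≤ K) (t : ℝ) :
    (coins p).real {R | t ≤ ∑ e, c R e * (ind (R e) - p e)} ≤ Real.exp (K - t) := by
  have h := integral_exp_coins_cond_le h0 h1 D c hdep hzero hK
  have hm := mul_meas_ge_le_integral_of_nonneg (μ := coins p)
    (f := fun R => Real.exp (∑ e, c R e * (ind (R e) - p e)))
    (ae_of_all _ fun _ => (Real.exp_pos _).le) Integrable.of_finite (Real.exp t)
  simp only [Real.exp_le_exp] at hm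
  rw [Real.exp_sub, le_div_iff₀ (Real.exp_pos _), mul_comm]
  exact hm.trans h

/-! ### Union bounds -/

lemma coins_exists_le {E ι : Type*} [Fintype E] (p : E → ℝ) (s : Finset ι)
    (P : ι → (E → Bool) → Prop) :
    (coins p).real {R | ∃ i ∈ s, P i R} ≤ ∑ i ∈ s, (coins p).real {R | P i R} := by
  have : {R | ∃ i ∈ s, P i R} = ⋃ i ∈ s, {R | P i R} := by ext; simp
  rw [this]
  exact measureReal_biUnion_finset_le _ _

/-- An upper bound for the logarithm of the number of `k`-subsets of a set of size `N`. -/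
noncomputable def entropy (N k : ℝ) : ℝ := k * (1 + Real.log (N / k))

/-- Combine `N.choose k ≤ N ^ k / k!` with `k ^ k / k! ≤ exp k`. -/
lemma choose_le_exp_entropy (N k : ℕ) : (N.choose k : ℝ) ≤ Real.exp (entropy N k) := by
  rcases Nat.eq_zero_or_pos k with rfl | hk
  · simp [entropy]
  rcases Nat.eq_zero_or_pos N with rfl | hN
  · rw [Nat.choose_eq_zero_of_lt hk]; simpa using (Real.exp_pos _).le
  have hk' : (0 : ℝ) < k := by exact_mod_cast hk
  have hN' : (0 : ℝ) < N := by exact_mod_cast hN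
  have h1 := Nat.choose_le_pow_div (α := ℝ) k N
  have h2 := Real.pow_div_factorial_le_exp (k : ℝ) hk'.le k
  have h3 : Real.exp (entropy N k) = (N / k : ℝ) ^ k * Real.exp k := by
    unfold entropy
    rw [mul_add, mul_one, Real.exp_add, mul_comm, ← Real.log_pow, Real.exp_log (by positivity)]
  rw [h3]
  calc (N.choose k : ℝ) ≤ (N : ℝ) ^ k / k.factorial := h1
    _ = (N / k : ℝ) ^ k * ((k : ℝ) ^ k / k.factorial) := by
        rw [div_pow]; field_simp
    _ ≤ _ := by gcongr

/-- Each cardinality contributes at most 1. So a union bound over all subsets costs only a factor N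
+ 1 once each subset pays its own entropy. -/
lemma sum_exp_neg_entropy_le (V : Type*) [Fintype V] :
    ∑ S : Finset V, Real.exp (-entropy (Fintype.card V) S.card) ≤ Fintype.card V + 1 := by
  have h := Finset.sum_powerset_apply_card
    (fun k : ℕ => Real.exp (-entropy (Fintype.card V) k)) (x := (Finset.univ : Finset V))
  rw [Finset.powerset_univ] at h
  rw [h, Finset.card_univ]
  calc _ ≤ ∑ m ∈ Finset.range (Fintype.card V + 1), (1 : ℝ) := by
        refine Finset.sum_le_sum fun m _ => ?_
        rw [nsmul_eq_mul, Real.exp_neg, ← div_eq_mul_inv, div_le_one (Real.exp_pos _)]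
        exact choose_le_exp_entropy _ _
    _ = _ := by simp

/-- A union bound over all sets of vertices. -/
lemma coins_exists_set_le {E V : Type*} [Fintype E] [Fintype V] (p : E → ℝ)
    (P : Finset V → (E → Bool) → Prop) {δ : ℝ}
    (h : ∀ S, (coins p).real {R | P S R} ≤ δ * Real.exp (-entropy (Fintype.card V) S.card)) :
    (coins p).real {R | ∃ S, P S R} ≤ δ * (Fintype.card V + 1) := by
  classical
  have h1 := coins_exists_le p (Finset.univ : Finset (Finset V)) P
  simp only [Finset.mem_univ, true_and] at h1
  have hδ : 0 ≤ δ := by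
    have := (measureReal_nonneg (μ := coins p)).trans (h ∅)
    exact nonneg_of_mul_nonneg_left this (Real.exp_pos _)
  calc _ ≤ _ := h1
    _ ≤ ∑ S : Finset V, δ * Real.exp (-entropy (Fintype.card V) S.card) :=
        Finset.sum_le_sum fun S _ => h S
    _ ≤ _ := by
        rw [← Finset.mul_sum]
        exact mul_le_mul_of_nonneg_left (sum_exp_neg_entropy_le V) hδ

end BlockModel

namespace BlockModel

/-! ### Sums over ordered pairs of vertices -/

section Pairs

variable {V : Type*}

open scoped Classical in
/-- The entry of the adjacency matrix of the graph with edge indicator `R`. -/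
noncomputable def edge (R : Sym2 V → Bool) (i j : V) : ℝ :=
  if i = j then 0 else ind (R s(i, j))

lemma edge_nonneg (R : Sym2 V → Bool) (i j : V) : 0 ≤ edge R i j := by
  unfold edge; split_ifs <;> simp [ind_nonneg]

lemma edge_symm (R : Sym2 V → Bool) (i j : V) : edge R i j = edge R j i := by
  by_cases h : i = j
  · rw [h]
  · simp [edge, h, Ne.symm h, Sym2.eq_swap (a := i)]

@[simp] lemma edge_self (R : Sym2 V → Bool) (i : V) : edge R i i = 0 := by simp [edge]

variable [Fintype V]

open scoped Classical in
/-- The sum of the coefficients of the ordered pairs that represent `e`. -/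
noncomputable def pairSum (c : V → V → ℝ) (e : Sym2 V) : ℝ :=
  ∑ q : V × V with s(q.1, q.2) = e, c q.1 q.2

/-- An off-diagonal pair has two ordered representatives. A diagonal pair has only one, and the
hypothesis makes its coefficient zero, so the formula holds there too. -/
lemma pairSum_mk {c : V → V → ℝ} (hc : ∀ i, c i i = 0) (i j : V) :
    pairSum c s(i, j) = c i j + c j i := by
  classical
  unfold pairSum
  rcases eq_or_ne i j with rfl | hij
  · rw [Finset.sum_eq_zero]
    · simp [hc]
    · rintro ⟨a, b⟩ hq
      simp only [Finset.mem_filter, Finset.mem_univ, true_and, Sym2.eq_iff] at hq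
      rcases hq with ⟨rfl, rfl⟩ | ⟨rfl, rfl⟩ <;> exact hc _
  · have : (Finset.univ.filter fun q : V × V => s(q.1, q.2) = s(i, j)) = {(i, j), (j, i)} := by
      ext ⟨a, b⟩; simp
    rw [this, Finset.sum_pair (by simp [hij])]

lemma sum_pairSum (g : Sym2 V → ℝ) (c : V → V → ℝ) :
    ∑ e, pairSum c e * g e = ∑ i, ∑ j, c i j * g s(i, j) := by
  classical
  have h : ∀ e, pairSum c e * g e
      = ∑ q : V × V with s(q.1, q.2) = e, c q.1 q.2 * g s(q.1, q.2) := by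
    intro e
    unfold pairSum
    rw [Finset.sum_mul]
    refine Finset.sum_congr rfl fun q hq => ?_
    rw [(Finset.mem_filter.1 hq).2]
  simp_rw [h]
  rw [Finset.sum_fiberwise, Fintype.sum_prod_type]

lemma sum_edge_sub (p : Sym2 V → ℝ) {c : V → V → ℝ} (hc : ∀ i, c i i = 0) (R : Sym2 V → Bool) :
    ∑ i, ∑ j, c i j * (edge R i j - p s(i, j)) = ∑ e, pairSum c e * (ind (R e) - p e) := by
  rw [sum_pairSum (fun e => ind (R e) - p e)]
  refine Finset.sum_congr rfl fun i _ => Finset.sum_congr rfl fun j _ => ?_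
  rcases eq_or_ne i j with rfl | hij
  · simp [hc]
  · simp [edge, hij]

/-- To bound a sum over unordered pairs, it suffices to bound it for the two orders. -/
lemma sum_expRem_pairSum_le {p : Sym2 V → ℝ} (h0 : ∀ e, 0 ≤ p e) {c : V → V → ℝ}
    (hc : ∀ i, c i i = 0) {f : V → V → ℝ} (hf0 : ∀ i, f i i = 0)
    (hf : ∀ i j, expRem (c i j + c j i) ≤ f i j + f j i) :
    ∑ e, p e * expRem (pairSum c e) ≤ ∑ i, ∑ j, p s(i, j) * f i j := by
  have h := sum_pairSum p f
  calc _ ≤ ∑ e, pairSum f e * p e := by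
        refine Finset.sum_le_sum fun e _ => ?_
        induction e with
        | _ i j =>
          rw [pairSum_mk hc, pairSum_mk hf0, mul_comm]
          exact mul_le_mul_of_nonneg_right (hf i j) (h0 _)
    _ = _ := by rw [h]; simp_rw [mul_comm]

/-- This is `(exp a - exp b) ^ 2 ≥ 0`. It separates the two orientations of an edge at the price of
doubling the coefficients. -/
lemma expRem_add_le (a b : ℝ) : expRem (a + b) ≤ expRem (2 * a) / 2 + expRem (2 * b) / 2 := by
  have h : (Real.exp a - Real.exp b) ^ 2 ≥ 0 := sq_nonneg _
  have h1 : Real.exp (2 * a) = Real.exp a ^ 2 := by rw [← Real.exp_nat_mul]; norm_num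
  have h2 : Real.exp (2 * b) = Real.exp b ^ 2 := by rw [← Real.exp_nat_mul]; norm_num
  unfold expRem
  rw [Real.exp_add, h1, h2]
  nlinarith

/-- The Chernoff bound for a weighted sum of edge indicators. -/
lemma edges_chernoff {p : Sym2 V → ℝ} (h0 : ∀ e, 0 ≤ p e) (h1 : ∀ e, p e ≤ 1)
    {c : V → V → ℝ} (hc : ∀ i, c i i = 0) {K : ℝ}
    (hK : ∑ i, ∑ j, p s(i, j) * (expRem (2 * c i j) / 2) ≤ K) (t : ℝ) :
    (coins p).real {R | t ≤ ∑ i, ∑ j, c i j * (edge R i j - p s(i, j))} ≤ Real.exp (K - t) := by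
  have h := coins_chernoff h0 h1 ∅ (fun _ => pairSum c) (fun _ _ _ => rfl)
    (fun _ e he => he.elim) (K := K) (fun _ => (sum_expRem_pairSum_le h0 hc
      (f := fun i j => expRem (2 * c i j) / 2) (by simp [hc])
      (fun i j => expRem_add_le _ _)).trans hK) t
  simpa only [sum_edge_sub p hc] using h

/-- The Chernoff bound for a weighted sum of indicators of edges across a cut, where the weights
may depend on the edges on one side. -/
lemma cut_chernoff {p : Sym2 V → ℝ} (h0 : ∀ e, 0 ≤ p e) (h1 : ∀ e, p e ≤ 1)
    [DecidableEq V] (S : Finset V) (s : V → ℝ) (h : (Sym2 V → Bool) → V → ℝ)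
    (hdep : ∀ R R' : Sym2 V → Bool, (∀ i ∉ S, ∀ j ∉ S, R s(i, j) = R' s(i, j)) → h R = h R')
    {K : ℝ} (hK : ∀ R, ∑ u ∈ S, ∑ w ∈ Sᶜ, p s(u, w) * expRem (s u * h R w) ≤ K) (t : ℝ) :
    (coins p).real {R | t ≤ ∑ u ∈ S, s u * ∑ w ∈ Sᶜ, h R w * (edge R u w - p s(u, w))}
      ≤ Real.exp (K - t) := by
  set c : (Sym2 V → Bool) → V → V → ℝ := fun R i j => if i ∈ S ∧ j ∉ S then s i * h R j else 0
    with hcdef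
  have hc : ∀ R i, c R i i = 0 := fun R i => by simp [hcdef]
  have hsum : ∀ (R : Sym2 V → Bool) (F : V → V → ℝ) (G : ℝ → ℝ), G 0 = 0 →
      ∑ i, ∑ j, F i j * G (c R i j) = ∑ u ∈ S, ∑ w ∈ Sᶜ, F u w * G (s u * h R w) := by
    intro R F G hG
    rw [← Finset.sum_subset (Finset.subset_univ S)]
    · refine Finset.sum_congr rfl fun u hu => ?_
      rw [← Finset.sum_subset (Finset.subset_univ Sᶜ)]
      · refine Finset.sum_congr rfl fun w hw => ?_
        simp [hcdef, hu, Finset.mem_compl.1 hw]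
      · intro w _ hw
        simp [hcdef, hu, not_not.1 (fun h => hw (Finset.mem_compl.2 h)), hG]
    · intro u _ hu
      simp [hcdef, hu, hG]
  -- A pair across the cut has a nonzero coefficient in one orientation only, so the doubling of
  -- `expRem_add_le` is avoided. This keeps the exponents of the sign bound and of the correction
  -- stage sharp.
  have hb := coins_chernoff h0 h1 {e | ∃ i ∉ S, ∃ j ∉ S, e = s(i, j)} (fun R => pairSum (c R))
    (fun R R' hR => by
      have : h R = h R' := hdep R R' fun i hi j hj => hR _ ⟨i, hi, j, hj, rfl⟩
      simp only [hcdef, this])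
    (by
      rintro R e ⟨i, hi, j, hj, rfl⟩
      rw [pairSum_mk (hc R)]
      simp [hcdef, hi, hj]) (K := K)
    (fun R => (sum_expRem_pairSum_le h0 (hc R)
      (f := fun i j => expRem (c R i j)) (by simp [hc])
      (fun i j => by
        by_cases hi : i ∈ S <;> by_cases hj : j ∈ S <;> simp [hcdef, hi, hj])).trans
        ((hsum R (fun i j => p s(i, j)) expRem expRem_zero).trans_le (hK R))) t
  refine le_trans (le_of_eq ?_) hb
  congr 1
  ext R
  simp only [Set.mem_ofPred_eq]
  rw [← sum_edge_sub p (hc R)]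
  have := hsum R (fun i j => edge R i j - p s(i, j)) id rfl
  simp only [id] at this
  have h2 : ∑ i, ∑ j, c R i j * (edge R i j - p s(i, j))
      = ∑ u ∈ S, s u * ∑ w ∈ Sᶜ, h R w * (edge R u w - p s(u, w)) := by
    simp_rw [mul_comm (c R _ _)]
    rw [this]
    refine Finset.sum_congr rfl fun u _ => ?_
    rw [Finset.mul_sum]
    refine Finset.sum_congr rfl fun w _ => ?_
    ring
  rw [h2]

end Pairs

end BlockModel

namespace BlockModel

section Discrepancy

variable {V : Type*}

/-! ### Degrees and discrepancy -/

/-- The number of edges between `I` and `J`, where edges inside `I ∩ J` count twice. -/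
noncomputable def edgeCount (R : Sym2 V → Bool) (I J : Finset V) : ℝ :=
  ∑ i ∈ I, ∑ j ∈ J, edge R i j

lemma edgeCount_nonneg (R : Sym2 V → Bool) (I J : Finset V) : 0 ≤ edgeCount R I J :=
  Finset.sum_nonneg fun _ _ => Finset.sum_nonneg fun _ _ => edge_nonneg _ _ _

variable [Fintype V]

/-- The degree of `u`. -/
noncomputable def degree (R : Sym2 V → Bool) (u : V) : ℝ := ∑ j, edge R u j

/-- The set of edge sets with few vertices of large degree. -/
def FewHighDegrees (D : ℝ) (R : Sym2 V → Bool) : Prop :=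
  ∀ S : Finset V, (∀ u ∈ S, 10 * D ≤ degree R u) →
    (S.card : ℝ) ≤ Fintype.card V * Real.exp (-D)

/-- The derivative of `k (1 + log (N / k))` in `k` is `log (N / k)`, which is nonnegative for `k ≤
N`. The finite form uses `log t ≤ t - 1` at `t = j / i`. -/
lemma entropy_mono {N i j : ℝ} (hi : 0 < i) (hij : i ≤ j) (hj : j ≤ N) :
    entropy N i ≤ entropy N j := by
  have hj0 : 0 < j := hi.trans_le hij
  have hN : 0 < N := hj0.trans_le hj
  unfold entropy
  have h1 : Real.log (N / i) = Real.log (N / j) + Real.log (j / i) := by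
    rw [← Real.log_mul (by positivity) (by positivity)]; congr 1; field_simp
  have h2 : Real.log (j / i) ≤ j / i - 1 := Real.log_le_sub_one_of_pos (by positivity)
  have h3 : 0 ≤ Real.log (N / j) := Real.log_nonneg (by rw [le_div_iff₀ hj0]; linarith)
  have h4 : i * Real.log (j / i) ≤ j - i := by
    calc _ ≤ i * (j / i - 1) := by gcongr
      _ = _ := by field_simp
  rw [h1]
  nlinarith

lemma card_mul_sum_le {p : Sym2 V → ℝ} {D : ℝ} (hp : ∀ e, p e ≤ D / Fintype.card V)
    (I J : Finset V) : ∑ i ∈ I, ∑ j ∈ J, p s(i, j) ≤ I.card * J.card * D / Fintype.card V := by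
  calc _ ≤ ∑ i ∈ I, ∑ j ∈ J, D / (Fintype.card V : ℝ) :=
        Finset.sum_le_sum fun i _ => Finset.sum_le_sum fun j _ => hp _
    _ = _ := by simp; ring

/-- The Chernoff bound for the number of edges between two sets. -/
lemma edgeCount_chernoff {p : Sym2 V → ℝ} (h0 : ∀ e, 0 ≤ p e) (h1 : ∀ e, p e ≤ 1) {D : ℝ}
    (hp : ∀ e, p e ≤ D / Fintype.card V) (I J : Finset V) {θ : ℝ} (hθ : 0 ≤ θ) (m : ℝ) :
    (coins p).real {R | m ≤ edgeCount R I J} ≤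
      Real.exp (I.card * J.card * D / Fintype.card V * ((Real.exp (2 * θ) - 1) / 2) - θ * m) := by
  classical
  set c : V → V → ℝ := fun i j => if i ≠ j ∧ i ∈ I ∧ j ∈ J then θ else 0 with hc
  set q : ℝ := ∑ i ∈ I, ∑ j ∈ J, if i = j then 0 else p s(i, j) with hq
  have hqle : q ≤ I.card * J.card * D / Fintype.card V := by
    refine le_trans ?_ (card_mul_sum_le hp I J)
    refine Finset.sum_le_sum fun i _ => Finset.sum_le_sum fun j _ => ?_
    split_ifs
    · exact h0 _
    · exact le_rfl
  have hgen : ∀ F : V → V → ℝ, ∀ G : ℝ → ℝ, G 0 = 0 → ∑ i, ∑ j, F i j * G (c i j)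
      = ∑ i ∈ I, ∑ j ∈ J, if i = j then 0 else F i j * G θ := by
    intro F G hG
    rw [← Finset.sum_subset (Finset.subset_univ I)]
    · refine Finset.sum_congr rfl fun u hu => ?_
      rw [← Finset.sum_subset (Finset.subset_univ J)]
      · refine Finset.sum_congr rfl fun w hw => ?_
        by_cases h : u = w <;> simp [hc, hu, hw, h, hG]
      · intro w _ hw
        simp [hc, hw, hG]
    · intro u _ hu
      simp [hc, hu, hG]
  have hK : ∑ i, ∑ j, p s(i, j) * (expRem (2 * c i j) / 2) = q * (expRem (2 * θ) / 2) := by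
    rw [hgen (fun i j => p s(i, j)) (fun z => expRem (2 * z) / 2) (by simp), hq, Finset.sum_mul]
    refine Finset.sum_congr rfl fun i _ => ?_
    rw [Finset.sum_mul]
    refine Finset.sum_congr rfl fun j _ => ?_
    split_ifs <;> simp
  -- The `2 * θ` in the exponent is the price of edges inside `I ∩ J`, which are counted twice.
  have h := edges_chernoff h0 h1 (c := c) (by simp [hc]) hK.le (θ * (m - q))
  have hset : ∀ R, ∑ i, ∑ j, c i j * (edge R i j - p s(i, j)) = θ * (edgeCount R I J - q) := by
    intro R
    have := hgen (fun i j => edge R i j - p s(i, j)) id rfl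
    simp only [id] at this
    simp_rw [mul_comm (c _ _)]
    rw [this, edgeCount, hq, ← Finset.sum_sub_distrib, Finset.mul_sum]
    refine Finset.sum_congr rfl fun i _ => ?_
    rw [← Finset.sum_sub_distrib, Finset.mul_sum]
    refine Finset.sum_congr rfl fun j _ => ?_
    split_ifs with hij
    · subst hij; simp
    · ring
  refine le_trans (measureReal_mono ?_) (h.trans (Real.exp_le_exp.2 ?_))
  · intro R hR
    simp only [Set.mem_ofPred_eq, hset] at hR ⊢
    gcongr
  · have he : 0 ≤ (Real.exp (2 * θ) - 1) / 2 := by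
      have := Real.one_le_exp (x := 2 * θ) (by linarith)
      linarith
    have := mul_le_mul_of_nonneg_right hqle he
    unfold expRem
    nlinarith

lemma fewHighDegrees_prob {p : Sym2 V → ℝ} (h0 : ∀ e, 0 ≤ p e) (h1 : ∀ e, p e ≤ 1) {D : ℝ}
    (hD : 1 ≤ D) (hp : ∀ e, p e ≤ D / Fintype.card V) :
    (coins p).real {R | ¬ FewHighDegrees D R} ≤
      Real.exp (-(Fintype.card V * Real.exp (-D))) * (Fintype.card V + 1) := by
  have hset : {R : Sym2 V → Bool | ¬ FewHighDegrees D R} = {R | ∃ S : Finset V,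
      (∀ u ∈ S, 10 * D ≤ degree R u) ∧ Fintype.card V * Real.exp (-D) < S.card} := by
    ext R; simp [FewHighDegrees]
  rw [hset]
  apply coins_exists_set_le
  intro S
  by_cases hS : Fintype.card V * Real.exp (-D) < S.card
  swap
  · simp only [hS, and_false]
    rw [show {R : Sym2 V → Bool | False} = ∅ from rfl]
    simp only [measureReal_empty]
    positivity
  have hS0 : (0 : ℝ) < S.card := lt_of_le_of_lt (by positivity) hS
  have hNN : (S.card : ℝ) ≤ Fintype.card V := by exact_mod_cast S.card_le_univ
  have hN : (0 : ℝ) < Fintype.card V := hS0.trans_le hNN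
  -- With tilt 1/2 the exponent is below -4D per vertex of `S`, because (e - 1)/2 < 0.86. The
  -- entropy costs at most 1 + D per vertex, and at most 1 more is needed for the final factor.
  have h := edgeCount_chernoff h0 h1 hp S Finset.univ (θ := 1 / 2) (by norm_num) (10 * D * S.card)
  refine le_trans (measureReal_mono ?_) (h.trans ?_)
  · rintro R ⟨hR, -⟩
    show 10 * D * S.card ≤ edgeCount R S Finset.univ
    calc 10 * D * S.card = ∑ u ∈ S, 10 * D := by simp; ring
      _ ≤ _ := Finset.sum_le_sum fun u hu => hR u hu
  · rw [← Real.exp_add]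
    refine Real.exp_le_exp.2 ?_
    have he : Real.exp (2 * (1 / 2)) < 2.7182818286 := by
      rw [show (2 : ℝ) * (1 / 2) = 1 by norm_num]; exact Real.exp_one_lt_d9
    rw [Finset.card_univ, show (S.card * Fintype.card V * D / Fintype.card V : ℝ) = S.card * D by
      field_simp]
    have hlog : Real.log (Fintype.card V / S.card) ≤ D := by
      rw [Real.log_le_iff_le_exp (by positivity), div_le_iff₀ hS0]
      have := mul_lt_mul_of_pos_left hS (Real.exp_pos D)
      rw [mul_left_comm, ← Real.exp_add] at this
      simp at this
      exact this.le
    unfold entropy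
    have : S.card * D * ((Real.exp (2 * (1 / 2)) - 1) / 2) ≤ S.card * D * (0.86 : ℝ) := by
      gcongr; linarith
    have h4 := mul_le_mul_of_nonneg_left hlog hS0.le
    nlinarith

/-- The discrepancy property of a sparse random graph. -/
def Discrepancy (D : ℝ) (R : Sym2 V → Bool) : Prop :=
  ∀ J I : Finset V, I.Nonempty → I.card ≤ J.card →
    edgeCount R I J ≤ Real.exp 2 * (I.card * J.card * D / Fintype.card V) ∨
    edgeCount R I J * Real.log (edgeCount R I J / (I.card * J.card * D / Fintype.card V)) ≤
      32 * entropy (Fintype.card V) J.card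

lemma edgeCount_eq_natCast (R : Sym2 V → Bool) (I J : Finset V) :
    ∃ m : ℕ, m ∈ Finset.range (Fintype.card V ^ 2 + 1) ∧ edgeCount R I J = m := by
  classical
  refine ⟨∑ i ∈ I, ∑ j ∈ J, if edge R i j = 1 then 1 else 0, ?_, ?_⟩
  · rw [Finset.mem_range, Nat.lt_succ_iff]
    calc _ ≤ ∑ i ∈ I, ∑ j ∈ J, 1 := by
          refine Finset.sum_le_sum fun i _ => Finset.sum_le_sum fun j _ => ?_
          split_ifs <;> simp
      _ = I.card * J.card := by simp
      _ ≤ _ := by rw [sq]; exact Nat.mul_le_mul I.card_le_univ J.card_le_univ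
  · unfold edgeCount
    push_cast
    refine Finset.sum_congr rfl fun i _ => Finset.sum_congr rfl fun j _ => ?_
    by_cases hij : i = j
    · simp [edge, hij]
    · cases h : R s(i, j) <;> simp [edge, hij, h]

/-- The tilt is half of ℓ = log(m/μ). Since ℓ ≥ 2, half of the gain mℓ/2 absorbs (m - μ)/2, and what
remains is mℓ/4 > 8H for the entropy H. The union runs over the at most N² + 1 integer values of the
count. -/
lemma edgeCount_discrepancy_prob {p : Sym2 V → ℝ} (h0 : ∀ e, 0 ≤ p e) (h1 : ∀ e, p e ≤ 1) {D : ℝ}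
    (hD : 0 < D) (hp : ∀ e, p e ≤ D / Fintype.card V) (I J : Finset V) (hI : I.Nonempty)
    (hIJ : I.card ≤ J.card) :
    (coins p).real {R | ¬ (edgeCount R I J ≤ Real.exp 2 * (I.card * J.card * D / Fintype.card V) ∨
      edgeCount R I J * Real.log (edgeCount R I J / (I.card * J.card * D / Fintype.card V)) ≤
        32 * entropy (Fintype.card V) J.card)} ≤
      (Fintype.card V ^ 2 + 1) * Real.exp (-8 * entropy (Fintype.card V) J.card) := by
  have hI0 : (0 : ℝ) < I.card := by exact_mod_cast hI.card_pos
  have hJ0 : (0 : ℝ) < J.card := by exact_mod_cast hI.card_pos.trans_le hIJ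
  have hN : (0 : ℝ) < Fintype.card V := hI0.trans_le (by exact_mod_cast I.card_le_univ)
  set μ : ℝ := I.card * J.card * D / Fintype.card V with hμ
  have hμ0 : 0 < μ := by positivity
  set H := entropy (Fintype.card V) J.card
  have hincl : {R | ¬ (edgeCount R I J ≤ Real.exp 2 * μ ∨
      edgeCount R I J * Real.log (edgeCount R I J / μ) ≤ 32 * H)} ⊆
      {R | ∃ m ∈ Finset.range (Fintype.card V ^ 2 + 1), edgeCount R I J = (m : ℝ) ∧
        Real.exp 2 * μ < m ∧ 32 * H < m * Real.log (m / μ)} := by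
    intro R hR
    obtain ⟨m, hm, hRm⟩ := edgeCount_eq_natCast R I J
    simp only [Set.mem_ofPred_eq, hRm, not_or, not_le] at hR ⊢
    exact ⟨m, hm, rfl, hR⟩
  refine (measureReal_mono hincl).trans ((coins_exists_le p _ _).trans ?_)
  calc _ ≤ ∑ m ∈ Finset.range (Fintype.card V ^ 2 + 1), Real.exp (-8 * H) := by
        refine Finset.sum_le_sum fun m _ => ?_
        by_cases hm : Real.exp 2 * μ < m ∧ 32 * H < m * Real.log (m / μ)
        swap
        · simp only [hm, and_false]
          rw [show {R : Sym2 V → Bool | False} = ∅ from rfl]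
          simp only [measureReal_empty]
          positivity
        have hm0 : (0 : ℝ) < m := lt_trans (by positivity) hm.1
        have hL : 2 ≤ Real.log (m / μ) := by
          rw [Real.le_log_iff_exp_le (by positivity), le_div_iff₀ hμ0]; exact hm.1.le
        have h := edgeCount_chernoff h0 h1 hp I J (θ := Real.log (m / μ) / 2) (by linarith) m
        refine le_trans (measureReal_mono ?_) (h.trans (Real.exp_le_exp.2 ?_))
        · rintro R ⟨hR, -⟩
          exact hR.symm.le
        · rw [mul_div_cancel₀ _ (two_ne_zero), Real.exp_log (by positivity), ← hμ]
          have : μ * ((m / μ - 1) / 2) = (m - μ) / 2 := by field_simp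
          rw [this]
          nlinarith [hm.2]
    _ = _ := by simp

lemma discrepancy_prob {p : Sym2 V → ℝ} (h0 : ∀ e, 0 ≤ p e) (h1 : ∀ e, p e ≤ 1) {D : ℝ}
    (hD : 0 < D) (hp : ∀ e, p e ≤ D / Fintype.card V) (hN : 0 < Fintype.card V) :
    (coins p).real {R | ¬ Discrepancy D R} ≤ 8 / Fintype.card V := by
  set N : ℝ := (Fintype.card V : ℝ) with hNdef
  have hN1 : (1 : ℝ) ≤ N := by rw [hNdef]; exact_mod_cast hN
  have hset : {R : Sym2 V → Bool | ¬ Discrepancy D R} = {R | ∃ J I : Finset V, (I.Nonempty ∧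
      I.card ≤ J.card) ∧ ¬ (edgeCount R I J ≤ Real.exp 2 * (I.card * J.card * D / N) ∨
      edgeCount R I J * Real.log (edgeCount R I J / (I.card * J.card * D / N)) ≤
        32 * entropy N J.card)} := by
    ext R; simp only [Discrepancy, Set.mem_ofPred_eq, not_forall, exists_prop, and_assoc]; rfl
  rw [hset]
  have hJ : ∀ J : Finset V, (coins p).real {R | ∃ I : Finset V, (I.Nonempty ∧
      I.card ≤ J.card) ∧ ¬ (edgeCount R I J ≤ Real.exp 2 * (I.card * J.card * D / N) ∨
      edgeCount R I J * Real.log (edgeCount R I J / (I.card * J.card * D / N)) ≤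
        32 * entropy N J.card)} ≤ (N ^ 2 + 1) * (N + 1) / N ^ 6 * Real.exp (-entropy N J.card) := by
    intro J
    rcases Finset.eq_empty_or_nonempty J with rfl | hJne
    · have : {R : Sym2 V → Bool | ∃ I : Finset V, (I.Nonempty ∧
        I.card ≤ (∅ : Finset V).card) ∧ ¬ (edgeCount R I ∅ ≤
        Real.exp 2 * (I.card * (∅ : Finset V).card * D / N) ∨
        edgeCount R I ∅ * Real.log (edgeCount R I ∅ / (I.card * (∅ : Finset V).card * D / N)) ≤
        32 * entropy N (∅ : Finset V).card)} = ∅ := by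
        ext R
        simp only [Set.mem_ofPred_eq, Set.mem_empty_iff_false, iff_false, not_exists]
        rintro I ⟨⟨hI, hc⟩, -⟩
        have := hI.card_pos
        simp at hc
        simp [hc] at hI
      rw [this]
      simp only [measureReal_empty]
      positivity
    have hJ1 : (1 : ℝ) ≤ J.card := by exact_mod_cast hJne.card_pos
    have hJN : (J.card : ℝ) ≤ N := by rw [hNdef]; exact_mod_cast J.card_le_univ
    have hent : Real.log N ≤ entropy N J.card := by
      refine le_trans ?_ (entropy_mono one_pos hJ1 hJN)
      simp [entropy]
    have h := coins_exists_set_le p (fun I R => (I.Nonempty ∧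
      I.card ≤ J.card) ∧ ¬ (edgeCount R I J ≤ Real.exp 2 * (I.card * J.card * D / N) ∨
      edgeCount R I J * Real.log (edgeCount R I J / (I.card * J.card * D / N)) ≤
        32 * entropy N J.card)) (δ := (N ^ 2 + 1) * Real.exp (-7 * entropy N J.card)) (by
      intro I
      by_cases hI : I.Nonempty ∧ I.card ≤ J.card
      swap
      · simp only [hI, false_and]
        rw [show {R : Sym2 V → Bool | False} = ∅ from rfl]
        simp only [measureReal_empty]
        positivity
      simp only [hI, true_and]
      refine (edgeCount_discrepancy_prob h0 h1 hD hp I J hI.1 hI.2).trans ?_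
      rw [mul_assoc, ← Real.exp_add]
      refine mul_le_mul_of_nonneg_left (Real.exp_le_exp.2 ?_) (by positivity)
      have := entropy_mono (N := N) (i := I.card) (j := J.card) (by exact_mod_cast hI.1.card_pos)
        (by exact_mod_cast hI.2) hJN
      linarith)
    refine h.trans ?_
    -- Of the eight entropies, one has paid for the choice of `I` and one is kept for `J`. The
    -- remaining six give N⁻⁶, since the entropy of a nonempty set is at least log N.
    have he : Real.exp (-7 * entropy N J.card)
        ≤ Real.exp (-entropy N J.card) / N ^ 6 := by
      rw [show -7 * entropy N J.card = -entropy N J.card - 6 * entropy N J.card by ring,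
        Real.exp_sub]
      gcongr
      calc N ^ 6 = Real.exp (6 * Real.log N) := by
            rw [mul_comm, Real.exp_mul, Real.exp_log (by linarith)]
            norm_cast
        _ ≤ _ := Real.exp_le_exp.2 (by linarith)
    calc _ ≤ (N ^ 2 + 1) * (Real.exp (-entropy N J.card) / N ^ 6) * (N + 1) := by gcongr
      _ = _ := by ring
  refine (coins_exists_set_le p _ hJ).trans ?_
  rw [← hNdef, div_mul_eq_mul_div, div_le_div_iff₀ (by positivity) (by positivity)]
  have hN6 : (N ^ 2 + 1) * (N + 1) * (N + 1) * N ≤ (2 * N ^ 2) * (2 * N) * (2 * N) * N := by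
    gcongr <;> nlinarith
  calc _ ≤ _ := hN6
    _ = 8 * N ^ 5 := by ring
    _ ≤ 8 * N ^ 6 := by gcongr; linarith

end Discrepancy

end BlockModel

namespace BlockModel

/-! ### Geometric sums -/

/-- A geometric sum is at most twice its largest term. The induction needs the second bound `2 ^ n`
to absorb each new term. -/
lemma sum_two_pow_le {c : ℝ} (hc : 0 ≤ c) (n : ℕ) :
    ∑ s ∈ Finset.range n, (if (2 : ℝ) ^ s ≤ c then (2 : ℝ) ^ s else 0) ≤ 2 * c := by
  suffices h : ∑ s ∈ Finset.range n, (if (2 : ℝ) ^ s ≤ c then (2 : ℝ) ^ s else 0) ≤ 2 * c ∧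
      ∑ s ∈ Finset.range n, (if (2 : ℝ) ^ s ≤ c then (2 : ℝ) ^ s else 0) ≤ 2 ^ n from h.1
  induction n with
  | zero => simpa using hc
  | succ n ih =>
    rw [Finset.sum_range_succ, pow_succ]
    have : (0 : ℝ) < 2 ^ n := by positivity
    split_ifs with h
    · constructor <;> linarith [ih.1, ih.2]
    · constructor <;> linarith [ih.1, ih.2]

/-- The induction carries the full geometric tail `2 / 2 ^ n`, so that adding a term only splits off
part of that tail. -/
lemma sum_inv_two_pow_le {c : ℝ} (hc : 0 < c) (n : ℕ) :
    ∑ s ∈ Finset.range n, (if c < (2 : ℝ) ^ s then 1 / (2 : ℝ) ^ s else 0) ≤ 2 / c := by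
  suffices h : (c < 2 ^ n → ∑ s ∈ Finset.range n, (if c < (2 : ℝ) ^ s then 1 / (2 : ℝ) ^ s else 0)
      + 2 / 2 ^ n ≤ 2 / c) ∧ ((2 : ℝ) ^ n ≤ c →
      ∑ s ∈ Finset.range n, (if c < (2 : ℝ) ^ s then 1 / (2 : ℝ) ^ s else 0) = 0) by
    rcases lt_or_ge c (2 ^ n) with h1 | h1
    · have := h.1 h1
      have : (0 : ℝ) < 2 / 2 ^ n := by positivity
      linarith
    · rw [h.2 h1]; positivity
  induction n with
  | zero =>
    simp only [pow_zero, Finset.range_zero, Finset.sum_empty, zero_add, div_one, implies_true,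
      and_true]
    intro h
    rw [le_div_iff₀ hc]; linarith
  | succ n ih =>
    have hp : (0 : ℝ) < 2 ^ n := by positivity
    rw [Finset.sum_range_succ]
    rcases lt_or_ge c (2 ^ n) with h1 | h1
    · refine ⟨fun _ => ?_, fun h => ?_⟩
      · rw [if_pos h1]
        have := ih.1 h1
        have e : (1 : ℝ) / 2 ^ n + 2 / 2 ^ (n + 1) = 2 / 2 ^ n := by
          rw [pow_succ]; field_simp; norm_num
        linarith
      · rw [pow_succ] at h; linarith
    · rw [ih.2 h1, if_neg (not_lt.2 h1)]
      refine ⟨fun h => ?_, fun _ => by simp⟩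
      simp only [add_zero, zero_add]
      exact div_le_div_of_nonneg_left (by norm_num) hc h.le

lemma sum_three_quarters_pow_le (n : ℕ) : ∑ s ∈ Finset.range n, (3 / 4 : ℝ) ^ s ≤ 4 := by
  have h := geom_sum_eq (show (3 / 4 : ℝ) ≠ 1 by norm_num) n
  rw [h]
  have : (0 : ℝ) ≤ (3 / 4) ^ n := by positivity
  rw [div_le_iff_of_neg (by norm_num)]
  linarith

/-! ### The contribution of heavy pairs -/

/-- The contribution of the edges between two dyadic level sets with `a ≤ b` elements and levels
`P` and `Q`, under the discrepancy property. -/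
lemma heavy_bucket_le {e a b N D P Q q : ℝ} (ha : 0 < a) (hab : a ≤ b) (hbN : b ≤ N) (hP : 0 < P)
    (hQ : 0 < Q) (hq : 0 < q) (hqD : q ^ 2 = D) (hPQ : q ≤ P * Q) (he : 0 ≤ e)
    (hdeg : e ≤ 20 * D * a) (hα : a * P ^ 2 ≤ 16 * N)
    (hdisc : e ≤ Real.exp 2 * (a * b * D / N) ∨
      e * Real.log (e / (a * b * D / N)) ≤ 32 * entropy N b) :
    e * P * Q ≤ N * q * (20 * q * (a * P ^ 2 / N) / P * (if Q ≤ P / q then Q else 0)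
      + 8 * (a * P ^ 2 / N) * (b * Q ^ 2 / N)
      + 128 * (b * Q ^ 2 / N) / (Q * q) * (if P ≤ Q * q then P else 0)
      + 64 * (Real.exp ((1 + Real.log (N / b)) / 4) * (b * Q ^ 2 / N)) / (Q * q)
        * (if P ≤ q then P else 0)
      + 16 * (Real.exp ((1 + Real.log (N / b)) / 4) * (b * Q ^ 2 / N)) * q / Q
        * (if q < P then 1 / P else 0)) := by
  have hb : 0 < b := ha.trans_le hab
  have hN : 0 < N := hb.trans_le hbN
  have hD : 0 < D := by rw [← hqD]; positivity
  set ζ := Real.exp ((1 + Real.log (N / b)) / 4) with hζ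
  have hζ0 : 0 < ζ := Real.exp_pos _
  set f1 := 20 * q * (a * P ^ 2 / N) / P * (if Q ≤ P / q then Q else 0) with hf1
  set f2 := 8 * (a * P ^ 2 / N) * (b * Q ^ 2 / N) with hf2
  set f3 := 128 * (b * Q ^ 2 / N) / (Q * q) * (if P ≤ Q * q then P else 0) with hf3
  set f4 := 64 * (ζ * (b * Q ^ 2 / N)) / (Q * q) * (if P ≤ q then P else 0) with hf4
  set f5 := 16 * (ζ * (b * Q ^ 2 / N)) * q / Q * (if q < P then 1 / P else 0) with hf5
  have h1 : 0 ≤ f1 := by rw [hf1]; split_ifs <;> positivity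
  have h2 : 0 ≤ f2 := by positivity
  have h3 : 0 ≤ f3 := by rw [hf3]; split_ifs <;> positivity
  have h4 : 0 ≤ f4 := by rw [hf4]; split_ifs <;> positivity
  have h5 : 0 ≤ f5 := by rw [hf5]; split_ifs <;> positivity
  have hNq : 0 < N * q := by positivity
  -- Each summand dominates in one regime: very unequal levels (degree bound), count of the order of
  -- its mean, large logarithmic excess, and moderate excess with `P` below or above `q`.
  suffices h : e * P * Q ≤ N * q * f1 ∨ e * P * Q ≤ N * q * f2 ∨ e * P * Q ≤ N * q * f3 ∨
      e * P * Q ≤ N * q * f4 ∨ e * P * Q ≤ N * q * f5 by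
    have m1 := mul_nonneg hNq.le h1
    have m2 := mul_nonneg hNq.le h2
    have m3 := mul_nonneg hNq.le h3
    have m4 := mul_nonneg hNq.le h4
    have m5 := mul_nonneg hNq.le h5
    rcases h with h | h | h | h | h <;> linarith
  by_cases hPQ1 : Q ≤ P / q
  · left
    rw [hf1, if_pos hPQ1]
    calc e * P * Q ≤ 20 * D * a * P * Q := by gcongr
      _ = _ := by rw [← hqD]; field_simp
  right
  have hPQ2 : P ≤ Q * q := by
    rw [not_le, div_lt_iff₀ hq] at hPQ1; exact hPQ1.le
  set μ := a * b * D / N with hμ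
  have hμ0 : 0 < μ := by positivity
  by_cases hsmall : e ≤ Real.exp 2 * μ
  · left
    have he2 : Real.exp 2 ≤ 8 := by
      have := Real.exp_one_lt_d9
      have h2 : Real.exp 2 = Real.exp 1 ^ 2 := by rw [← Real.exp_nat_mul]; norm_num
      rw [h2]; nlinarith [Real.exp_pos 1]
    calc e * P * Q ≤ 8 * μ * P * Q := by gcongr; exact hsmall.trans (by gcongr)
      _ = 8 * (a * b * P * Q / N) * q * q := by rw [hμ, ← hqD]; ring
      _ ≤ 8 * (a * b * P * Q / N) * q * (P * Q) := by gcongr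
      _ = _ := by rw [hf2]; field_simp
  right
  have hd := hdisc.resolve_left hsmall
  rw [not_le] at hsmall
  have he0 : 0 < e := lt_trans (by positivity) hsmall
  set ℓ := Real.log (e / μ) with hℓ
  have hℓ2 : 2 ≤ ℓ := by
    rw [hℓ, Real.le_log_iff_exp_le (by positivity), le_div_iff₀ hμ0]; exact hsmall.le
  set L := 1 + Real.log (N / b) with hL
  have hL1 : 0 ≤ Real.log (N / b) := Real.log_nonneg (by rw [le_div_iff₀ hb]; linarith)
  have hent : entropy N b = b * L := rfl
  rw [hent] at hd
  -- The entropy is `b * L`. If the excess ℓ is a fixed part of `L`, discrepancy gives a count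
  -- linear in `b`. Otherwise e/μ is below ζ = exp(L/4), only a fourth root of eN/b.
  by_cases hbig : L / 4 ≤ ℓ
  · left
    have : e ≤ 128 * b := by
      have h' : e * (L / 4) ≤ 32 * (b * L) := (mul_le_mul_of_nonneg_left hbig he).trans hd
      have hL0 : 0 < L := by rw [hL]; linarith
      have : e * L ≤ 128 * b * L := by linarith
      exact le_of_mul_le_mul_right this hL0
    rw [hf3, if_pos hPQ2]
    calc e * P * Q ≤ 128 * b * P * Q := by gcongr
      _ = _ := by field_simp
  right
  rw [not_le] at hbig
  -- For small `P`, use ℓ ≥ 2 and L ≤ 4ζ. For large `P`, use e ≤ ζμ together with aP² ≤ 16N, which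
  -- produces the summable factor 1/P.
  by_cases hPq : P ≤ q
  · left
    have hLζ : L ≤ 4 * ζ := by
      have := Real.add_one_le_exp (L / 4)
      rw [hζ]; linarith
    have : e ≤ 64 * (b * ζ) := by
      have h' : e * 2 ≤ 32 * (b * L) := (mul_le_mul_of_nonneg_left hℓ2 he).trans hd
      have : b * L ≤ b * (4 * ζ) := by gcongr
      linarith
    rw [hf4, if_pos hPq]
    calc e * P * Q ≤ 64 * (b * ζ) * P * Q := by gcongr
      _ = _ := by field_simp
  · right
    rw [not_le] at hPq
    have : e ≤ ζ * μ := by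
      have h' : e / μ < ζ := by
        rw [hζ, ← Real.log_lt_iff_lt_exp (by positivity)]; exact hbig
      rw [div_lt_iff₀ hμ0] at h'
      exact h'.le
    rw [hf5, if_pos hPq]
    calc e * P * Q ≤ ζ * μ * P * Q := by gcongr
      _ = ζ * b * D * Q / (N * P) * (a * P ^ 2) := by rw [hμ]; field_simp
      _ ≤ ζ * b * D * Q / (N * P) * (16 * N) := by gcongr
      _ = _ := by rw [← hqD]; field_simp

/-- The fourth power of the left side is exactly e β³ / 4ᵗ with β ≤ 16. The ratio 3/4 works because
4 (3/4)⁴ > 1, and 11 because 11⁴ exceeds e · 16³. -/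
lemma level_factor_le {b N : ℝ} {t : ℕ} (hb : 0 < b) (hN : 0 < N)
    (hα : b * ((2 : ℝ) ^ t) ^ 2 ≤ 16 * N) :
    Real.exp ((1 + Real.log (N / b)) / 4) * (b * ((2 : ℝ) ^ t) ^ 2 / N) / 2 ^ t
      ≤ 11 * (3 / 4) ^ t := by
  set Q : ℝ := 2 ^ t with hQ
  have hQ0 : 0 < Q := by positivity
  set ζ := Real.exp ((1 + Real.log (N / b)) / 4) with hζ
  have hζ0 : 0 < ζ := Real.exp_pos _
  have hζ4 : ζ ^ 4 = Real.exp 1 * (N / b) := by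
    rw [hζ, ← Real.exp_nat_mul]
    rw [show ((4 : ℕ) : ℝ) * ((1 + Real.log (N / b)) / 4) = 1 + Real.log (N / b) by
      push_cast; ring, Real.exp_add, Real.exp_log (by positivity)]
  refine le_of_pow_le_pow_left₀ (n := 4) (by norm_num) (by positivity) ?_
  have hβ : b * Q ^ 2 / N ≤ 16 := by rw [div_le_iff₀ hN]; exact hα
  set β := b * Q ^ 2 / N with hβdef
  have hβ0 : 0 < β := by positivity
  have e1 : (ζ * β / Q) ^ 4 = Real.exp 1 * β ^ 3 / Q ^ 2 := by
    rw [div_pow, mul_pow, hζ4, hβdef]; field_simp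
  rw [e1]
  have he := Real.exp_one_lt_d9
  have h3 : β ^ 3 ≤ 16 ^ 3 := by gcongr
  have hQ4 : Q ^ 2 = 4 ^ t := by rw [hQ, ← pow_mul, mul_comm, pow_mul]; norm_num
  rw [hQ4, div_le_iff₀ (by positivity)]
  have h4 : (1 : ℝ) ≤ ((3 / 4) ^ t) ^ 4 * 4 ^ t := by
    rw [← pow_mul, mul_comm t 4, pow_mul, ← mul_pow]
    exact one_le_pow₀ (by norm_num)
  calc Real.exp 1 * β ^ 3 ≤ 2.7182818286 * 16 ^ 3 := by gcongr
    _ ≤ 11 ^ 4 * 1 := by norm_num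
    _ ≤ 11 ^ 4 * (((3 / 4) ^ t) ^ 4 * 4 ^ t) := by gcongr
    _ = _ := by ring

end BlockModel

namespace BlockModel

lemma edgeCount_comm {V : Type*} (R : Sym2 V → Bool) (I J : Finset V) :
    edgeCount R I J = edgeCount R J I := by
  unfold edgeCount
  rw [Finset.sum_comm]
  simp_rw [edge_symm R]

lemma edgeCount_le_degree {V : Type*} [Fintype V] (R : Sym2 V → Bool) (I J : Finset V) :
    edgeCount R I J ≤ ∑ i ∈ I, degree R i :=
  Finset.sum_le_sum fun _ _ => Finset.sum_le_sum_of_subset_of_nonneg (Finset.subset_univ _)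
    fun _ _ _ => edge_nonneg _ _ _

lemma level_term_nonneg {q α β ζ P Q : ℝ} (hq : 0 < q) (hα : 0 ≤ α) (hβ : 0 ≤ β) (hζ : 0 ≤ ζ)
    (hP : 0 < P) (hQ : 0 < Q) :
    0 ≤ 20 * q * α / P * (if Q ≤ P / q then Q else 0) + 8 * α * β
      + 128 * β / (Q * q) * (if P ≤ Q * q then P else 0)
      + 64 * (ζ * β) / (Q * q) * (if P ≤ q then P else 0)
      + 16 * (ζ * β) * q / Q * (if q < P then 1 / P else 0) := by
  split_ifs <;> positivity

/-- Each term with an indicator is summed first over the level in the indicator, as a geometric sum.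
What remains is bounded by Σ α ≤ 16 or by the decay (3/4)ᵗ. The five totals are 640, 2048, 4096,
5632 and 1408. -/
lemma level_sum_le {n : ℕ} {q : ℝ} {α ζ : ℕ → ℝ} (hq : 0 < q) (hα0 : ∀ s, 0 ≤ α s)
    (hζ0 : ∀ s, 0 ≤ ζ s) (hαsum : ∑ s ∈ Finset.range n, α s ≤ 16)
    (hfac : ∀ t ∈ Finset.range n, ζ t * α t / 2 ^ t ≤ 11 * (3 / 4) ^ t) :
    ∑ s ∈ Finset.range n, ∑ t ∈ Finset.range n,
      (20 * q * α s / 2 ^ s * (if (2 : ℝ) ^ t ≤ 2 ^ s / q then 2 ^ t else 0) + 8 * α s * α t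
      + 128 * α t / (2 ^ t * q) * (if (2 : ℝ) ^ s ≤ 2 ^ t * q then 2 ^ s else 0)
      + 64 * (ζ t * α t) / (2 ^ t * q) * (if (2 : ℝ) ^ s ≤ q then 2 ^ s else 0)
      + 16 * (ζ t * α t) * q / 2 ^ t * (if q < (2 : ℝ) ^ s then 1 / 2 ^ s else 0)) ≤ 13824 := by
  set f1 : ℕ → ℕ → ℝ := fun s t => 20 * q * α s / 2 ^ s * (if (2 : ℝ) ^ t ≤ 2 ^ s / q then 2 ^ t else 0) with hf1
  set f2 : ℕ → ℕ → ℝ := fun s t => 8 * α s * α t with hf2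
  set f3 : ℕ → ℕ → ℝ := fun s t => 128 * α t / (2 ^ t * q) * (if (2 : ℝ) ^ s ≤ 2 ^ t * q then 2 ^ s else 0) with hf3
  set f4 : ℕ → ℕ → ℝ := fun s t => 64 * (ζ t * α t) / (2 ^ t * q) * (if (2 : ℝ) ^ s ≤ q then 2 ^ s else 0) with hf4
  set f5 : ℕ → ℕ → ℝ := fun s t => 16 * (ζ t * α t) * q / 2 ^ t * (if q < (2 : ℝ) ^ s then 1 / 2 ^ s else 0) with hf5
  have s1 : ∑ s ∈ Finset.range n, ∑ t ∈ Finset.range n, f1 s t ≤ 640 := by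
    calc _ ≤ ∑ s ∈ Finset.range n, 40 * α s := by
          refine Finset.sum_le_sum fun s _ => ?_
          simp only [hf1]
          rw [← Finset.mul_sum]
          have := hα0 s
          calc _ ≤ 20 * q * α s / 2 ^ s * (2 * (2 ^ s / q)) := by
                gcongr; exact sum_two_pow_le (by positivity) n
            _ = 40 * α s := by field_simp; ring
      _ ≤ _ := by rw [← Finset.mul_sum]; linarith
  have s2 : ∑ s ∈ Finset.range n, ∑ t ∈ Finset.range n, f2 s t ≤ 2048 := by
    have : ∑ s ∈ Finset.range n, ∑ t ∈ Finset.range n, f2 s t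
        = 8 * ((∑ s ∈ Finset.range n, α s) * ∑ t ∈ Finset.range n, α t) := by
      rw [Finset.sum_mul_sum, Finset.mul_sum]
      refine Finset.sum_congr rfl fun s _ => ?_
      rw [Finset.mul_sum]
      exact Finset.sum_congr rfl fun t _ => by simp only [hf2]; ring
    rw [this]
    have h0 : 0 ≤ ∑ s ∈ Finset.range n, α s := Finset.sum_nonneg fun s _ => hα0 s
    nlinarith
  have s3 : ∑ s ∈ Finset.range n, ∑ t ∈ Finset.range n, f3 s t ≤ 4096 := by
    rw [Finset.sum_comm]
    calc _ ≤ ∑ t ∈ Finset.range n, 256 * α t := by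
          refine Finset.sum_le_sum fun t _ => ?_
          simp only [hf3]
          rw [← Finset.mul_sum]
          have := hα0 t
          calc _ ≤ 128 * α t / (2 ^ t * q) * (2 * (2 ^ t * q)) := by
                gcongr; exact sum_two_pow_le (by positivity) n
            _ = 256 * α t := by field_simp; ring
      _ ≤ _ := by rw [← Finset.mul_sum]; linarith
  have s4 : ∑ s ∈ Finset.range n, ∑ t ∈ Finset.range n, f4 s t ≤ 5632 := by
    rw [Finset.sum_comm]
    calc ∑ t ∈ Finset.range n, ∑ s ∈ Finset.range n, f4 s t
        ≤ ∑ t ∈ Finset.range n, 128 * (11 * (3 / 4) ^ t) := by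
          refine Finset.sum_le_sum fun t ht => ?_
          simp only [hf4]
          rw [← Finset.mul_sum]
          have := hα0 t
          have h3 := hζ0 t
          calc _ ≤ 64 * (ζ t * α t) / (2 ^ t * q) * (2 * q) := by
                gcongr; exact sum_two_pow_le hq.le n
            _ = 128 * (ζ t * α t / 2 ^ t) := by field_simp; ring
            _ ≤ 128 * (11 * (3 / 4) ^ t) := mul_le_mul_of_nonneg_left (hfac t ht) (by norm_num)
      _ = 128 * (11 * ∑ t ∈ Finset.range n, (3 / 4) ^ t) := by
          rw [Finset.mul_sum, Finset.mul_sum]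
      _ ≤ 5632 := by linarith [sum_three_quarters_pow_le n]
  have s5 : ∑ s ∈ Finset.range n, ∑ t ∈ Finset.range n, f5 s t ≤ 1408 := by
    rw [Finset.sum_comm]
    calc ∑ t ∈ Finset.range n, ∑ s ∈ Finset.range n, f5 s t
        ≤ ∑ t ∈ Finset.range n, 32 * (11 * (3 / 4) ^ t) := by
          refine Finset.sum_le_sum fun t ht => ?_
          simp only [hf5]
          rw [← Finset.mul_sum]
          have := hα0 t
          have h3 := hζ0 t
          calc _ ≤ 16 * (ζ t * α t) * q / 2 ^ t * (2 / q) := by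
                gcongr; exact sum_inv_two_pow_le hq n
            _ = 32 * (ζ t * α t / 2 ^ t) := by field_simp; ring
            _ ≤ 32 * (11 * (3 / 4) ^ t) := mul_le_mul_of_nonneg_left (hfac t ht) (by norm_num)
      _ = 32 * (11 * ∑ t ∈ Finset.range n, (3 / 4) ^ t) := by
          rw [Finset.mul_sum, Finset.mul_sum]
      _ ≤ 1408 := by linarith [sum_three_quarters_pow_le n]
  calc _ = ∑ s ∈ Finset.range n, ∑ t ∈ Finset.range n, f1 s t
          + ∑ s ∈ Finset.range n, ∑ t ∈ Finset.range n, f2 s t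
          + ∑ s ∈ Finset.range n, ∑ t ∈ Finset.range n, f3 s t
          + ∑ s ∈ Finset.range n, ∑ t ∈ Finset.range n, f4 s t
          + ∑ s ∈ Finset.range n, ∑ t ∈ Finset.range n, f5 s t := by
          simp_rw [← Finset.sum_add_distrib]
          rfl
    _ ≤ _ := by linarith

set_option maxHeartbeats 400000 in
/-- The heavy pairs contribute little to the quadratic form of a graph of bounded degree with the
discrepancy property. -/
lemma heavy_sum_le {V : Type*} [Fintype V] {D : ℝ} (hD : 1 ≤ D) {R : Sym2 V → Bool}
    (hdisc : Discrepancy D R) (y : V → ℕ) (hy : ∑ i, (y i : ℝ) ^ 2 ≤ 16 * Fintype.card V)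
    (hdeg : ∀ i, y i ≠ 0 → degree R i ≤ 20 * D) :
    ∑ i, ∑ j, (if 16 * √D < (y i : ℝ) * y j then edge R i j * ((y i : ℝ) * y j) else 0) ≤
      115000 * Fintype.card V * √D := by
  classical
  rcases Nat.eq_zero_or_pos (Fintype.card V) with hV | hV
  · have := Fintype.card_eq_zero_iff.1 hV
    simp
  set N : ℝ := (Fintype.card V : ℝ) with hNdef
  have hN : 0 < N := by rw [hNdef]; exact_mod_cast hV
  set q := √D with hqdef
  have hq : 0 < q := Real.sqrt_pos.2 (by linarith)
  have hqD : q ^ 2 = D := Real.sq_sqrt (by linarith)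
  set lev : V → ℕ := fun i => Nat.log 2 (y i) with hlev
  set n := Finset.univ.sup lev + 1 with hn
  have hlevn : ∀ i, lev i ∈ Finset.range n := fun i => by
    rw [Finset.mem_range, hn, Nat.lt_succ_iff]; exact Finset.le_sup (Finset.mem_univ i)
  set U := Finset.univ.filter fun i => y i ≠ 0 with hU
  set I : ℕ → Finset V := fun s => U.filter fun i => lev i = s with hI
  have hIy : ∀ s, ∀ i ∈ I s, (2 : ℝ) ^ s ≤ y i ∧ y i ≠ 0 := by
    intro s i hi
    simp only [hI, hU, Finset.mem_filter, Finset.mem_univ, true_and] at hi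
    refine ⟨?_, hi.1⟩
    rw [← hi.2]
    exact_mod_cast Nat.pow_log_le_self 2 hi.1
  set a : ℕ → ℝ := fun s => ((I s).card : ℝ) with ha
  have ha0 : ∀ s, 0 ≤ a s := fun s => Nat.cast_nonneg _
  have haN : ∀ s, a s ≤ N := fun s => by
    simp only [ha, hNdef]; exact_mod_cast (I s).card_le_univ
  set α : ℕ → ℝ := fun s => a s * ((2 : ℝ) ^ s) ^ 2 / N with hα
  have hα0 : ∀ s, 0 ≤ α s := fun s => by have := ha0 s; simp only [hα]; positivity
  have hαsum : ∑ s ∈ Finset.range n, α s ≤ 16 := by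
    simp only [hα]
    rw [← Finset.sum_div, div_le_iff₀ hN]
    refine le_trans ?_ hy
    calc _ ≤ ∑ s ∈ Finset.range n, ∑ i ∈ I s, (y i : ℝ) ^ 2 := by
          refine Finset.sum_le_sum fun s _ => ?_
          calc a s * ((2 : ℝ) ^ s) ^ 2 = ∑ i ∈ I s, ((2 : ℝ) ^ s) ^ 2 := by
                rw [Finset.sum_const, nsmul_eq_mul]
            _ ≤ _ := Finset.sum_le_sum fun i hi => by
              have := (hIy s i hi).1
              gcongr
      _ = ∑ i ∈ U, (y i : ℝ) ^ 2 :=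
          Finset.sum_fiberwise_of_maps_to (fun i _ => hlevn i) _
      _ ≤ _ := Finset.sum_le_sum_of_subset_of_nonneg (Finset.subset_univ _)
          fun _ _ _ => sq_nonneg _
  have hα16 : ∀ s ∈ Finset.range n, α s ≤ 16 := fun s hs =>
    (Finset.single_le_sum (fun s _ => hα0 s) hs).trans hαsum
  have haα : ∀ s ∈ Finset.range n, a s * ((2 : ℝ) ^ s) ^ 2 ≤ 16 * N := fun s hs => by
    have := hα16 s hs
    simp only [hα] at this
    rwa [div_le_iff₀ hN] at this
  set W : ℕ → ℕ → ℝ := fun s t =>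
    if q ≤ 2 ^ s * 2 ^ t then edgeCount R (I s) (I t) * 2 ^ s * 2 ^ t else 0 with hW
  have hW0 : ∀ s t, 0 ≤ W s t := fun s t => by
    simp only [hW]
    have := edgeCount_nonneg R (I s) (I t)
    split_ifs <;> positivity
  have hWsymm : ∀ s t, W s t = W t s := fun s t => by
    simp only [hW]
    rw [mul_comm ((2 : ℝ) ^ s), edgeCount_comm, mul_right_comm]
  -- reduction to levels
  have step1 : ∑ i, ∑ j, (if 16 * q < (y i : ℝ) * y j then edge R i j * ((y i : ℝ) * y j) else 0)
      ≤ 4 * ∑ s ∈ Finset.range n, ∑ t ∈ Finset.range n, W s t := by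
    -- Rounding both entries down to powers of two loses a factor below 4. Hence a product above `16
    -- * q` still has rounded product above `4 * q`, so it survives in `W`.
    set F : V → V → ℝ := fun i j => if q ≤ (2 : ℝ) ^ lev i * 2 ^ lev j then
      edge R i j * (2 : ℝ) ^ lev i * 2 ^ lev j else 0 with hF
    have hF0 : ∀ i j, 0 ≤ F i j := fun i j => by
      simp only [hF]
      have := edge_nonneg R i j
      split_ifs <;> positivity
    have hterm : ∀ i j, (if 16 * q < (y i : ℝ) * y j then edge R i j * ((y i : ℝ) * y j) else 0)
        ≤ if i ∈ U ∧ j ∈ U then 4 * F i j else 0 := by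
      intro i j
      split_ifs with h1 h2 h2
      · have hlt : ∀ k, (y k : ℝ) ≤ 2 * 2 ^ lev k := fun k => by
          have := (Nat.lt_pow_succ_log_self (b := 2) (by norm_num) (y k)).le
          rw [pow_succ, mul_comm] at this
          exact_mod_cast this
        have hle : (y i : ℝ) * y j ≤ (2 * 2 ^ lev i) * (2 * 2 ^ lev j) :=
          mul_le_mul (hlt i) (hlt j) (Nat.cast_nonneg _) (by positivity)
        simp only [hF]
        rw [if_pos (by nlinarith)]
        calc _ ≤ edge R i j * ((2 * 2 ^ lev i) * (2 * 2 ^ lev j)) :=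
              mul_le_mul_of_nonneg_left hle (edge_nonneg _ _ _)
          _ = _ := by ring
      · exfalso
        apply h2
        simp only [hU, Finset.mem_filter, Finset.mem_univ, true_and]
        constructor
        · intro h; simp [h] at h1; linarith
        · intro h; simp [h] at h1; linarith
      · have := hF0 i j; positivity
      · exact le_rfl
    calc _ ≤ ∑ i, ∑ j, if i ∈ U ∧ j ∈ U then 4 * F i j else 0 :=
          Finset.sum_le_sum fun i _ => Finset.sum_le_sum fun j _ => hterm i j
      _ = ∑ i ∈ U, ∑ j ∈ U, 4 * F i j := by
          rw [← Finset.sum_subset (Finset.subset_univ U)]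
          · refine Finset.sum_congr rfl fun i hi => ?_
            rw [← Finset.sum_subset (Finset.subset_univ U)]
            · exact Finset.sum_congr rfl fun j hj => by rw [if_pos ⟨hi, hj⟩]
            · intro j _ hj; rw [if_neg fun h => hj h.2]
          · intro i _ hi
            exact Finset.sum_eq_zero fun j _ => by rw [if_neg fun h => hi h.1]
      _ = ∑ s ∈ Finset.range n, ∑ i ∈ I s, ∑ t ∈ Finset.range n, ∑ j ∈ I t, 4 * F i j := by
          rw [← Finset.sum_fiberwise_of_maps_to (fun i _ => hlevn i)]
          refine Finset.sum_congr rfl fun s _ => Finset.sum_congr rfl fun i _ => ?_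
          rw [← Finset.sum_fiberwise_of_maps_to (fun i _ => hlevn i)]
      _ = _ := by
          rw [Finset.mul_sum]
          refine Finset.sum_congr rfl fun s _ => ?_
          rw [Finset.sum_comm, Finset.mul_sum]
          refine Finset.sum_congr rfl fun t _ => ?_
          simp_rw [← Finset.mul_sum]
          congr 1
          simp only [hW, edgeCount]
          have : ∀ i ∈ I s, ∀ j ∈ I t, F i j
              = if q ≤ 2 ^ s * 2 ^ t then edge R i j * 2 ^ s * 2 ^ t else 0 := by
            intro i hi j hj
            simp only [hF, (Finset.mem_filter.1 hi).2, (Finset.mem_filter.1 hj).2]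
          rw [Finset.sum_congr rfl fun i hi => Finset.sum_congr rfl fun j hj => this i hi j hj]
          split_ifs
          · simp_rw [Finset.sum_mul]
          · simp
  -- Discrepancy is stated with the larger set second. Symmetry reduces to this order at the cost of
  -- a factor 2, and in total 4 · 2 · 13824 ≤ 115000.
  have step2 : ∑ s ∈ Finset.range n, ∑ t ∈ Finset.range n, W s t
      ≤ 2 * ∑ s ∈ Finset.range n, ∑ t ∈ Finset.range n, (if a s ≤ a t then W s t else 0) := by
    have h : ∀ s t, W s t ≤ (if a s ≤ a t then W s t else 0) + (if a t ≤ a s then W t s else 0) := by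
      intro s t
      rcases le_total (a s) (a t) with h | h
      · rw [if_pos h]
        have : 0 ≤ if a t ≤ a s then W t s else 0 := by
          split_ifs
          · exact hW0 _ _
          · exact le_rfl
        linarith
      · rw [if_pos h, hWsymm t s]
        have : 0 ≤ if a s ≤ a t then W s t else 0 := by
          split_ifs
          · exact hW0 _ _
          · exact le_rfl
        linarith
    calc _ ≤ ∑ s ∈ Finset.range n, ∑ t ∈ Finset.range n,
          ((if a s ≤ a t then W s t else 0) + (if a t ≤ a s then W t s else 0)) :=
          Finset.sum_le_sum fun s _ => Finset.sum_le_sum fun t _ => h s t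
      _ = _ := by
          simp_rw [Finset.sum_add_distrib]
          rw [Finset.sum_comm (f := fun s t => if a t ≤ a s then W t s else 0)]
          ring
  -- the bound for a pair of levels
  set ζ : ℕ → ℝ := fun t => Real.exp ((1 + Real.log (N / a t)) / 4) with hζ
  have step3 : ∀ s ∈ Finset.range n, ∀ t ∈ Finset.range n, (if a s ≤ a t then W s t else 0) ≤
      N * q * (20 * q * α s / 2 ^ s * (if (2 : ℝ) ^ t ≤ 2 ^ s / q then 2 ^ t else 0) + 8 * α s * α t
      + 128 * α t / (2 ^ t * q) * (if (2 : ℝ) ^ s ≤ 2 ^ t * q then 2 ^ s else 0)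
      + 64 * (ζ t * α t) / (2 ^ t * q) * (if (2 : ℝ) ^ s ≤ q then 2 ^ s else 0)
      + 16 * (ζ t * α t) * q / 2 ^ t * (if q < (2 : ℝ) ^ s then 1 / 2 ^ s else 0)) := by
    intro s hs t ht
    have hnn : 0 ≤ N * q * (20 * q * α s / 2 ^ s * (if (2 : ℝ) ^ t ≤ 2 ^ s / q then 2 ^ t else 0) + 8 * α s * α t
      + 128 * α t / (2 ^ t * q) * (if (2 : ℝ) ^ s ≤ 2 ^ t * q then 2 ^ s else 0)
      + 64 * (ζ t * α t) / (2 ^ t * q) * (if (2 : ℝ) ^ s ≤ q then 2 ^ s else 0)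
      + 16 * (ζ t * α t) * q / 2 ^ t * (if q < (2 : ℝ) ^ s then 1 / 2 ^ s else 0)) := by
      exact mul_nonneg (mul_pos hN hq).le (level_term_nonneg hq (hα0 s) (hα0 t)
        (Real.exp_pos _).le (by positivity) (by positivity))
    by_cases hst : a s ≤ a t
    swap
    · rw [if_neg hst]; exact hnn
    rw [if_pos hst]
    rcases (ha0 s).eq_or_lt with h0 | h0
    · have : I s = ∅ := by
        rw [← Finset.card_eq_zero]; simp only [ha] at h0; exact_mod_cast h0.symm
      simp only [hW, this, edgeCount, Finset.sum_empty, zero_mul, ite_self]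
      exact hnn
    by_cases hPQ : q ≤ 2 ^ s * 2 ^ t
    swap
    · simp only [hW, if_neg hPQ]; exact hnn
    simp only [hW, if_pos hPQ]
    have hne : (I s).Nonempty := by
      rw [← Finset.card_pos]; simp only [ha] at h0; exact_mod_cast h0
    refine heavy_bucket_le (a := a s) (b := a t) (D := D) h0 hst (haN t) (by positivity)
      (by positivity) hq hqD hPQ (edgeCount_nonneg _ _ _) ?_ (haα s hs) ?_
    · refine (edgeCount_le_degree R (I s) (I t)).trans ?_
      calc _ ≤ ∑ i ∈ I s, 20 * D := Finset.sum_le_sum fun i hi => hdeg i (hIy s i hi).2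
        _ = _ := by
          rw [Finset.sum_const, nsmul_eq_mul]
          show _ = 20 * D * ((I s).card : ℝ)
          ring
    · exact hdisc (I t) (I s) hne (by simp only [ha] at hst; exact_mod_cast hst)
  have hfac : ∀ t ∈ Finset.range n, ζ t * α t / 2 ^ t ≤ 11 * (3 / 4) ^ t := by
    intro t ht
    rcases (ha0 t).eq_or_lt with h0 | h0
    · have hz : α t = 0 := by simp only [hα, ← h0, zero_mul, zero_div]
      rw [hz, mul_zero, zero_div]
      positivity
    · exact level_factor_le h0 hN (haα t ht)
  have step4 : ∑ s ∈ Finset.range n, ∑ t ∈ Finset.range n, (if a s ≤ a t then W s t else 0)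
      ≤ N * q * 13824 := by
    calc _ ≤ ∑ s ∈ Finset.range n, ∑ t ∈ Finset.range n,
          N * q * (20 * q * α s / 2 ^ s * (if (2 : ℝ) ^ t ≤ 2 ^ s / q then 2 ^ t else 0) + 8 * α s * α t
      + 128 * α t / (2 ^ t * q) * (if (2 : ℝ) ^ s ≤ 2 ^ t * q then 2 ^ s else 0)
      + 64 * (ζ t * α t) / (2 ^ t * q) * (if (2 : ℝ) ^ s ≤ q then 2 ^ s else 0)
      + 16 * (ζ t * α t) * q / 2 ^ t * (if q < (2 : ℝ) ^ s then 1 / 2 ^ s else 0)) :=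
          Finset.sum_le_sum fun s hs => Finset.sum_le_sum fun t ht => step3 s hs t ht
      _ = N * q * ∑ s ∈ Finset.range n, ∑ t ∈ Finset.range n,
          (20 * q * α s / 2 ^ s * (if (2 : ℝ) ^ t ≤ 2 ^ s / q then 2 ^ t else 0) + 8 * α s * α t
      + 128 * α t / (2 ^ t * q) * (if (2 : ℝ) ^ s ≤ 2 ^ t * q then 2 ^ s else 0)
      + 64 * (ζ t * α t) / (2 ^ t * q) * (if (2 : ℝ) ^ s ≤ q then 2 ^ s else 0)
      + 16 * (ζ t * α t) * q / 2 ^ t * (if q < (2 : ℝ) ^ s then 1 / 2 ^ s else 0)) := by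
          simp_rw [← Finset.mul_sum]
      _ ≤ _ := mul_le_mul_of_nonneg_left
          (level_sum_le hq hα0 (fun _ => (Real.exp_pos _).le) hαsum hfac) (mul_pos hN hq).le
  have hNq : 0 < N * q := by positivity
  linarith

end BlockModel

namespace BlockModel

/-! ### The contribution of light pairs -/

/-- The term `2 * (1 / 2) ^ m` makes the induction close, since exp(-(m+1)²) ≤ (1/2)^(m+1). The
bound 3 ≤ exp 2, uniform in the radius, is the price per coordinate in the lattice union bounds. -/
lemma sum_exp_neg_sq_le (m : ℕ) :
    ∑ z ∈ Finset.Icc (-(m : ℤ)) m, Real.exp (-(z : ℝ) ^ 2) ≤ 3 - 2 * (1 / 2) ^ m := by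
  induction m with
  | zero => norm_num
  | succ m ih =>
    have hI : Finset.Icc (-((m + 1 : ℕ) : ℤ)) ((m + 1 : ℕ) : ℤ)
        = insert (-((m : ℤ) + 1)) (insert ((m : ℤ) + 1) (Finset.Icc (-(m : ℤ)) m)) := by
      ext z
      simp only [Finset.mem_insert, Finset.mem_Icc]
      push_cast
      omega
    rw [hI, Finset.sum_insert, Finset.sum_insert]
    · have hle : Real.exp (-((m : ℝ) + 1) ^ 2) ≤ (1 / 2) ^ (m + 1) := by
        have h1 : Real.exp (-1) ≤ 1 / 2 := by
          rw [Real.exp_neg, one_div]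
          have := Real.add_one_le_exp (1 : ℝ)
          exact inv_anti₀ (by norm_num) (by linarith)
        calc Real.exp (-((m : ℝ) + 1) ^ 2) ≤ Real.exp (((m + 1 : ℕ) : ℝ) * (-1)) := by
              apply Real.exp_le_exp.2
              push_cast
              have : (0 : ℝ) ≤ m := Nat.cast_nonneg m
              nlinarith
          _ = Real.exp (-1) ^ (m + 1) := Real.exp_nat_mul _ _
          _ ≤ _ := pow_le_pow_left₀ (Real.exp_pos _).le h1 _
      have e1 : Real.exp (-((-((m : ℤ) + 1) : ℤ) : ℝ) ^ 2) = Real.exp (-((m : ℝ) + 1) ^ 2) := by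
        push_cast; congr 1; ring
      have e2 : Real.exp (-(((m : ℤ) + 1 : ℤ) : ℝ) ^ 2) = Real.exp (-((m : ℝ) + 1) ^ 2) := by
        push_cast; rfl
      rw [e1, e2]
      have : (1 / 2 : ℝ) ^ (m + 1) = (1 / 2) ^ m / 2 := by rw [pow_succ]; ring
      linarith
    · simp
    · simp only [Finset.mem_insert, Finset.mem_Icc, not_or]
      constructor <;> omega

lemma expRem_le_sq {z : ℝ} (hz : |z| ≤ 1) : expRem z ≤ z ^ 2 :=
  (le_abs_self _).trans (Real.abs_exp_sub_one_sub_id_le hz)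

variable {V : Type*} [Fintype V]

open scoped Classical in
/-- For all short lattice vectors, the light pairs contribute little to the quadratic form of the
centred adjacency matrix. -/
def LightBound (D : ℝ) (p : Sym2 V → ℝ) (R : Sym2 V → Bool) : Prop :=
  ∀ w : V → ℤ, ∑ i, (w i : ℝ) ^ 2 ≤ 16 * Fintype.card V →
    |∑ i, ∑ j, (if i ≠ j ∧ |(w i : ℝ) * w j| ≤ 16 * √D then (w i : ℝ) * w j else 0)
      * (edge R i j - p s(i, j))| ≤ 640 * Fintype.card V * √D

-- On light pairs the tilt 1/(32√D) keeps the doubled coefficients in [-1, 1], where `expRem` is at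
-- most the square. The moment exponent is then at most N/2, against a threshold of 20N.
open scoped Classical in
lemma light_prob_aux {p : Sym2 V → ℝ} (h0 : ∀ e, 0 ≤ p e) (h1 : ∀ e, p e ≤ 1) {D : ℝ}
    (hD : 0 < D) (hp : ∀ e, p e ≤ D / Fintype.card V) (hN : 0 < Fintype.card V) (w : V → ℤ)
    (hw : ∑ i, (w i : ℝ) ^ 2 ≤ 16 * Fintype.card V) {ε : ℝ} (hε : ε ^ 2 = 1) :
    (coins p).real {R | 640 * Fintype.card V * √D ≤ ε * ∑ i, ∑ j,
      (if i ≠ j ∧ |(w i : ℝ) * w j| ≤ 16 * √D then (w i : ℝ) * w j else 0)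
        * (edge R i j - p s(i, j))} ≤ Real.exp (-(39 / 2 * Fintype.card V)) := by
  set N : ℝ := (Fintype.card V : ℝ) with hNdef
  have hN0 : 0 < N := by rw [hNdef]; exact_mod_cast hN
  have hq : 0 < √D := Real.sqrt_pos.2 hD
  have hqD : √D ^ 2 = D := Real.sq_sqrt hD.le
  set q := √D with hqdef
  have hεabs : |ε| = 1 := by
    have := Real.sqrt_sq_eq_abs ε
    rw [hε, Real.sqrt_one] at this; exact this.symm
  set g : V → V → ℝ := fun i j =>
    if i ≠ j ∧ |(w i : ℝ) * w j| ≤ 16 * q then (w i : ℝ) * w j else 0 with hg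
  have hgq : ∀ i j, |g i j| ≤ 16 * q := fun i j => by
    simp only [hg]; split_ifs with h
    · exact h.2
    · simp; exact hq.le
  have hgw : ∀ i j, g i j ^ 2 ≤ (w i : ℝ) ^ 2 * (w j : ℝ) ^ 2 := fun i j => by
    simp only [hg]; split_ifs with h
    · rw [mul_pow]
    · rw [zero_pow two_ne_zero]; positivity
  have h := edges_chernoff h0 h1 (c := fun i j => 1 / (32 * q) * (ε * g i j)) (fun i => by simp [hg])
    (K := N / 2) ?_ (20 * N)
  · have hs : {R : Sym2 V → Bool | 640 * N * q ≤ ε * ∑ i, ∑ j, g i j * (edge R i j - p s(i, j))} =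
        {R | 20 * N ≤ ∑ i, ∑ j, 1 / (32 * q) * (ε * g i j) * (edge R i j - p s(i, j))} := by
      ext R
      have e : ∑ i, ∑ j, 1 / (32 * q) * (ε * g i j) * (edge R i j - p s(i, j))
          = 1 / (32 * q) * (ε * ∑ i, ∑ j, g i j * (edge R i j - p s(i, j))) := by
        simp_rw [Finset.mul_sum]
        exact Finset.sum_congr rfl fun i _ => Finset.sum_congr rfl fun j _ => by ring
      simp only [Set.mem_ofPred_eq]
      rw [e, one_div_mul_eq_div, le_div_iff₀ (by positivity)]
      constructor <;> intro h <;> linarith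
    rw [hs]
    refine h.trans_eq ?_
    congr 1; ring
  · have hterm : ∀ i j, p s(i, j) * (expRem (2 * (1 / (32 * q) * (ε * g i j))) / 2)
        ≤ D / N * (1 / (512 * D)) * ((w i : ℝ) ^ 2 * (w j : ℝ) ^ 2) := by
      intro i j
      have hz : |2 * (1 / (32 * q) * (ε * g i j))| ≤ 1 := by
        rw [abs_mul, abs_mul, abs_mul, hεabs, abs_of_pos (by norm_num : (0 : ℝ) < 2),
          abs_of_pos (by positivity : 0 < 1 / (32 * q))]
        calc _ ≤ 2 * (1 / (32 * q) * (1 * (16 * q))) := by gcongr; exact hgq i j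
          _ = 1 := by field_simp; norm_num
      calc _ ≤ D / N * ((2 * (1 / (32 * q) * (ε * g i j))) ^ 2 / 2) := by
            have := expRem_nonneg (2 * (1 / (32 * q) * (ε * g i j)))
            have := expRem_le_sq hz
            have := h0 s(i, j)
            have : 0 < D / N := by positivity
            apply mul_le_mul (hp _) <;> first | positivity | linarith
        _ = D / N * (1 / (512 * D)) * g i j ^ 2 := by
            rw [← hqD]; rw [mul_pow, mul_pow, mul_pow, hε]; field_simp; ring
        _ ≤ _ := by
            have := hgw i j
            gcongr
    calc _ ≤ ∑ i, ∑ j, D / N * (1 / (512 * D)) * ((w i : ℝ) ^ 2 * (w j : ℝ) ^ 2) :=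
          Finset.sum_le_sum fun i _ => Finset.sum_le_sum fun j _ => hterm i j
      _ = D / N * (1 / (512 * D)) * ((∑ i, (w i : ℝ) ^ 2) * ∑ j, (w j : ℝ) ^ 2) := by
          rw [Finset.sum_mul_sum, Finset.mul_sum]
          exact Finset.sum_congr rfl fun i _ => by rw [Finset.mul_sum]
      _ ≤ D / N * (1 / (512 * D)) * ((16 * N) * (16 * N)) := by
          have : 0 ≤ ∑ i, (w i : ℝ) ^ 2 := Finset.sum_nonneg fun i _ => sq_nonneg _
          gcongr
      _ = N / 2 := by field_simp; norm_num

open scoped Classical in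
/-- The integer points of the cube of radius `m`. -/
noncomputable def latticeBox (V : Type*) [Fintype V] (m : ℕ) : Finset (V → ℤ) :=
  Fintype.piFinset fun _ => Finset.Icc (-(m : ℤ)) m

lemma sum_exp_neg_sq_latticeBox_le (m : ℕ) :
    ∑ w ∈ latticeBox V m, Real.exp (-∑ i, (w i : ℝ) ^ 2)
      ≤ Real.exp (2 * Fintype.card V) := by
  classical
  have h := Finset.prod_univ_sum (fun _ : V => Finset.Icc (-(m : ℤ)) m)
    (fun _ z => Real.exp (-(z : ℝ) ^ 2))
  have e : ∀ w : V → ℤ, Real.exp (-∑ i, (w i : ℝ) ^ 2) = ∏ i, Real.exp (-(w i : ℝ) ^ 2) := by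
    intro w
    rw [← Real.exp_sum, Finset.sum_neg_distrib]
  simp_rw [e]
  have h' : ∑ w ∈ latticeBox V m, ∏ i, Real.exp (-(w i : ℝ) ^ 2)
      = ∏ _i : V, ∑ z ∈ Finset.Icc (-(m : ℤ)) m, Real.exp (-(z : ℝ) ^ 2) := by
    rw [h]
    refine Finset.sum_congr ?_ fun _ _ => rfl
    ext; simp [latticeBox, Fintype.mem_piFinset]
  rw [h', mul_comm, ← Nat.cast_ofNat, mul_comm, Nat.cast_ofNat, mul_comm, Real.exp_nat_mul,
    Finset.prod_const, Finset.card_univ]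
  refine pow_le_pow_left₀ (Finset.sum_nonneg fun _ _ => (Real.exp_pos _).le) ?_ _
  have h3 := sum_exp_neg_sq_le m
  have : (0 : ℝ) < (1 / 2) ^ m := by positivity
  have := Real.add_one_le_exp (2 : ℝ)
  linarith

lemma light_prob {p : Sym2 V → ℝ} (h0 : ∀ e, 0 ≤ p e) (h1 : ∀ e, p e ≤ 1) {D : ℝ}
    (hD : 0 < D) (hp : ∀ e, p e ≤ D / Fintype.card V) (hN : 0 < Fintype.card V) :
    (coins p).real {R | ¬ LightBound D p R} ≤ 2 * Real.exp (-(Fintype.card V)) := by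
  classical
  set N : ℝ := (Fintype.card V : ℝ) with hNdef
  set X : (V → ℤ) → (Sym2 V → Bool) → ℝ := fun w R => ∑ i, ∑ j,
      (if i ≠ j ∧ |(w i : ℝ) * w j| ≤ 16 * √D then (w i : ℝ) * w j else 0)
        * (edge R i j - p s(i, j)) with hX
  have key : ∀ ε : ℝ, ε ^ 2 = 1 → (coins p).real {R | ∃ w ∈ latticeBox V (16 * Fintype.card V),
      ∑ i, (w i : ℝ) ^ 2 ≤ 16 * N ∧ 640 * N * √D ≤ ε * X w R} ≤ Real.exp (-N) := by
    intro ε hε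
    refine (coins_exists_le p _ _).trans ?_
    -- No lattice points are counted: because |w|² ≤ 16N, the bound exp(-19.5N) is at most
    -- exp(-3.5N) exp(-|w|²), and the Gaussian weights sum to at most exp(2N).
    calc _ ≤ ∑ w ∈ latticeBox V (16 * Fintype.card V),
          Real.exp (-(7 / 2 * N)) * Real.exp (-∑ i, (w i : ℝ) ^ 2) := by
          refine Finset.sum_le_sum fun w _ => ?_
          by_cases hw : ∑ i, (w i : ℝ) ^ 2 ≤ 16 * N
          · simp only [hw, true_and]
            refine (light_prob_aux h0 h1 hD hp hN w hw hε).trans ?_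
            rw [← Real.exp_add]
            apply Real.exp_le_exp.2
            linarith
          · simp only [hw, false_and]
            rw [show {R : Sym2 V → Bool | False} = ∅ from rfl, measureReal_empty]
            positivity
      _ ≤ Real.exp (-(7 / 2 * N)) * Real.exp (2 * N) := by
          rw [← Finset.mul_sum]
          gcongr
          exact sum_exp_neg_sq_latticeBox_le _
      _ ≤ _ := by
          rw [← Real.exp_add]
          apply Real.exp_le_exp.2
          have : 0 ≤ N := Nat.cast_nonneg _
          linarith
  have hsub : {R : Sym2 V → Bool | ¬ LightBound D p R} ⊆
      {R | ∃ w ∈ latticeBox V (16 * Fintype.card V),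
      ∑ i, (w i : ℝ) ^ 2 ≤ 16 * N ∧ 640 * N * √D ≤ 1 * X w R} ∪
      {R | ∃ w ∈ latticeBox V (16 * Fintype.card V),
      ∑ i, (w i : ℝ) ^ 2 ≤ 16 * N ∧ 640 * N * √D ≤ (-1) * X w R} := by
    intro R hR
    have hR' : ¬ LightBound D p R := hR
    unfold LightBound at hR'
    push Not at hR'
    obtain ⟨w, hw, hlt⟩ := hR'
    have hmem : w ∈ latticeBox V (16 * Fintype.card V) := by
      rw [latticeBox, Fintype.mem_piFinset]
      intro i
      have h2 : (w i : ℝ) ^ 2 ≤ 16 * N :=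
        (Finset.single_le_sum (f := fun i => (w i : ℝ) ^ 2) (fun _ _ => sq_nonneg _)
          (Finset.mem_univ i)).trans hw
      have h3 : (w i) ^ 2 ≤ 16 * (Fintype.card V : ℤ) := by
        rw [hNdef] at h2; exact_mod_cast h2
      rw [Finset.mem_Icc]
      push_cast
      have h4 : |w i| ≤ (w i) ^ 2 := by rw [← sq_abs]; exact Int.le_self_sq _
      exact abs_le.1 (h4.trans h3)
    have hX' : 640 * N * √D < |X w R| := by simpa [hX] using hlt
    rcases lt_abs.1 hX' with h | h
    · left; exact ⟨w, hmem, hw, by linarith⟩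
    · right; exact ⟨w, hmem, hw, by linarith⟩
  refine (measureReal_mono hsub).trans ((measureReal_union_le _ _).trans ?_)
  have := key 1 (by norm_num)
  have := key (-1) (by norm_num)
  linarith

end BlockModel

namespace BlockModel

/-! ### From lattice vectors to all vectors -/

/-- Rounding is towards zero, not to the nearest integer: neither the support nor any absolute value
may grow. -/
lemma exists_int_trunc (y : ℝ) : ∃ w : ℤ, (w ≠ 0 → y ≠ 0) ∧ (w : ℝ) ^ 2 ≤ y ^ 2 ∧
    (y - w) ^ 2 ≤ 1 := by
  rcases le_total 0 y with h | h
  · have h1 := Int.floor_le y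
    have h2 := Int.lt_floor_add_one y
    have h3 : (0 : ℝ) ≤ ⌊y⌋ := by exact_mod_cast Int.floor_nonneg.2 h
    refine ⟨⌊y⌋, fun h hy => h (by simp [hy]), by nlinarith, by nlinarith⟩
  · have h1 := Int.le_ceil y
    have h2 := Int.ceil_lt_add_one y
    have h3 : (⌈y⌉ : ℝ) ≤ 0 := by exact_mod_cast Int.ceil_le.2 (by simpa using h)
    refine ⟨⌈y⌉, fun h hy => h (by simp [hy]), by nlinarith, by nlinarith⟩

variable {V : Type*} [Fintype V]

/-- The quadratic form with matrix `E`. -/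
def quadForm (E : V → V → ℝ) (z : V → ℝ) : ℝ := ∑ i, ∑ j, z i * z j * E i j

/-- The bilinear form with matrix `E`. -/
def bilinForm (E : V → V → ℝ) (y z : V → ℝ) : ℝ := ∑ i, ∑ j, y i * z j * E i j

lemma bilinForm_symm {E : V → V → ℝ} (hE : ∀ i j, E i j = E j i) (y z : V → ℝ) :
    bilinForm E y z = bilinForm E z y := by
  unfold bilinForm
  rw [Finset.sum_comm]
  exact Finset.sum_congr rfl fun i _ => Finset.sum_congr rfl fun j _ => by rw [hE]; ring

lemma quadForm_add (E : V → V → ℝ) (hE : ∀ i j, E i j = E j i) (y z : V → ℝ) (c : ℝ) :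
    quadForm E (fun i => y i + c * z i)
      = quadForm E y + 2 * c * bilinForm E y z + c ^ 2 * quadForm E z := by
  have h : quadForm E (fun i => y i + c * z i)
      = quadForm E y + c * bilinForm E y z + c * bilinForm E z y + c ^ 2 * quadForm E z := by
    unfold quadForm bilinForm
    simp_rw [Finset.mul_sum, ← Finset.sum_add_distrib]
    exact Finset.sum_congr rfl fun i _ => Finset.sum_congr rfl fun j _ => by ring
  rw [h, bilinForm_symm hE z y]; ring

lemma quadForm_smul (E : V → V → ℝ) (c : ℝ) (z : V → ℝ) :
    quadForm E (fun i => c * z i) = c ^ 2 * quadForm E z := by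
  unfold quadForm
  simp_rw [Finset.mul_sum]
  exact Finset.sum_congr rfl fun i _ => Finset.sum_congr rfl fun j _ => by ring

lemma abs_quadForm_le_crude (E : V → V → ℝ) (z : V → ℝ) :
    |quadForm E z| ≤ (∑ i, ∑ j, |E i j|) * ∑ i, z i ^ 2 := by
  unfold quadForm
  refine (Finset.abs_sum_le_sum_abs _ _).trans ?_
  rw [Finset.sum_mul]
  refine Finset.sum_le_sum fun i _ => (Finset.abs_sum_le_sum_abs _ _).trans ?_
  rw [Finset.sum_mul]
  refine Finset.sum_le_sum fun j _ => ?_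
  rw [abs_mul, mul_comm]
  refine mul_le_mul_of_nonneg_left ?_ (abs_nonneg _)
  have hi := Finset.single_le_sum (f := fun i => z i ^ 2) (fun _ _ => sq_nonneg _)
    (Finset.mem_univ i)
  have hj := Finset.single_le_sum (f := fun i => z i ^ 2) (fun _ _ => sq_nonneg _)
    (Finset.mem_univ j)
  rw [abs_mul]
  nlinarith [sq_abs (z i), sq_abs (z j), sq_nonneg (|z i| - |z j|)]

/-- A bound for a quadratic form on short lattice vectors extends to all vectors. -/
lemma abs_quadForm_le_of_lattice {E : V → V → ℝ} (hE : ∀ i j, E i j = E j i) (U : Set V) {K : ℝ}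
    (h : ∀ w : V → ℤ, (∀ i, w i ≠ 0 → i ∈ U) → ∑ i, (w i : ℝ) ^ 2 ≤ 16 * Fintype.card V →
      |quadForm E (fun i => (w i : ℝ))| ≤ 16 * Fintype.card V * K)
    (z : V → ℝ) (hz : ∀ i, z i ≠ 0 → i ∈ U) :
    |quadForm E z| ≤ 16 / 7 * K * ∑ i, z i ^ 2 := by
  set N : ℝ := (Fintype.card V : ℝ) with hNdef
  set P : ℝ → Prop := fun b => ∀ z : V → ℝ, (∀ i, z i ≠ 0 → i ∈ U) →
    |quadForm E z| ≤ b * ∑ i, z i ^ 2 with hP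
  -- Scale z to squared norm 16N and write it as a lattice vector w plus a remainder r with |r|² ≤
  -- N. The cross term is one eighth of the difference of the form at w + 4r and w - 4r, whose
  -- squared norms sum to at most 64N. So it costs 8bN, the form at r costs bN, and 9/16 is (8 +
  -- 1)/16.
  have step : ∀ b, 0 ≤ b → P b → P (K + 9 / 16 * b) := by
    intro b hb hPb z hz
    rcases (Finset.sum_nonneg fun i _ => sq_nonneg (z i) :
      0 ≤ ∑ i, z i ^ 2).eq_or_lt with h0 | h0
    · have := hPb z hz
      rw [← h0, mul_zero] at this ⊢; exact this
    have hN : 0 < N := by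
      rw [hNdef]
      rcases Nat.eq_zero_or_pos (Fintype.card V) with h1 | h1
      · have := Fintype.card_eq_zero_iff.1 h1
        simp at h0
      · exact_mod_cast h1
    set s := ∑ i, z i ^ 2 with hs
    set c := √(16 * N / s) with hc
    have hc2 : c ^ 2 * s = 16 * N := by
      rw [hc, Real.sq_sqrt (by positivity)]; field_simp
    have hc0 : 0 < c := Real.sqrt_pos.2 (by positivity)
    choose w hw0 hwle hwr using fun i => exists_int_trunc (c * z i)
    set r : V → ℝ := fun i => c * z i - w i with hr
    have hr0 : ∀ i, r i ≠ 0 → i ∈ U := fun i hi => hz i fun h => hi <| by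
      have : w i = 0 := by by_contra h'; exact hw0 i h' (by rw [h, mul_zero])
      simp [hr, h, this]
    have hwU : ∀ i, w i ≠ 0 → i ∈ U := fun i hi => hz i fun h => hw0 i hi (by rw [h, mul_zero])
    have hy : ∑ i, (c * z i) ^ 2 = 16 * N := by
      simp_rw [mul_pow]; rw [← Finset.mul_sum]; exact hc2
    have hw2 : ∑ i, (w i : ℝ) ^ 2 ≤ 16 * N := (Finset.sum_le_sum fun i _ => hwle i).trans hy.le
    have hr2 : ∑ i, r i ^ 2 ≤ N :=
      (Finset.sum_le_sum fun i _ => hwr i).trans_eq (by simp [hNdef])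
    have e1 : quadForm E (fun i => c * z i) = quadForm E (fun i => (w i : ℝ))
        + 2 * bilinForm E (fun i => (w i : ℝ)) r + quadForm E r := by
      have := quadForm_add E hE (fun i => (w i : ℝ)) r 1
      simp only [one_mul, one_pow, mul_one] at this
      rw [← this]
      congr 1; ext i; simp [hr]
    have e2 := quadForm_add E hE (fun i => (w i : ℝ)) r 4
    have e3 := quadForm_add E hE (fun i => (w i : ℝ)) r (-4)
    have hsq : ∀ t : ℝ, t ^ 2 = 16 → ∑ i, ((w i : ℝ) + t * r i) ^ 2 + ∑ i, ((w i : ℝ) + (-t) * r i) ^ 2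
        ≤ 64 * N := by
      intro t ht
      rw [← Finset.sum_add_distrib]
      have : ∀ i, ((w i : ℝ) + t * r i) ^ 2 + ((w i : ℝ) + (-t) * r i) ^ 2
          = 2 * (w i : ℝ) ^ 2 + 32 * r i ^ 2 := fun i => by linear_combination 2 * r i ^ 2 * ht
      simp_rw [this, Finset.sum_add_distrib, ← Finset.mul_sum]
      linarith
    have hsq4 := hsq 4 (by norm_num)
    have hU : ∀ t : ℝ, ∀ i, (w i : ℝ) + t * r i ≠ 0 → i ∈ U := by
      intro t i hi
      by_contra hni
      apply hi
      have h1 : w i = 0 := by by_contra h'; exact hni (hwU i h')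
      have h2 : r i = 0 := by by_contra h'; exact hni (hr0 i h')
      simp [h1, h2]
    have b2 := abs_le.1 (hPb _ (hU 4))
    have b3 := abs_le.1 (hPb _ (hU (-4)))
    rw [e2] at b2
    rw [e3] at b3
    have b4 := abs_le.1 (hPb r hr0)
    have b1 := abs_le.1 (h w hwU hw2)
    have hb1 := mul_le_mul_of_nonneg_left hsq4 hb
    have hb2 := mul_le_mul_of_nonneg_left hr2 hb
    have e4 := quadForm_smul E c z
    rw [mul_add] at hb1
    have hc2' : 0 < c ^ 2 := by positivity
    have : c ^ 2 * |quadForm E z| ≤ c ^ 2 * ((K + 9 / 16 * b) * s) := by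
      rw [show c ^ 2 * ((K + 9 / 16 * b) * s) = (K + 9 / 16 * b) * (c ^ 2 * s) by ring, hc2,
        ← abs_of_pos hc2', ← abs_mul, ← e4, e1, abs_le]
      constructor <;> nlinarith [b1.1, b1.2, b2.1, b2.2, b3.1, b3.2, b4.1, b4.2]
    exact le_of_mul_le_mul_left this hc2'
  set b0 := ∑ i, ∑ j, |E i j| with hb0
  have hb00 : 0 ≤ b0 := Finset.sum_nonneg fun _ _ => Finset.sum_nonneg fun _ _ => abs_nonneg _
  have hK : 0 ≤ K ∨ ∑ i, z i ^ 2 = 0 := by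
    rcases Nat.eq_zero_or_pos (Fintype.card V) with h1 | h1
    · right
      have := Fintype.card_eq_zero_iff.1 h1
      simp
    · left
      have := h (fun _ => 0) (by simp) (by simp [hNdef])
      simp only [Int.cast_zero] at this
      have h2 : 0 ≤ 16 * N * K := (abs_nonneg _).trans this
      have hN : 0 < N := by rw [hNdef]; exact_mod_cast h1
      exact nonneg_of_mul_nonneg_right h2 (by positivity)
  rcases hK with hK | hK
  swap
  · have := abs_quadForm_le_crude E z
    rw [hK, mul_zero] at this ⊢; exact this
  -- Start from the crude bound, which holds for any matrix, and iterate. The fixed point of b ↦ K +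
  -- 9b/16 is 16K/7.
  have hall : ∀ m : ℕ, P (16 / 7 * K + (9 / 16) ^ m * b0) := by
    intro m
    induction m with
    | zero =>
      intro z _
      refine (abs_quadForm_le_crude E z).trans ?_
      have : 0 ≤ ∑ i, z i ^ 2 := Finset.sum_nonneg fun i _ => sq_nonneg _
      rw [pow_zero, one_mul]
      gcongr
      linarith
    | succ m ih =>
      have := step _ (by positivity) ih
      convert this using 1
      rw [pow_succ]; ring
  have hlim : Tendsto (fun m : ℕ => (16 / 7 * K + (9 / 16 : ℝ) ^ m * b0) * ∑ i, z i ^ 2) atTop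
      (𝓝 ((16 / 7 * K + 0 * b0) * ∑ i, z i ^ 2)) :=
    ((tendsto_const_nhds.add ((tendsto_pow_atTop_nhds_zero_of_lt_one (by norm_num)
      (by norm_num)).mul_const _)).mul_const _)
  rw [zero_mul, add_zero] at hlim
  exact ge_of_tendsto' hlim fun m => hall m z hz

/-! ### The norm of the centred trimmed adjacency matrix -/

open scoped Classical in
/-- The adjacency matrix with the rows and columns of high degree zeroed out. -/
noncomputable def trimmedEdge (D : ℝ) (R : Sym2 V → Bool) (i j : V) : ℝ :=
  if 20 * D < degree R i ∨ 20 * D < degree R j then 0 else edge R i j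

/-- The trimmed adjacency matrix is close to the mean in operator norm. -/
def NormBound (D : ℝ) (p : Sym2 V → ℝ) (R : Sym2 V → Bool) : Prop :=
  ∀ z : V → ℝ, |quadForm (fun i j => trimmedEdge D R i j - p s(i, j)) z|
    ≤ 17000 * √D * ∑ i, z i ^ 2

lemma abs_quadForm_lattice_le {p : Sym2 V → ℝ} (h0 : ∀ e, 0 ≤ p e) {D : ℝ}
    (hD : 1 ≤ D) (hp : ∀ e, p e ≤ D / Fintype.card V) (hDN : D ≤ Fintype.card V)
    {R : Sym2 V → Bool} (hdisc : Discrepancy D R) (hlight : LightBound D p R) (w : V → ℤ)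
    (hwU : ∀ i, w i ≠ 0 → degree R i ≤ 20 * D) (hw : ∑ i, (w i : ℝ) ^ 2 ≤ 16 * Fintype.card V) :
    |quadForm (fun i j => edge R i j - p s(i, j)) (fun i => (w i : ℝ))|
      ≤ 115672 * Fintype.card V * √D := by
  classical
  set N : ℝ := (Fintype.card V : ℝ) with hNdef
  have hN : 0 < N := by linarith
  have hq : 1 ≤ √D := by rw [Real.one_le_sqrt]; exact hD
  have hqD : √D ^ 2 = D := Real.sq_sqrt (by linarith)
  have hheavy := heavy_sum_le hD hdisc (fun i => (w i).natAbs)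
    (by simpa [Nat.cast_natAbs, sq_abs] using hw) (fun i hi => hwU i (by simpa using hi))
  simp only [Nat.cast_natAbs, Int.cast_abs] at hheavy
  have hl := hlight w hw
  rw [← hNdef] at hheavy hl
  set q := √D with hqdef
  -- The non-light part consists of heavy edges, heavy means and the diagonal. For a heavy pair |w_i
  -- w_j| ≤ |w_i w_j|²/(16√D), which makes the contribution of the means summable.
  have hsplit : ∀ i j, |(w i : ℝ) * w j * (edge R i j - p s(i, j)) -
      (if i ≠ j ∧ |(w i : ℝ) * w j| ≤ 16 * q then (w i : ℝ) * w j else 0) * (edge R i j - p s(i, j))|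
      ≤ (if 16 * q < |(w i : ℝ)| * |(w j : ℝ)| then edge R i j * (|(w i : ℝ)| * |(w j : ℝ)|) else 0)
        + (D / N / (16 * q)) * ((w i : ℝ) ^ 2 * (w j : ℝ) ^ 2)
        + (if i = j then D / N * (w i : ℝ) ^ 2 else 0) := by
    intro i j
    have hDN0 : 0 < D / N := by positivity
    have hm : 0 ≤ (D / N / (16 * q)) * ((w i : ℝ) ^ 2 * (w j : ℝ) ^ 2) := by positivity
    have he := edge_nonneg R i j
    have hp0 := h0 s(i, j)
    have hd : 0 ≤ if i = j then D / N * (w i : ℝ) ^ 2 else 0 := by split_ifs <;> positivity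
    have hh : 0 ≤ if 16 * q < |(w i : ℝ)| * |(w j : ℝ)| then
        edge R i j * (|(w i : ℝ)| * |(w j : ℝ)|) else 0 := by split_ifs <;> positivity
    by_cases h1 : 16 * q < |(w i : ℝ)| * |(w j : ℝ)|
    · rw [if_neg (fun h => by rw [abs_mul] at h; linarith [h.2]), zero_mul, sub_zero, abs_mul,
        abs_mul, if_pos h1]
      set a := |(w i : ℝ)| * |(w j : ℝ)| with ha
      have ha2 : (w i : ℝ) ^ 2 * (w j : ℝ) ^ 2 = a ^ 2 := by rw [ha, mul_pow, sq_abs, sq_abs]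
      have h2 : |edge R i j - p s(i, j)| ≤ edge R i j + D / N := by
        rw [abs_le]; constructor <;> linarith [hp s(i, j)]
      have h3 : a * (D / N) ≤ (D / N / (16 * q)) * a ^ 2 := by
        rw [div_mul_eq_mul_div, le_div_iff₀ (by positivity)]
        have : a * (16 * q) ≤ a * a := mul_le_mul_of_nonneg_left h1.le (by positivity)
        nlinarith
      have h4 : a * |edge R i j - p s(i, j)| ≤ a * (edge R i j + D / N) :=
        mul_le_mul_of_nonneg_left h2 (by positivity)
      rw [ha2]
      linarith
    · by_cases h2 : i = j
      · subst h2
        rw [if_neg (fun h => h.1 rfl), zero_mul, sub_zero, edge_self, zero_sub, abs_mul, abs_neg,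
          abs_of_nonneg hp0, if_pos rfl, abs_mul, abs_mul_abs_self, ← sq]
        have : (w i : ℝ) ^ 2 * p s(i, i) ≤ D / N * (w i : ℝ) ^ 2 := by
          rw [mul_comm]; gcongr; exact hp _
        rw [if_pos rfl] at hd
        have : 0 ≤ if 16 * q < |(w i : ℝ)| * |(w i : ℝ)| then
          edge R i i * (|(w i : ℝ)| * |(w i : ℝ)|) else 0 := hh
        simp only [zero_mul, ite_self]
        linarith
      · rw [if_pos ⟨h2, by rw [abs_mul]; exact not_lt.1 h1⟩, sub_self, abs_zero]
        linarith
  have hS := Finset.sum_nonneg fun i (_ : i ∈ Finset.univ) => sq_nonneg (w i : ℝ)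
  have hm : ∑ i, ∑ j, (D / N / (16 * q)) * ((w i : ℝ) ^ 2 * (w j : ℝ) ^ 2) ≤ 16 * N * q := by
    calc _ = (D / N / (16 * q)) * ((∑ i, (w i : ℝ) ^ 2) * ∑ j, (w j : ℝ) ^ 2) := by
          rw [Finset.sum_mul_sum, Finset.mul_sum]
          exact Finset.sum_congr rfl fun i _ => by rw [Finset.mul_sum]
      _ ≤ (D / N / (16 * q)) * ((16 * N) * (16 * N)) := by gcongr
      _ = _ := by rw [← hqD]; field_simp
  have hd : ∑ i, ∑ j, (if i = j then D / N * (w i : ℝ) ^ 2 else 0) ≤ 16 * N * q := by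
    simp only [Finset.sum_ite_eq, Finset.mem_univ, if_true]
    rw [← Finset.mul_sum]
    calc _ ≤ D / N * (16 * N) := by gcongr
      _ = 16 * D := by field_simp
      _ ≤ _ := by nlinarith
  have hdiff : |quadForm (fun i j => edge R i j - p s(i, j)) (fun i => (w i : ℝ)) -
      ∑ i, ∑ j, (if i ≠ j ∧ |(w i : ℝ) * w j| ≤ 16 * q then (w i : ℝ) * w j else 0)
        * (edge R i j - p s(i, j))| ≤ 115000 * N * q + 16 * N * q + 16 * N * q := by
    unfold quadForm
    rw [← Finset.sum_sub_distrib]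
    simp_rw [← Finset.sum_sub_distrib]
    refine (Finset.abs_sum_le_sum_abs _ _).trans ?_
    refine (Finset.sum_le_sum fun i _ => (Finset.abs_sum_le_sum_abs _ _).trans
      (Finset.sum_le_sum fun j _ => hsplit i j)).trans ?_
    simp_rw [Finset.sum_add_distrib]
    linarith
  rw [abs_le] at hdiff hl ⊢
  constructor <;> linarith [hdiff.1, hdiff.2, hl.1, hl.2]

lemma sqrt_mul_exp_neg_le {D : ℝ} (hD : 1 ≤ D) : D * √(Real.exp (-D)) ≤ √D := by
  have h1 : √D * √(Real.exp (-D)) ≤ 1 := by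
    rw [← Real.sqrt_mul (by linarith), Real.sqrt_le_one, Real.exp_neg, ← div_eq_mul_inv,
      div_le_one (Real.exp_pos _)]
    linarith [Real.add_one_le_exp D]
  calc D * √(Real.exp (-D)) = √D * (√D * √(Real.exp (-D))) := by
        rw [← mul_assoc, Real.mul_self_sqrt (by linarith)]
    _ ≤ √D * 1 := by gcongr
    _ = _ := mul_one _

/-- On the untrimmed vertices the matrix is the centred adjacency matrix, and the lattice bound
applies. All other entries are just minus the mean, on at most N exp(-D) rows and columns.
Cauchy–Schwarz and D √(exp(-D)) ≤ √D bound their form by 2√D. -/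
lemma normBound_of {p : Sym2 V → ℝ} (h0 : ∀ e, 0 ≤ p e) {D : ℝ}
    (hD : 1 ≤ D) (hp : ∀ e, p e ≤ D / Fintype.card V) (hDN : D ≤ Fintype.card V)
    {R : Sym2 V → Bool} (hfew : FewHighDegrees D R) (hdisc : Discrepancy D R)
    (hlight : LightBound D p R) : NormBound D p R := by
  classical
  intro z
  set N : ℝ := (Fintype.card V : ℝ) with hNdef
  have hN : 0 < N := by linarith
  set U := Finset.univ.filter fun i => degree R i ≤ 20 * D with hU
  have hmU : ∀ i, i ∈ U ↔ degree R i ≤ 20 * D := fun i => by simp [hU]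
  have hUc : ((Uᶜ).card : ℝ) ≤ N * Real.exp (-D) := by
    apply hfew
    intro u hu
    rw [Finset.mem_compl, hmU] at hu
    linarith
  set y : V → ℝ := fun i => if i ∈ U then z i else 0 with hy
  have hS : 0 ≤ ∑ i, z i ^ 2 := Finset.sum_nonneg fun i _ => sq_nonneg _
  have hyz : ∑ i, y i ^ 2 ≤ ∑ i, z i ^ 2 := Finset.sum_le_sum fun i _ => by
    simp only [hy]; split_ifs
    · exact le_rfl
    · rw [zero_pow two_ne_zero]; exact sq_nonneg _
  have h1 := abs_quadForm_le_of_lattice (E := fun i j => edge R i j - p s(i, j))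
    (fun i j => by rw [edge_symm, Sym2.eq_swap]) {i | degree R i ≤ 20 * D} (K := 115672 / 16 * √D)
    (fun w hw hw2 => (abs_quadForm_lattice_le h0 hD hp hDN hdisc hlight w hw hw2).trans_eq (by ring))
    y (fun i hi => by
      simp only [hy] at hi
      split_ifs at hi with h
      · exact (hmU i).1 h
      · exact absurd rfl hi)
  have hdiff : quadForm (fun i j => trimmedEdge D R i j - p s(i, j)) z
      - quadForm (fun i j => edge R i j - p s(i, j)) y
      = -∑ i, ∑ j, (if i ∈ U ∧ j ∈ U then 0 else z i * z j * p s(i, j)) := by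
    unfold quadForm
    rw [← Finset.sum_sub_distrib]
    simp_rw [← Finset.sum_sub_distrib, ← Finset.sum_neg_distrib]
    refine Finset.sum_congr rfl fun i _ => Finset.sum_congr rfl fun j _ => ?_
    simp only [hy, trimmedEdge]
    by_cases hi : i ∈ U <;> by_cases hj : j ∈ U
    · have hn : ¬ (20 * D < degree R i ∨ 20 * D < degree R j) := by
        rw [hmU] at hi hj; push Not; exact ⟨hi, hj⟩
      rw [if_pos hi, if_pos hj, if_pos (c := i ∈ U ∧ j ∈ U) ⟨hi, hj⟩, if_neg hn]
      ring
    all_goals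
      rw [if_neg (c := i ∈ U ∧ j ∈ U) (by tauto), if_pos (c := 20 * D < degree R i ∨ _)
        (by rw [hmU] at hi hj; simp only [not_le] at hi hj; tauto)]
      simp [hi, hj]
  have hcs : ∀ T : Finset V, ∑ i ∈ T, |z i| ≤ √T.card * √(∑ i, z i ^ 2) := by
    intro T
    rw [← Real.sqrt_mul (Nat.cast_nonneg _)]
    apply Real.le_sqrt_of_sq_le
    refine sq_sum_le_card_mul_sum_sq.trans ?_
    simp_rw [sq_abs]
    exact mul_le_mul_of_nonneg_left (Finset.sum_le_sum_of_subset_of_nonneg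
      (Finset.subset_univ _) fun _ _ _ => sq_nonneg _) (Nat.cast_nonneg _)
  have hrest : |∑ i, ∑ j, (if i ∈ U ∧ j ∈ U then 0 else z i * z j * p s(i, j))|
      ≤ 2 * √D * ∑ i, z i ^ 2 := by
    have hterm : ∀ i j, |if i ∈ U ∧ j ∈ U then 0 else z i * z j * p s(i, j)| ≤
        D / N * ((if i ∈ Uᶜ then |z i| else 0) * |z j|) + D / N * (|z i| * (if j ∈ Uᶜ then |z j| else 0)) := by
      intro i j
      have hDN0 : 0 < D / N := by positivity
      have hb : |z i * z j * p s(i, j)| ≤ D / N * (|z i| * |z j|) := by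
        rw [abs_mul, abs_mul, abs_of_nonneg (h0 _), mul_comm]; gcongr; exact hp _
      have hpos : 0 ≤ D / N * (|z i| * |z j|) := by positivity
      by_cases hi : i ∈ U <;> by_cases hj : j ∈ U <;> simp only [hi, hj, Finset.mem_compl, and_self,
        and_true, and_false, not_true_eq_false, not_false_eq_true, if_true, if_false, abs_zero,
        zero_mul, mul_zero, add_zero, zero_add] <;> linarith
    have hsum : ∑ i, ∑ j, (D / N * ((if i ∈ Uᶜ then |z i| else 0) * |z j|)
        + D / N * (|z i| * (if j ∈ Uᶜ then |z j| else 0)))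
        = 2 * (D / N) * ((∑ i ∈ Uᶜ, |z i|) * ∑ j, |z j|) := by
      simp_rw [Finset.sum_add_distrib, ← Finset.mul_sum]
      rw [← Finset.sum_mul, ← Finset.sum_mul, Finset.sum_ite_mem, Finset.univ_inter]
      ring
    refine ((Finset.abs_sum_le_sum_abs _ _).trans (Finset.sum_le_sum fun i _ =>
      (Finset.abs_sum_le_sum_abs _ _).trans (Finset.sum_le_sum fun j _ => hterm i j))).trans ?_
    rw [hsum]
    have e1 : ∑ i ∈ Uᶜ, |z i| ≤ √(N * Real.exp (-D)) * √(∑ i, z i ^ 2) :=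
      (hcs _).trans (by gcongr)
    have e2 : ∑ j, |z j| ≤ √N * √(∑ i, z i ^ 2) := by
      have := hcs Finset.univ; rwa [Finset.card_univ] at this
    calc _ ≤ 2 * (D / N) * ((√(N * Real.exp (-D)) * √(∑ i, z i ^ 2)) * (√N * √(∑ i, z i ^ 2))) := by
          gcongr
      _ = 2 * (D / N) * (√N * √N) * √(Real.exp (-D)) * (√(∑ i, z i ^ 2) * √(∑ i, z i ^ 2)) := by
          rw [Real.sqrt_mul hN.le]; ring
      _ = 2 * (D * √(Real.exp (-D))) * ∑ i, z i ^ 2 := by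
          rw [Real.mul_self_sqrt hN.le, Real.mul_self_sqrt hS]; field_simp
      _ ≤ _ := by
          have := sqrt_mul_exp_neg_le hD
          have h2 : 2 * (D * √(Real.exp (-D))) ≤ 2 * √D := by linarith
          exact mul_le_mul_of_nonneg_right h2 hS
  have hq : 0 ≤ √D := Real.sqrt_nonneg _
  have hfin : 16 / 7 * (115672 / 16 * √D) * ∑ i, y i ^ 2 ≤ 16525 * √D * ∑ i, z i ^ 2 := by
    have : 16 / 7 * (115672 / 16 * √D) ≤ 16525 * √D := by linarith
    exact mul_le_mul this hyz (Finset.sum_nonneg fun i _ => sq_nonneg _) (by positivity)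
  have hqS : 0 ≤ √D * ∑ i, z i ^ 2 := by positivity
  rw [abs_le] at h1 hrest ⊢
  constructor <;> nlinarith [h1.1, h1.2, hrest.1, hrest.2]

lemma normBound_prob {p : Sym2 V → ℝ} (h0 : ∀ e, 0 ≤ p e) (h1 : ∀ e, p e ≤ 1) {D : ℝ}
    (hD : 1 ≤ D) (hp : ∀ e, p e ≤ D / Fintype.card V) (hDN : D ≤ Fintype.card V) :
    (coins p).real {R | ¬ NormBound D p R} ≤
      Real.exp (-(Fintype.card V * Real.exp (-D))) * (Fintype.card V + 1) + 8 / Fintype.card V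
        + 2 * Real.exp (-(Fintype.card V)) := by
  have hN : 0 < Fintype.card V := by
    have : (0 : ℝ) < Fintype.card V := by linarith
    exact_mod_cast this
  have hsub : {R | ¬ NormBound D p R} ⊆ ({R | ¬ FewHighDegrees D R} ∪ {R | ¬ Discrepancy D R}) ∪
      {R | ¬ LightBound D p R} := by
    intro R hR
    by_contra hcon
    simp only [Set.mem_union, Set.mem_ofPred_eq, not_or, not_not] at hcon
    exact hR (normBound_of h0 hD hp hDN hcon.1.1 hcon.1.2 hcon.2)
  refine (measureReal_mono hsub).trans ((measureReal_union_le _ _).trans ?_)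
  refine add_le_add ((measureReal_union_le _ _).trans (add_le_add ?_ ?_)) ?_
  · exact fewHighDegrees_prob h0 h1 hD hp
  · exact discrepancy_prob h0 h1 (by linarith) hp hN
  · exact light_prob h0 h1 (by linarith) hp hN

end BlockModel

namespace BlockModel

open Matrix

variable {V : Type*} [Fintype V]

/-! ### The Euclidean norm on functions -/

/-- The Euclidean norm of a function. -/
noncomputable def l2 (z : V → ℝ) : ℝ := ‖(WithLp.toLp 2 z : EuclideanSpace ℝ V)‖

lemma l2_sq (z : V → ℝ) : l2 z ^ 2 = ∑ i, z i ^ 2 := EuclideanSpace.real_norm_sq_eq _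

lemma l2_nonneg (z : V → ℝ) : 0 ≤ l2 z := norm_nonneg _

lemma l2_add_le (y z : V → ℝ) : l2 (y + z) ≤ l2 y + l2 z := norm_add_le _ _

lemma l2_sub_le (y z : V → ℝ) : l2 (y - z) ≤ l2 y + l2 z := norm_sub_le _ _

lemma l2_smul (c : ℝ) (z : V → ℝ) : l2 (c • z) = |c| * l2 z :=
  norm_smul c (WithLp.toLp 2 z : EuclideanSpace ℝ V)

lemma l2_zero : l2 (0 : V → ℝ) = 0 := norm_zero

lemma l2_le {z : V → ℝ} {c : ℝ} (hc : 0 ≤ c) (h : ∑ i, z i ^ 2 ≤ c ^ 2) : l2 z ≤ c :=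
  le_of_sq_le_sq (by rwa [l2_sq]) hc

lemma l2_mono {y z : V → ℝ} (h : ∀ i, |y i| ≤ |z i|) : l2 y ≤ l2 z :=
  l2_le (l2_nonneg z) <| by
    rw [l2_sq]; exact Finset.sum_le_sum fun i _ => sq_le_sq.2 (h i)

lemma dot_self (z : V → ℝ) : z ⬝ᵥ z = l2 z ^ 2 := by
  rw [l2_sq]; exact Finset.sum_congr rfl fun i _ => by ring

lemma abs_dot_le (y z : V → ℝ) : |y ⬝ᵥ z| ≤ l2 y * l2 z := by
  have h := abs_real_inner_le_norm (WithLp.toLp 2 y : EuclideanSpace ℝ V) (WithLp.toLp 2 z)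
  have e : inner ℝ (WithLp.toLp 2 y : EuclideanSpace ℝ V) (WithLp.toLp 2 z) = y ⬝ᵥ z := by
    rw [PiLp.inner_apply]
    exact Finset.sum_congr rfl fun i _ => by simp [mul_comm]
  rw [e] at h
  exact h

lemma l2_indicator_le (S : Set V) (z : V → ℝ) : l2 (S.indicator z) ≤ l2 z :=
  l2_mono fun i => by
    by_cases h : i ∈ S
    · rw [Set.indicator_of_mem h]
    · rw [Set.indicator_of_notMem h, abs_zero]; exact abs_nonneg _

lemma l2_indicator_sq (S : Finset V) (z : V → ℝ) :
    l2 ((S : Set V).indicator z) ^ 2 = ∑ i ∈ S, z i ^ 2 := by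
  classical
  rw [l2_sq, ← Finset.sum_subset (Finset.subset_univ S)]
  · exact Finset.sum_congr rfl fun i hi => by rw [Set.indicator_of_mem (Finset.mem_coe.2 hi)]
  · intro i _ hi
    rw [Set.indicator_of_notMem (by simpa using hi)]; simp

/-- Few entries are large, compared with the Euclidean norm. -/
lemma card_le_of_l2 {z : V → ℝ} {c t k : ℝ} (ht : 0 < t) (S : Finset V) (h : ∀ i ∈ S, t ≤ |z i|)
    (hz : l2 ((S : Set V).indicator z) ≤ c) (hk : c ^ 2 ≤ k * t ^ 2) : (S.card : ℝ) ≤ k := by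
  have h1 : (S.card : ℝ) * t ^ 2 ≤ ∑ i ∈ S, z i ^ 2 := by
    rw [← nsmul_eq_mul, ← Finset.sum_const]
    exact Finset.sum_le_sum fun i hi => by
      rw [← sq_abs (z i)]; exact pow_le_pow_left₀ ht.le (h i hi) 2
  rw [← l2_indicator_sq] at h1
  have h2 : l2 ((S : Set V).indicator z) ^ 2 ≤ c ^ 2 := pow_le_pow_left₀ (l2_nonneg _) hz 2
  have ht2 : 0 < t ^ 2 := by positivity
  exact le_of_mul_le_mul_right (h1.trans (h2.trans hk)) ht2

/-! ### Operator norms -/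

lemma bilinForm_eq (E : Matrix V V ℝ) (y z : V → ℝ) : bilinForm E y z = y ⬝ᵥ (E *ᵥ z) := by
  simp only [bilinForm, dotProduct, mulVec, Finset.mul_sum]
  exact Finset.sum_congr rfl fun i _ => Finset.sum_congr rfl fun j _ => by ring

/-- For a symmetric matrix, polarisation turns the quadratic bound into a bilinear one. It is
applied to z and to the multiple of Ez that has the length of z. -/
lemma l2_mulVec_le {E : Matrix V V ℝ} (hE : ∀ i j, E i j = E j i) {ρ : ℝ}
    (h : ∀ z, |quadForm E z| ≤ ρ * ∑ i, z i ^ 2) (z : V → ℝ) : l2 (E *ᵥ z) ≤ ρ * l2 z := by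
  have hbil : ∀ y z : V → ℝ, 2 * bilinForm E y z ≤ ρ * (l2 y ^ 2 + l2 z ^ 2) := by
    intro y z
    have e1 := quadForm_add E hE y z 1
    have e2 := quadForm_add E hE y z (-1)
    have b1 := (abs_le.1 (h fun i => y i + 1 * z i)).2
    have b2 := (abs_le.1 (h fun i => y i + -1 * z i)).1
    have e3 : ∑ i, (y i + 1 * z i) ^ 2 + ∑ i, (y i + -1 * z i) ^ 2 = 2 * (l2 y ^ 2 + l2 z ^ 2) := by
      rw [l2_sq, l2_sq, ← Finset.sum_add_distrib, ← Finset.sum_add_distrib, Finset.mul_sum]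
      exact Finset.sum_congr rfl fun i _ => by ring
    rw [e1] at b1
    rw [e2] at b2
    have : ρ * (∑ i, (y i + 1 * z i) ^ 2 + ∑ i, (y i + -1 * z i) ^ 2)
        = ρ * (2 * (l2 y ^ 2 + l2 z ^ 2)) := by rw [e3]
    rw [mul_add] at this
    linarith
  rcases (l2_nonneg (E *ᵥ z)).eq_or_lt with h0 | h0
  · rw [← h0]
    have := abs_nonneg (quadForm E z)
    have h2 := this.trans (h z)
    rw [← l2_sq] at h2
    rcases (l2_nonneg z).eq_or_lt with h3 | h3
    · rw [← h3, mul_zero]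
    · have : 0 < l2 z ^ 2 := by positivity
      exact mul_nonneg (nonneg_of_mul_nonneg_left h2 this) h3.le
  have hz : 0 < l2 z := by
    rcases (l2_nonneg z).eq_or_lt with h3 | h3
    · exfalso
      have : z = 0 := by
        have h4 : (WithLp.toLp 2 z : EuclideanSpace ℝ V) = 0 := norm_eq_zero.1 h3.symm
        have := congrArg WithLp.ofLp h4
        simpa using this
      rw [this, mulVec_zero, l2_zero] at h0
      exact lt_irrefl _ h0
    · exact h3
  set c := l2 z / l2 (E *ᵥ z) with hc
  have hc0 : 0 < c := by positivity
  have h1 := hbil (c • (E *ᵥ z)) z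
  rw [bilinForm_eq, smul_dotProduct, dot_self, l2_smul, abs_of_pos hc0, smul_eq_mul] at h1
  have e : c * l2 (E *ᵥ z) = l2 z := by rw [hc]; field_simp
  have h2 : 2 * (l2 z * l2 (E *ᵥ z)) ≤ ρ * (2 * l2 z ^ 2) := by
    rw [e] at h1
    calc 2 * (l2 z * l2 (E *ᵥ z)) = 2 * (c * l2 (E *ᵥ z) ^ 2) := by rw [← e]; ring
      _ ≤ _ := by linarith
  have h3 : l2 z * l2 (E *ᵥ z) ≤ l2 z * (ρ * l2 z) := by linarith
  exact le_of_mul_le_mul_left h3 hz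

/-! ### The second eigenvalue -/

/-- The Rayleigh quotient is bounded by the largest eigenvalue. -/
lemma inner_self_le_of_eigenvalue_le {E : Type*} [NormedAddCommGroup E] [InnerProductSpace ℝ E]
    [FiniteDimensional ℝ E] {T : E →ₗ[ℝ] E} (hT : T.IsSymmetric) {c : ℝ}
    (h : ∀ z : E, ∀ l : ℝ, z ≠ 0 → T z = l • z → l ≤ c) (w : E) :
    inner ℝ w (T w) ≤ c * ‖w‖ ^ 2 := by
  set b := hT.eigenvectorBasis rfl with hb
  have h1 := b.sum_inner_mul_inner w (T w)
  have h2 := b.sum_sq_norm_inner_right w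
  rw [← h1, ← h2, Finset.mul_sum]
  refine Finset.sum_le_sum fun i _ => ?_
  have e : inner ℝ (b i) (T w) = hT.eigenvalues rfl i * inner ℝ (b i) w := by
    rw [← hT, hb, hT.apply_eigenvectorBasis, inner_smul_left]; simp
  have hl : hT.eigenvalues rfl i ≤ c := h (b i) _ (b.orthonormal.ne_zero i) (by
    rw [hb, hT.apply_eigenvectorBasis]; rfl)
  rw [e, real_inner_comm, Real.norm_eq_abs, sq_abs]
  nlinarith [sq_nonneg (inner ℝ (b i) w)]

/-- A vector perpendicular to the first eigenvector has a Rayleigh quotient at most the second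
eigenvalue. -/
lemma rayleigh_le_of_topTwo {A : Matrix V V ℝ} (hA : A.IsHermitian) {x y : EuclideanSpace ℝ V}
    {l₁ l₂ : ℝ} (hxy : Orthonormal ℝ ![x, y]) (hx : A.mulVec x.ofLp = l₁ • x.ofLp)
    (hy : A.mulVec y.ofLp = l₂ • y.ofLp)
    (htop : ∀ (z : EuclideanSpace ℝ V) (l : ℝ), z ∈ (Submodule.span ℝ {x, y})ᗮ → z ≠ 0 →
      A.mulVec z.ofLp = l • z.ofLp → l ≤ l₂)
    (w : EuclideanSpace ℝ V) (hw : inner ℝ x w = 0) :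
    w.ofLp ⬝ᵥ (A *ᵥ w.ofLp) ≤ l₂ * ‖w‖ ^ 2 := by
  classical
  set T := Matrix.toEuclideanLin A with hTdef
  have hT : T.IsSymmetric := Matrix.isSymmetric_toEuclideanLin_iff.2 hA
  have hTa : ∀ z : EuclideanSpace ℝ V, T z = WithLp.toLp 2 (A *ᵥ z.ofLp) := fun z => rfl
  have hTx : T x = l₁ • x := by rw [hTa, hx]; rfl
  have hTy : T y = l₂ • y := by rw [hTa, hy]; rfl
  set W := Submodule.span ℝ {x, y} with hW
  have hmem : ∀ z, z ∈ Wᗮ ↔ inner ℝ x z = 0 ∧ inner ℝ y z = 0 := by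
    intro z
    rw [Submodule.mem_orthogonal]
    constructor
    · intro h
      exact ⟨h x (Submodule.subset_span (by simp)), h y (Submodule.subset_span (by simp))⟩
    · rintro ⟨h1, h2⟩ u hu
      obtain ⟨a, b, rfl⟩ := Submodule.mem_span_pair.1 hu
      rw [inner_add_left, inner_smul_left, inner_smul_left, h1, h2]; simp
  -- Symmetry makes the orthogonal complement of `W` invariant, so the spectral theorem applies
  -- there. The remaining part of `w` is a multiple of `y`, and no cross terms arise.
  have hinv : ∀ z ∈ Wᗮ, T z ∈ Wᗮ := by
    intro z hz
    rw [hmem] at hz ⊢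
    rw [← hT, ← hT, hTx, hTy, inner_smul_left, inner_smul_left, hz.1, hz.2]; simp
  have hT' := hT.restrict_invariant hinv
  have hR := inner_self_le_of_eigenvalue_le hT' (c := l₂) (by
    intro z l hz hzl
    have h1 : T z = l • (z : EuclideanSpace ℝ V) := by
      have := congrArg (Subtype.val) hzl
      simpa using this
    refine htop z l z.2 (by simpa using hz) ?_
    have := congrArg WithLp.ofLp h1
    rw [hTa] at this
    exact this)
  have hyy : inner ℝ y y = (1 : ℝ) := by
    have h1 : ‖y‖ = 1 := by simpa using hxy.1 1
    rw [real_inner_self_eq_norm_sq, h1]; norm_num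
  have hxy0 : inner ℝ x y = (0 : ℝ) := by
    have := hxy.2 (i := 0) (j := 1) (by simp)
    simpa using this
  set c : ℝ := inner ℝ y w with hc
  set w' := w - c • y with hw'
  have hwmem : w' ∈ Wᗮ := by
    rw [hmem, hw', inner_sub_right, inner_sub_right, inner_smul_right, inner_smul_right, hw, hxy0,
      hyy, ← hc]
    simp
  have hww : w = w' + c • y := by rw [hw']; simp
  have hR' := hR ⟨w', hwmem⟩
  have hR2 : inner ℝ w' (T w') ≤ l₂ * ‖w'‖ ^ 2 := hR'
  have hyw : inner ℝ y w' = (0 : ℝ) := ((hmem w').1 hwmem).2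
  have hwy : inner ℝ w' y = (0 : ℝ) := by rw [real_inner_comm]; exact hyw
  have e1 : inner ℝ w (T w) = inner ℝ w' (T w') + c ^ 2 * l₂ := by
    rw [hww, map_add, map_smul, hTy, inner_add_left, inner_add_right, inner_add_right,
      inner_smul_left, inner_smul_left, inner_smul_right, inner_smul_right, ← hT y, hTy,
      inner_smul_left, inner_smul_right, inner_smul_right, hyw, hwy, hyy]
    simp; ring
  have e2 : ‖w‖ ^ 2 = ‖w'‖ ^ 2 + c ^ 2 := by
    rw [← real_inner_self_eq_norm_sq, ← real_inner_self_eq_norm_sq]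
    conv_lhs => rw [hww]
    rw [inner_add_left, inner_add_right, inner_add_right,
      inner_smul_left, inner_smul_left, inner_smul_right, inner_smul_right, hyw, hwy, hyy]
    simp; ring
  have e3 : inner ℝ w (T w) = w.ofLp ⬝ᵥ (A *ᵥ w.ofLp) := by
    rw [hTa, PiLp.inner_apply]
    exact Finset.sum_congr rfl fun i _ => by simp [mul_comm]
  rw [← e3, e1, e2]
  nlinarith

end BlockModel

namespace BlockModel

open Matrix

variable {V : Type*} [Fintype V]

/-! ### The planted mean matrix -/

/-- The matrix of the edge probabilities. -/
def meanMatrix (p : Sym2 V → ℝ) : Matrix V V ℝ := fun i j => p s(i, j)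

/-- The trimmed adjacency matrix. -/
noncomputable def trimmedMatrix (D : ℝ) (R : Sym2 V → Bool) : Matrix V V ℝ :=
  fun i j => trimmedEdge D R i j

/-- The centred trimmed adjacency matrix. -/
noncomputable def noise (D : ℝ) (p : Sym2 V → ℝ) (R : Sym2 V → Bool) : Matrix V V ℝ :=
  fun i j => trimmedEdge D R i j - p s(i, j)

/-- The edge probabilities `p` are those of two balanced blocks with signs `σ`, with mean degree
`d / 2` and second eigenvalue `m`. -/
structure Planted (σ : V → ℝ) (d m : ℝ) (p : Sym2 V → ℝ) : Prop where
  sq : ∀ i, σ i ^ 2 = 1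
  sum_eq_zero : ∑ i, σ i = 0
  mean : ∀ i j, p s(i, j) = d / (2 * Fintype.card V) + m / Fintype.card V * (σ i * σ j)
  pos : 0 < m
  le : 2 * m ≤ d
  card_pos : 0 < Fintype.card V

lemma trimmedEdge_symm (D : ℝ) (R : Sym2 V → Bool) (i j : V) :
    trimmedEdge D R i j = trimmedEdge D R j i := by
  unfold trimmedEdge
  simp only [or_comm (a := 20 * D < degree R i), edge_symm R i j]

lemma noise_symm (D : ℝ) (p : Sym2 V → ℝ) (R : Sym2 V → Bool) (i j : V) :
    noise D p R i j = noise D p R j i := by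
  unfold noise; rw [trimmedEdge_symm, Sym2.eq_swap]

lemma trimmedMatrix_eq (D : ℝ) (p : Sym2 V → ℝ) (R : Sym2 V → Bool) :
    trimmedMatrix D R = meanMatrix p + noise D p R := by
  ext i j; simp [trimmedMatrix, meanMatrix, noise]

lemma trimmedMatrix_isHermitian (D : ℝ) (R : Sym2 V → Bool) : (trimmedMatrix D R).IsHermitian := by
  ext i j
  simp [trimmedMatrix, trimmedEdge_symm D R j i]

namespace Planted

variable {σ : V → ℝ} {d m : ℝ} {p : Sym2 V → ℝ} (H : Planted σ d m p)
include H

lemma card_pos' : (0 : ℝ) < Fintype.card V := by exact_mod_cast H.card_pos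

lemma mulVec (z : V → ℝ) : meanMatrix p *ᵥ z = fun i =>
    d / (2 * Fintype.card V) * ∑ j, z j + m / Fintype.card V * (∑ j, σ j * z j) * σ i := by
  ext i
  simp only [Matrix.mulVec, dotProduct, meanMatrix, H.mean]
  simp_rw [add_mul, Finset.sum_add_distrib]
  rw [Finset.mul_sum, Finset.mul_sum, Finset.sum_mul]
  congr 1
  exact Finset.sum_congr rfl fun j _ => by ring

lemma l2_comb_sq (a b : ℝ) :
    l2 (fun i => a + b * σ i) ^ 2 = (a ^ 2 + b ^ 2) * Fintype.card V := by
  rw [l2_sq]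
  have : ∀ i, (a + b * σ i) ^ 2 = a ^ 2 + b ^ 2 + 2 * a * b * σ i := fun i => by
    linear_combination b ^ 2 * H.sq i
  simp_rw [this, Finset.sum_add_distrib, ← Finset.mul_sum, H.sum_eq_zero]
  simp; ring

lemma l2_comb_le (a b : ℝ) : l2 (fun i => a + b * σ i) ≤ (|a| + |b|) * √(Fintype.card V) := by
  refine le_of_sq_le_sq ?_ (by positivity)
  rw [H.l2_comb_sq, mul_pow, Real.sq_sqrt H.card_pos'.le]
  have h1 := mul_nonneg (abs_nonneg a) (abs_nonneg b)
  refine mul_le_mul_of_nonneg_right ?_ H.card_pos'.le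
  nlinarith [sq_abs a, sq_abs b]

lemma l2_sigma : l2 σ = √(Fintype.card V) := by
  have h := H.l2_comb_sq 0 1
  simp only [zero_add, one_mul] at h
  rw [← Real.sqrt_sq (l2_nonneg σ)]
  congr 1
  have e : l2 (fun i => σ i) = l2 σ := rfl
  rw [e] at h
  linarith

omit H in
lemma l2_one : l2 (fun _ : V => (1 : ℝ)) = √(Fintype.card V) := by
  rw [← Real.sqrt_sq (l2_nonneg _), l2_sq]
  simp

lemma sum_comb (a b : ℝ) : ∑ i, (a + b * σ i) = a * Fintype.card V := by
  rw [Finset.sum_add_distrib, ← Finset.mul_sum, H.sum_eq_zero]; simp [mul_comm]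

lemma sum_sigma_comb (a b : ℝ) : ∑ i, σ i * (a + b * σ i) = b * Fintype.card V := by
  have : ∀ i, σ i * (a + b * σ i) = a * σ i + b := fun i => by
    linear_combination b * H.sq i
  simp_rw [this, Finset.sum_add_distrib, ← Finset.mul_sum, H.sum_eq_zero]
  simp [mul_comm]

omit H in
lemma abs_sum_le (z : V → ℝ) : |∑ i, z i| ≤ √(Fintype.card V) * l2 z := by
  have h := abs_dot_le (fun _ => (1 : ℝ)) z
  rw [l2_one] at h
  simpa [dotProduct] using h

lemma abs_sum_sigma_le (z : V → ℝ) : |∑ i, σ i * z i| ≤ √(Fintype.card V) * l2 z := by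
  have h := abs_dot_le σ z
  rwa [H.l2_sigma] at h

end Planted

/-! ### The top two eigenvectors of the trimmed matrix -/

/-- `X` is an eigenvector of the trimmed adjacency matrix with eigenvalue `l`, and `a + b σ` is
the image of `X` under the mean matrix, divided by `l`. -/
structure IsEigen (σ : V → ℝ) (d m : ℝ) (p : Sym2 V → ℝ) (R : Sym2 V → Bool) (X : V → ℝ)
    (l a b : ℝ) : Prop where
  norm : l2 X = √(Fintype.card V)
  eig : trimmedMatrix d R *ᵥ X = l • X
  decomp : ∀ u, X u = a + b * σ u + (noise d p R *ᵥ X) u / l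
  abs_a_le : |a| ≤ 2
  abs_b_le : |b| ≤ 2
  le : 99 / 100 * m ≤ l

/-- The scaling by √N makes typical entries of order one. Since a + bσ equals X - ΔX/l, its norm is
at most 2√N, which gives a² + b² ≤ 4. -/
lemma isEigen_of {σ : V → ℝ} {d m : ℝ} {p : Sym2 V → ℝ} (H : Planted σ d m p) {R : Sym2 V → Bool}
    {ε : ℝ} (hε : ε ≤ 1 / 10 ^ 6) (hnoise : ∀ z, l2 (noise d p R *ᵥ z) ≤ ε * m * l2 z)
    {x : EuclideanSpace ℝ V} {l : ℝ} (hx : ‖x‖ = 1) (hxl : trimmedMatrix d R *ᵥ x.ofLp = l • x.ofLp)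
    (hl : 99 / 100 * m ≤ l) :
    ∃ a b, IsEigen σ d m p R (fun u => √(Fintype.card V) * x u) l a b := by
  have hN := H.card_pos'
  have hm := H.pos
  set N : ℝ := (Fintype.card V : ℝ) with hNdef
  have hl0 : 0 < l := by linarith
  set X : V → ℝ := fun u => √N * x u with hX
  have hXs : X = √N • x.ofLp := rfl
  have hnorm : l2 X = √N := by
    rw [hXs, l2_smul, abs_of_nonneg (Real.sqrt_nonneg _)]
    have : l2 x.ofLp = 1 := hx
    rw [this, mul_one]
  have heig : trimmedMatrix d R *ᵥ X = l • X := by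
    rw [hXs, mulVec_smul, hxl, smul_comm]
  set a := d / (2 * N) * (∑ j, X j) / l with ha
  set b := m / N * (∑ j, σ j * X j) / l with hb
  have hmean : ∀ u, (meanMatrix p *ᵥ X) u = l * (a + b * σ u) := by
    intro u
    rw [H.mulVec, ha, hb]
    simp only [← hNdef]
    field_simp
  have hdec : ∀ u, X u = a + b * σ u + (noise d p R *ᵥ X) u / l := by
    intro u
    have h1 := congrFun heig u
    rw [trimmedMatrix_eq d p, add_mulVec, Pi.add_apply, hmean, Pi.smul_apply, smul_eq_mul] at h1
    field_simp
    linarith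
  have hcomb : l2 (fun u => a + b * σ u) ≤ 2 * √N := by
    have e : (fun u => a + b * σ u) = X - (1 / l) • (noise d p R *ᵥ X) := by
      ext u
      rw [Pi.sub_apply, Pi.smul_apply, smul_eq_mul, hdec u]; ring
    rw [e]
    refine (l2_sub_le _ _).trans ?_
    rw [l2_smul, abs_of_pos (by positivity), hnorm]
    have h1 := hnoise X
    rw [hnorm] at h1
    have hs : 0 ≤ √N := Real.sqrt_nonneg _
    have h2 : 1 / l * l2 (noise d p R *ᵥ X) ≤ √N := by
      rw [one_div_mul_eq_div, div_le_iff₀ hl0]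
      refine h1.trans ?_
      rw [mul_comm]
      refine mul_le_mul_of_nonneg_left ?_ hs
      nlinarith
    linarith
  have hab : a ^ 2 + b ^ 2 ≤ 4 := by
    have h1 := pow_le_pow_left₀ (l2_nonneg _) hcomb 2
    rw [H.l2_comb_sq, mul_pow, Real.sq_sqrt hN.le] at h1
    have : (a ^ 2 + b ^ 2) * N ≤ 4 * N := by linarith
    exact le_of_mul_le_mul_right this hN
  refine ⟨a, b, hnorm, heig, hdec, abs_le_of_sq_le_sq (by nlinarith [sq_nonneg b]) (by norm_num),
    abs_le_of_sq_le_sq (by nlinarith [sq_nonneg a]) (by norm_num), hl⟩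

/-- The second eigenvalue is at least that of the mean matrix, up to the norm of the noise. -/
lemma second_eigenvalue_ge {σ : V → ℝ} {d m : ℝ} {p : Sym2 V → ℝ} (H : Planted σ d m p)
    {R : Sym2 V → Bool} {ρ : ℝ} (hnoise : ∀ z, l2 (noise d p R *ᵥ z) ≤ ρ * l2 z)
    {x y : EuclideanSpace ℝ V} {l₁ l₂ : ℝ} (hxy : Orthonormal ℝ ![x, y])
    (hx : (trimmedMatrix d R).mulVec x.ofLp = l₁ • x.ofLp)
    (hy : (trimmedMatrix d R).mulVec y.ofLp = l₂ • y.ofLp)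
    (htop : ∀ (z : EuclideanSpace ℝ V) (l : ℝ), z ∈ (Submodule.span ℝ {x, y})ᗮ → z ≠ 0 →
      (trimmedMatrix d R).mulVec z.ofLp = l • z.ofLp → l ≤ l₂) : m - ρ ≤ l₂ := by
  have hN := H.card_pos'
  set N : ℝ := (Fintype.card V : ℝ) with hNdef
  -- The plane spanned by 1 and σ contains a nonzero vector perpendicular to `x`. The mean matrix
  -- has eigenvalues d/2 ≥ m and m on this plane, so the Rayleigh quotient of that vector bounds
  -- `l₂` from below.
  obtain ⟨c₁, c₂, hc, hperp⟩ : ∃ c₁ c₂ : ℝ, 0 < c₁ ^ 2 + c₂ ^ 2 ∧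
      c₁ * ∑ i, x i + c₂ * ∑ i, σ i * x i = 0 := by
    by_cases h : ∑ i, x i = 0
    · exact ⟨1, 0, by norm_num, by rw [h]; ring⟩
    · refine ⟨∑ i, σ i * x i, -∑ i, x i, ?_, by ring⟩
      have : 0 < (-∑ i, x i) ^ 2 := by
        have := neg_ne_zero.2 h
        positivity
      nlinarith [sq_nonneg (∑ i, σ i * x i)]
  set w : V → ℝ := fun i => c₁ + c₂ * σ i with hw
  have hwx : inner ℝ x (WithLp.toLp 2 w : EuclideanSpace ℝ V) = (0 : ℝ) := by
    rw [PiLp.inner_apply, ← hperp, Finset.mul_sum, Finset.mul_sum, ← Finset.sum_add_distrib]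
    exact Finset.sum_congr rfl fun i _ => by simp [hw]; ring
  have h := rayleigh_le_of_topTwo (trimmedMatrix_isHermitian d R) hxy hx hy htop
    (WithLp.toLp 2 w) hwx
  have hw2 : l2 w ^ 2 = (c₁ ^ 2 + c₂ ^ 2) * N := H.l2_comb_sq _ _
  change w ⬝ᵥ (trimmedMatrix d R *ᵥ w) ≤ l₂ * l2 w ^ 2 at h
  rw [trimmedMatrix_eq d p, add_mulVec, dotProduct_add] at h
  have hn := (abs_le.1 (abs_dot_le w (noise d p R *ᵥ w))).1
  have hn2 := mul_le_mul_of_nonneg_left (hnoise w) (l2_nonneg w)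
  have hM : w ⬝ᵥ (meanMatrix p *ᵥ w) = (d / 2 * c₁ ^ 2 + m * c₂ ^ 2) * N := by
    rw [H.mulVec, H.sum_comb, H.sum_sigma_comb]
    have : ∀ i, w i * (d / (2 * N) * (c₁ * N) + m / N * (c₂ * N) * σ i)
        = (d / 2 * c₁) * w i + m * c₂ * (σ i * w i) := fun i => by field_simp
    simp only [dotProduct, ← hNdef, this]
    rw [Finset.sum_add_distrib, ← Finset.mul_sum, ← Finset.mul_sum, H.sum_comb, H.sum_sigma_comb]
    ring
  have hMge : m * l2 w ^ 2 ≤ w ⬝ᵥ (meanMatrix p *ᵥ w) := by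
    rw [hM, hw2, ← mul_assoc]
    refine mul_le_mul_of_nonneg_right ?_ hN.le
    nlinarith [H.le, sq_nonneg c₁]
  have hpos : 0 < l2 w ^ 2 := by rw [hw2]; positivity
  have : (m - ρ) * l2 w ^ 2 ≤ l₂ * l2 w ^ 2 := by nlinarith
  exact le_of_mul_le_mul_right this hpos

set_option maxHeartbeats 1000000 in
/-- The vector used by the spectral partition is close to the vector of the blocks. -/
theorem spectral_coefficients {σ : V → ℝ} {d m : ℝ} {p : Sym2 V → ℝ} (H : Planted σ d m p)
    {R : Sym2 V → Bool} {ε : ℝ} (hε0 : 0 ≤ ε) (hε : ε ≤ 1 / 10 ^ 6)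
    (hnoise : ∀ z, l2 (noise d p R *ᵥ z) ≤ ε * m * l2 z)
    {W : Submodule ℝ (EuclideanSpace ℝ V)} {v : EuclideanSpace ℝ V}
    (hW : IsTopTwoEigenspace (trimmedMatrix d R) W) (hv : v ∈ W) (hv1 : ‖v‖ = 1)
    (hperp : inner ℝ (W.starProjection allOnes) v = (0 : ℝ)) :
    ∃ (X Y : V → ℝ) (l₁ l₂ a₁ b₁ a₂ b₂ α β s : ℝ),
      IsEigen σ d m p R X l₁ a₁ b₁ ∧ IsEigen σ d m p R Y l₂ a₂ b₂ ∧
      (∀ u, √(Fintype.card V) * v u = α * X u + β * Y u) ∧ |α| ≤ 1 ∧ |β| ≤ 1 ∧ s ^ 2 = 1 ∧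
      |α * a₁ + β * a₂| ≤ 4 * ε ∧ |α * b₁ + β * b₂ - s| ≤ 8 * ε ∧
      |α * a₁ / l₁ + β * a₂ / l₂| ≤ 64 * ε / m ∧
      |α * b₁ / l₁ + β * b₂ / l₂ - s / m| ≤ 64 * ε / m := by
  obtain ⟨x, y, l₁, l₂, hxy, hx, hy, hl, rfl, htop⟩ := hW
  have hN := H.card_pos'
  have hm := H.pos
  have hl₂ := second_eigenvalue_ge H hnoise hxy hx hy htop
  have hl₂' : 99 / 100 * m ≤ l₂ := by nlinarith
  have hl₁' : 99 / 100 * m ≤ l₁ := hl₂'.trans hl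
  have hx1 : ‖x‖ = 1 := by simpa using hxy.1 0
  have hy1 : ‖y‖ = 1 := by simpa using hxy.1 1
  have hxy0 : inner ℝ x y = (0 : ℝ) := by
    have := hxy.2 (i := 0) (j := 1) (by simp)
    simpa using this
  obtain ⟨a₁, b₁, hX⟩ := isEigen_of H hε hnoise hx1 hx hl₁'
  obtain ⟨a₂, b₂, hY⟩ := isEigen_of H hε hnoise hy1 hy hl₂'
  set N : ℝ := (Fintype.card V : ℝ) with hNdef
  set X : V → ℝ := fun u => √N * x u with hXdef
  set Y : V → ℝ := fun u => √N * y u with hYdef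
  obtain ⟨α, β, hαβ⟩ := Submodule.mem_span_pair.1 hv
  have hnorm : α ^ 2 + β ^ 2 = 1 := by
    have h1 : ‖v‖ ^ 2 = 1 := by rw [hv1]; norm_num
    rw [← hαβ, ← real_inner_self_eq_norm_sq, inner_add_left, inner_add_right, inner_add_right,
      inner_smul_left, inner_smul_left, inner_smul_left, inner_smul_left, inner_smul_right,
      inner_smul_right, inner_smul_right, inner_smul_right, real_inner_comm x y, hxy0,
      real_inner_self_eq_norm_sq, real_inner_self_eq_norm_sq, hx1, hy1] at h1
    simp at h1
    linarith
  have hα : |α| ≤ 1 := abs_le_of_sq_le_sq (by nlinarith [sq_nonneg β]) (by norm_num)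
  have hβ : |β| ≤ 1 := abs_le_of_sq_le_sq (by nlinarith [sq_nonneg α]) (by norm_num)
  set U : V → ℝ := fun u => √N * v u with hU
  have hUXY : ∀ u, U u = α * X u + β * Y u := by
    intro u
    simp only [hU, hXdef, hYdef, ← hαβ]
    simp; ring
  -- Because `v` lies in `W`, being perpendicular to the projection of the all-ones vector is the
  -- same as being perpendicular to that vector itself.
  have hUsum : ∑ u, U u = 0 := by
    have h1 : inner ℝ (allOnes : EuclideanSpace ℝ V) v = (0 : ℝ) := by
      rw [Submodule.inner_starProjection_left_eq_right,
        Submodule.starProjection_eq_self_iff.2 hv] at hperp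
      exact hperp
    rw [PiLp.inner_apply] at h1
    simp only [allOnes] at h1
    simp only [hU, ← Finset.mul_sum]
    have : ∑ i, v i = 0 := by simpa using h1
    rw [this, mul_zero]
  set a := α * a₁ + β * a₂ with ha
  set b := α * b₁ + β * b₂ with hb
  set E : V → ℝ := fun u => α * ((noise d p R *ᵥ X) u / l₁) + β * ((noise d p R *ᵥ Y) u / l₂) with hE
  have hUab : ∀ u, U u = (a + b * σ u) + E u := by
    intro u
    rw [hUXY, hX.decomp u, hY.decomp u, ha, hb, hE]; ring
  have hl₁0 : 0 < l₁ := by linarith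
  have hl₂0 : 0 < l₂ := by linarith
  have hs : 0 ≤ √N := Real.sqrt_nonneg _
  have hterm : ∀ (Z : V → ℝ) (l γ : ℝ), l2 Z = √N → 99 / 100 * m ≤ l → |γ| ≤ 1 →
      l2 ((γ / l) • (noise d p R *ᵥ Z)) ≤ 2 * ε * √N := by
    intro Z l γ hZ hl hγ
    have hl0 : 0 < l := by linarith
    rw [l2_smul, abs_div, abs_of_pos hl0]
    have h1 := hnoise Z
    rw [hZ] at h1
    calc _ ≤ 1 / l * (ε * m * √N) := by gcongr; exact l2_nonneg _
      _ ≤ _ := by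
        rw [one_div_mul_eq_div, div_le_iff₀ hl0]
        nlinarith [mul_nonneg hε0 hs]
  have hE2 : l2 E ≤ 4 * ε * √N := by
    have e : E = (α / l₁) • (noise d p R *ᵥ X) + (β / l₂) • (noise d p R *ᵥ Y) := by
      ext u; simp only [hE, Pi.add_apply, Pi.smul_apply, smul_eq_mul]; ring
    rw [e]
    have := hterm X l₁ α hX.norm hl₁' hα
    have := hterm Y l₂ β hY.norm hl₂' hβ
    exact (l2_add_le _ _).trans (by linarith)
  have hss : √N * √N = N := Real.mul_self_sqrt hN.le
  have ha4 : |a| ≤ 4 * ε := by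
    have h1 : ∑ u, U u = a * N + ∑ u, E u := by
      rw [← H.sum_comb a b, ← Finset.sum_add_distrib]
      exact Finset.sum_congr rfl fun u _ => hUab u
    have h2 := Planted.abs_sum_le E
    have h3 : |a| * N ≤ 4 * ε * N := by
      rw [← abs_of_pos hN, ← abs_mul, abs_of_pos hN, show a * N = -∑ u, E u by linarith, abs_neg]
      calc _ ≤ √N * (4 * ε * √N) := h2.trans (by gcongr)
        _ = 4 * ε * (√N * √N) := by ring
        _ = _ := by rw [hss]
    exact le_of_mul_le_mul_right h3 hN
  have hU2 : l2 U = √N := by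
    have : U = √N • v.ofLp := rfl
    rw [this, l2_smul, abs_of_nonneg hs]
    have : l2 v.ofLp = 1 := hv1
    rw [this, mul_one]
  set s : ℝ := if 0 ≤ b then 1 else -1 with hsdef
  have hs2 : s ^ 2 = 1 := by rw [hsdef]; split_ifs <;> norm_num
  have hbabs : |(|b|) - 1| ≤ 8 * ε := by
    have e1 : (fun u => a + b * σ u) = U - E := by
      ext u; rw [Pi.sub_apply, hUab]; ring
    have e2 : U = (fun u => a + b * σ u) + E := by
      ext u; rw [Pi.add_apply, hUab]
    have h1 : l2 (fun u => a + b * σ u) ≤ (1 + 4 * ε) * √N := by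
      rw [e1]
      exact (l2_sub_le _ _).trans (by rw [hU2]; linarith)
    have h2 : √N ≤ (|a| + |b|) * √N + 4 * ε * √N := by
      have := l2_add_le (fun u => a + b * σ u) E
      rw [← e2, hU2] at this
      have := H.l2_comb_le a b
      linarith
    have hsN : 0 < √N := Real.sqrt_pos.2 hN
    have h3 : 1 ≤ |a| + |b| + 4 * ε := by
      have : 1 * √N ≤ (|a| + |b| + 4 * ε) * √N := by linarith
      exact le_of_mul_le_mul_right this hsN
    have h4 : |b| ≤ 1 + 4 * ε := by
      have h5 := pow_le_pow_left₀ (l2_nonneg _) h1 2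
      rw [H.l2_comb_sq, mul_pow, Real.sq_sqrt hN.le] at h5
      have h6 := le_of_mul_le_mul_right h5 hN
      exact abs_le_of_sq_le_sq (by nlinarith [sq_nonneg a]) (by linarith)
    rw [abs_le]; constructor <;> linarith
  have hbs : |b - s| ≤ 8 * ε := by
    rw [hsdef]
    split_ifs with h
    · rwa [abs_of_nonneg h] at hbabs
    · rw [abs_of_neg (not_le.1 h)] at hbabs
      rw [← abs_neg]
      rwa [show -(b - -1) = -b - 1 by ring]
  -- `U` is almost an eigenvector with eigenvalue `m`
  set Q : V → ℝ := fun u => α * (l₁ - m) * X u + β * (l₂ - m) * Y u with hQ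
  have hQ2 : l2 Q ≤ 13 * ε * m * √N := by
    set c : ℝ := (∑ u, σ u * E u) / N with hc
    have hc4 : |c| ≤ 4 * ε := by
      rw [hc, abs_div, abs_of_pos hN, div_le_iff₀ hN]
      calc _ ≤ √N * (4 * ε * √N) := (H.abs_sum_sigma_le E).trans (by gcongr)
        _ = 4 * ε * (√N * √N) := by ring
        _ = _ := by rw [hss]
    have hAU : trimmedMatrix d R *ᵥ U = fun u => α * l₁ * X u + β * l₂ * Y u := by
      have : U = α • X + β • Y := by
        ext u; rw [hUXY]; rfl
      rw [this, mulVec_add, mulVec_smul, mulVec_smul, hX.eig, hY.eig]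
      ext u; simp; ring
    have e : Q = noise d p R *ᵥ U + (m • (fun u => (-a) + c * σ u) - m • E) := by
      ext u
      have h1 := congrFun hAU u
      rw [trimmedMatrix_eq d p, add_mulVec, Pi.add_apply, H.mulVec, hUsum] at h1
      have h2 : ∑ j, σ j * U j = (b + c) * N := by
        simp_rw [hUab, mul_add]
        rw [Finset.sum_add_distrib, hc, add_mul, div_mul_cancel₀ _ hN.ne', ← H.sum_sigma_comb a b]
        congr 1
        exact Finset.sum_congr rfl fun j _ => by ring
      rw [h2] at h1
      have h3 : m / N * ((b + c) * N) = m * (b + c) := by field_simp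
      simp only [← hNdef] at h1
      rw [h3, mul_zero, zero_add] at h1
      simp only [hQ, Pi.add_apply, Pi.sub_apply, Pi.smul_apply, smul_eq_mul]
      have h4 := hUXY u
      rw [hUab] at h4
      linear_combination -h1 + m * h4
    rw [e]
    have n1 := hnoise U
    rw [hU2] at n1
    have n2 := H.l2_comb_le (-a) c
    rw [abs_neg] at n2
    have n3 : (|a| + |c|) * √N ≤ 8 * ε * √N := by gcongr; linarith
    refine (l2_add_le _ _).trans ?_
    have n4 := l2_sub_le (m • (fun u => (-a) + c * σ u)) (m • E)
    rw [l2_smul, l2_smul, abs_of_pos hm] at n4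
    have n5 := mul_le_mul_of_nonneg_left (n2.trans n3) hm.le
    have n6 := mul_le_mul_of_nonneg_left hE2 hm.le
    linarith
  -- By orthogonality the bound on `Q` controls both coordinates: an eigenvector with substantial
  -- weight in `v` has eigenvalue close to m. No gap between `l₁` and `l₂` is used.
  have hXY0 : X ⬝ᵥ Y = 0 := by
    have h1 : inner ℝ x y = ∑ i, x i * y i := by
      rw [PiLp.inner_apply]; exact Finset.sum_congr rfl fun i _ => by simp [mul_comm]
    rw [hxy0] at h1
    have : X ⬝ᵥ Y = N * ∑ i, x i * y i := by
      simp only [dotProduct, hXdef, hYdef, Finset.mul_sum]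
      exact Finset.sum_congr rfl fun i _ => by
        rw [show √N * x.ofLp i * (√N * y.ofLp i) = (√N * √N) * (x.ofLp i * y.ofLp i) by ring, hss]
    rw [this, ← h1, mul_zero]
  have hQsq : l2 Q ^ 2 = ((α * (l₁ - m)) ^ 2 + (β * (l₂ - m)) ^ 2) * N := by
    have hXX : X ⬝ᵥ X = N := by rw [dot_self, hX.norm, Real.sq_sqrt hN.le]
    have hYY : Y ⬝ᵥ Y = N := by rw [dot_self, hY.norm, Real.sq_sqrt hN.le]
    have e : Q = (α * (l₁ - m)) • X + (β * (l₂ - m)) • Y := rfl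
    rw [← dot_self, e]
    simp only [dotProduct_add, add_dotProduct, smul_dotProduct, dotProduct_smul, smul_eq_mul, hXX, hYY,
      hXY0, dotProduct_comm Y X]
    ring
  have hQ3 : (α * (l₁ - m)) ^ 2 + (β * (l₂ - m)) ^ 2 ≤ (13 * ε * m) ^ 2 := by
    have h1 := pow_le_pow_left₀ (l2_nonneg _) hQ2 2
    rw [hQsq, mul_pow (13 * ε * m), Real.sq_sqrt hN.le] at h1
    exact le_of_mul_le_mul_right h1 hN
  have hα13 : |α * (l₁ - m)| ≤ 13 * ε * m :=
    abs_le_of_sq_le_sq (by nlinarith [sq_nonneg (β * (l₂ - m))]) (by positivity)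
  have hβ13 : |β * (l₂ - m)| ≤ 13 * ε * m :=
    abs_le_of_sq_le_sq (by nlinarith [sq_nonneg (α * (l₁ - m))]) (by positivity)
  -- This replaces 1/l by 1/m at the price 2 · 13ε/(0.99m) ≤ 28ε/m. The weight γ in front is
  -- essential, since l may be far from m when γ is small.
  have hinv : ∀ γ l c : ℝ, 99 / 100 * m ≤ l → |γ * (l - m)| ≤ 13 * ε * m → |c| ≤ 2 →
      |γ * c / l - γ * c / m| ≤ 28 * ε / m := by
    intro γ l c hl hγ hc
    have hl0 : 0 < l := by linarith
    have e : γ * c / l - γ * c / m = -(γ * (l - m) * c / (l * m)) := by field_simp; ring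
    rw [e, abs_neg, abs_div, abs_of_pos (mul_pos hl0 hm), abs_mul, div_le_div_iff₀ (by positivity) hm]
    calc _ ≤ 13 * ε * m * 2 * m := by gcongr
      _ ≤ _ := by nlinarith [mul_nonneg hε0 (mul_pos hm hm).le]
  refine ⟨X, Y, l₁, l₂, a₁, b₁, a₂, b₂, α, β, s, hX, hY, hUXY, hα, hβ, hs2, ha4, hbs, ?_, ?_⟩
  · have h1 := hinv α l₁ a₁ hl₁' hα13 hX.abs_a_le
    have h2 := hinv β l₂ a₂ hl₂' hβ13 hY.abs_a_le
    have h3 : |a / m| ≤ 4 * ε / m := by rw [abs_div, abs_of_pos hm]; gcongr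
    have e : α * a₁ / l₁ + β * a₂ / l₂ = a / m + (α * a₁ / l₁ - α * a₁ / m)
        + (β * a₂ / l₂ - β * a₂ / m) := by rw [ha]; ring
    rw [e]
    refine (abs_add_three _ _ _).trans ?_
    have : 4 * ε / m + 28 * ε / m + 28 * ε / m ≤ 64 * ε / m := by
      rw [← add_div, ← add_div]; gcongr; linarith
    linarith
  · have h1 := hinv α l₁ b₁ hl₁' hα13 hX.abs_b_le
    have h2 := hinv β l₂ b₂ hl₂' hβ13 hY.abs_b_le
    have h3 : |(b - s) / m| ≤ 8 * ε / m := by rw [abs_div, abs_of_pos hm]; gcongr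
    have e : α * b₁ / l₁ + β * b₂ / l₂ - s / m = (b - s) / m + (α * b₁ / l₁ - α * b₁ / m)
        + (β * b₂ / l₂ - β * b₂ / m) := by rw [hb]; ring
    rw [e]
    refine (abs_add_three _ _ _).trans ?_
    have : 8 * ε / m + 28 * ε / m + 28 * ε / m ≤ 64 * ε / m := by
      rw [← add_div, ← add_div]; gcongr; linarith
    linarith

end BlockModel

namespace BlockModel

/-! ### Large deviations for the noise on small sets -/

lemma expRem_le_sq_mul_exp (z : ℝ) : expRem z ≤ z ^ 2 * Real.exp |z| := by
  rcases le_total |z| 1 with h | h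
  · refine (expRem_le_sq h).trans ?_
    have := Real.one_le_exp (abs_nonneg z)
    nlinarith [sq_nonneg z]
  · have h2 : 1 ≤ z ^ 2 := by rw [← sq_abs]; nlinarith
    have he := Real.exp_pos |z|
    have h1 : Real.exp z ≤ Real.exp |z| := Real.exp_le_exp.2 (le_abs_self z)
    rcases abs_cases z with ⟨h3, h4⟩ | ⟨h3, h4⟩
    · unfold expRem; nlinarith
    · unfold expRem
      have h5 : Real.exp z ≤ 1 := Real.exp_le_one_iff.2 h4.le
      have h6 : z ^ 2 ≤ z ^ 2 * Real.exp |z| := by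
        have := Real.one_le_exp (abs_nonneg z)
        nlinarith
      nlinarith

/-- The constant 13/20 instead of 1 matters: with z² the sign bound would reach only exponent 0.405
m²/d, too weak against an entropy of 0.13x per vertex. -/
lemma expRem_le_of_abs_le {z : ℝ} (hz : |z| ≤ 7 / 10) : expRem z ≤ 13 / 20 * z ^ 2 := by
  have h := Real.exp_bound (x := z) (by linarith) (n := 4) (by norm_num)
  simp only [Finset.sum_range_succ, Finset.sum_range_zero, Nat.factorial] at h
  norm_num at h
  have h1 := (abs_le.1 h).2
  have h4 : |z| ^ 4 = z ^ 2 * z ^ 2 := by rw [← sq_abs]; ring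
  have h2 : z ^ 2 ≤ 49 / 100 := by rw [← sq_abs]; nlinarith [abs_nonneg z]
  have h3 : z ^ 3 ≤ 7 / 10 * z ^ 2 := by
    have := (abs_le.1 hz).2
    nlinarith [sq_nonneg z]
  rw [h4] at h1
  unfold expRem
  nlinarith [sq_nonneg z]

variable {V : Type*} [Fintype V] [DecidableEq V]

/-- The centred weighted number of edges from `u` to the complement of `S`. -/
noncomputable def cutSum (p : Sym2 V → ℝ) (R : Sym2 V → Bool) (S : Finset V) (h : V → ℝ) (u : V) :
    ℝ :=
  ∑ w ∈ Sᶜ, h w * (edge R u w - p s(u, w))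

open scoped Classical in
/-- The vertices of `S` that are not trimmed. -/
noncomputable def kept (D : ℝ) (R : Sym2 V → Bool) (S : Finset V) : Finset V :=
  S.filter fun u => degree R u ≤ 20 * D

omit [DecidableEq V] in
lemma kept_subset (D : ℝ) (R : Sym2 V → Bool) (S : Finset V) : kept D R S ⊆ S :=
  Finset.filter_subset _ _

/-- Here the trimming enters: the noise at a kept vertex is bounded by a constant independent of n,
so the tilts used below stay bounded. -/
lemma abs_cutSum_le {p : Sym2 V → ℝ} (h0 : ∀ e, 0 ≤ p e) {D : ℝ}
    (hp : ∀ e, p e ≤ D / Fintype.card V) (hN : 0 < Fintype.card V) {R : Sym2 V → Bool}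
    {S : Finset V} {h : V → ℝ} {L : ℝ} (hL : ∀ w, |h w| ≤ L) {u : V} (hu : degree R u ≤ 20 * D) :
    |cutSum p R S h u| ≤ 21 * D * L := by
  have hL0 : 0 ≤ L := (abs_nonneg _).trans (hL u)
  have hN' : (0 : ℝ) < Fintype.card V := by exact_mod_cast hN
  calc |cutSum p R S h u| ≤ ∑ w ∈ Sᶜ, |h w * (edge R u w - p s(u, w))| :=
        Finset.abs_sum_le_sum_abs _ _
    _ ≤ ∑ w ∈ Sᶜ, L * (edge R u w + D / Fintype.card V) := by
        refine Finset.sum_le_sum fun w _ => ?_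
        rw [abs_mul]
        have h1 : |edge R u w - p s(u, w)| ≤ edge R u w + D / Fintype.card V := by
          have := edge_nonneg R u w
          have := h0 s(u, w)
          have := hp s(u, w)
          rw [abs_le]; constructor <;> linarith
        exact mul_le_mul (hL w) h1 (abs_nonneg _) hL0
    _ ≤ ∑ w, L * (edge R u w + D / Fintype.card V) := by
        refine Finset.sum_le_sum_of_subset_of_nonneg (Finset.subset_univ _) fun w _ _ => ?_
        have := edge_nonneg R u w
        have := (h0 s(u, w)).trans (hp s(u, w))
        positivity
    _ = L * (degree R u + D) := by
        rw [← Finset.mul_sum, Finset.sum_add_distrib]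
        simp only [Finset.sum_const, Finset.card_univ, nsmul_eq_mul]
        rw [mul_div_cancel₀ _ hN'.ne']; rfl
    _ ≤ L * (21 * D) := by gcongr; linarith
    _ = _ := by ring

/-- The integer points of the cube of radius `m` that are supported on `S`. -/
noncomputable def latticeBoxOn (S : Finset V) (m : ℕ) : Finset (V → ℤ) :=
  Fintype.piFinset fun u => if u ∈ S then Finset.Icc (-(m : ℤ)) m else {0}

lemma sum_exp_neg_sq_latticeBoxOn_le (S : Finset V) (m : ℕ) :
    ∑ j ∈ latticeBoxOn S m, Real.exp (-∑ u, (j u : ℝ) ^ 2) ≤ Real.exp (2 * S.card) := by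
  have h := Finset.prod_univ_sum (fun u : V => if u ∈ S then Finset.Icc (-(m : ℤ)) m else {0})
    (fun _ z => Real.exp (-(z : ℝ) ^ 2))
  have e : ∀ w : V → ℤ, Real.exp (-∑ i, (w i : ℝ) ^ 2) = ∏ i, Real.exp (-(w i : ℝ) ^ 2) := by
    intro w
    rw [← Real.exp_sum, Finset.sum_neg_distrib]
  simp_rw [e]
  unfold latticeBoxOn
  rw [← h]
  have h3 : ∀ u, ∑ z ∈ (if u ∈ S then Finset.Icc (-(m : ℤ)) m else {0}), Real.exp (-(z : ℝ) ^ 2)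
      ≤ if u ∈ S then Real.exp 2 else 1 := by
    intro u
    split_ifs
    · have h3 := sum_exp_neg_sq_le m
      have : (0 : ℝ) < (1 / 2) ^ m := by positivity
      have := Real.add_one_le_exp (2 : ℝ)
      linarith
    · simp
  calc _ ≤ ∏ u, (if u ∈ S then Real.exp 2 else 1) :=
        Finset.prod_le_prod (fun u _ => Finset.sum_nonneg fun _ _ => (Real.exp_pos _).le)
          fun u _ => h3 u
    _ = Real.exp (2 * S.card) := by
        rw [Finset.prod_ite_mem, Finset.univ_inter, Finset.prod_const, mul_comm, Real.exp_nat_mul]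

/-- With τ² = 16θ the claim is 4(y - j)² ≤ 4. It replaces the square of Z by a linear function of Z
with an integer slope, and leaves 4j² to pay for the union over j. -/
lemma sq_ge_of_trunc {θ Z y τ : ℝ} {j : ℤ} (hθ : 0 < θ) (hτ : τ ^ 2 = 16 * θ) (hτ0 : 0 < τ)
    (hy : y = 2 * θ * Z / τ) (hj : (y - j) ^ 2 ≤ 1) :
    θ * Z ^ 2 - 4 + 4 * (j : ℝ) ^ 2 ≤ (τ * j) * Z := by
  have hZ : Z = y * τ / (2 * θ) := by rw [hy]; field_simp
  have e1 : θ * Z ^ 2 = 4 * y ^ 2 := by rw [hZ, div_pow, mul_pow, hτ]; field_simp; ring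
  have e2 : (τ * j) * Z = 8 * (y * j) := by
    rw [hZ, show τ * j * (y * τ / (2 * θ)) = τ ^ 2 * (j * y) / (2 * θ) by ring, hτ]; field_simp
    ring
  rw [e1, e2]
  nlinarith

/-- The sum of the squares of the noise on a set is not large. -/
lemma sum_sq_cutSum_prob {p : Sym2 V → ℝ} (h0 : ∀ e, 0 ≤ p e) (h1 : ∀ e, p e ≤ 1) {D : ℝ}
    (hD : 0 < D) (hp : ∀ e, p e ≤ D / Fintype.card V) (hN : 0 < Fintype.card V) (S : Finset V)
    (h : (Sym2 V → Bool) → V → ℝ)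
    (hdep : ∀ R R' : Sym2 V → Bool, (∀ i ∉ S, ∀ j ∉ S, R s(i, j) = R' s(i, j)) → h R = h R')
    {L δ θ : ℝ} (hL : ∀ R w, |h R w| ≤ L) (hδ : ∀ R, ∑ w ∈ Sᶜ, h R w ^ 2 ≤ δ * Fintype.card V)
    (hθ : 0 < θ) (hcond : D * δ * Real.exp (42 * θ * D * L * L) ≤ 1 / (16 * θ)) (T : ℝ) :
    (coins p).real {R | T ≤ ∑ u ∈ kept D R S, cutSum p R S (h R) u ^ 2} ≤
      Real.exp (6 * S.card - θ * T) := by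
  classical
  have hN' : (0 : ℝ) < Fintype.card V := by exact_mod_cast hN
  set N : ℝ := (Fintype.card V : ℝ) with hNdef
  obtain ⟨u0⟩ : Nonempty V := Fintype.card_pos_iff.1 hN
  have hL0 : 0 ≤ L := (abs_nonneg _).trans (hL (fun _ => true) u0)
  have hδ0 : 0 ≤ δ := by
    have := (Finset.sum_nonneg fun w _ => sq_nonneg _).trans (hδ (fun _ => true))
    exact nonneg_of_mul_nonneg_left this hN'
  set τ := 4 * √θ with hτdef
  have hτ0 : 0 < τ := by have := Real.sqrt_pos.2 hθ; positivity
  have hτ : τ ^ 2 = 16 * θ := by rw [hτdef, mul_pow, Real.sq_sqrt hθ.le]; norm_num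
  set B := 42 * θ * D * L with hB
  have hB0 : 0 ≤ B := by positivity
  set m := ⌈B / τ⌉₊ with hm
  -- A large sum of squares forces a large linear form for some lattice vector supported on `S`. The
  -- form is linear in the edges that leave `S`, so the conditional Chernoff bound applies.
  set Q : (V → ℤ) → (Sym2 V → Bool) → Prop := fun j R => (∀ u, |(j u : ℝ)| * τ ≤ B) ∧
    (∀ u ∉ S, j u = 0) ∧ θ * T - 4 * S.card + 4 * ∑ u ∈ S, (j u : ℝ) ^ 2 ≤
      ∑ u ∈ S, (τ * j u) * ∑ w ∈ Sᶜ, h R w * (edge R u w - p s(u, w)) with hQ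
  have hsub : {R | T ≤ ∑ u ∈ kept D R S, cutSum p R S (h R) u ^ 2} ⊆
      {R | ∃ j ∈ latticeBoxOn S m, Q j R} := by
    intro R hR
    have hR' : T ≤ ∑ u ∈ kept D R S, cutSum p R S (h R) u ^ 2 := hR
    choose w hw0 hwle hwr using fun u => exists_int_trunc (2 * θ * cutSum p R S (h R) u / τ)
    set j : V → ℤ := fun u => if u ∈ kept D R S then w u else 0 with hj
    have hjB : ∀ u, |(j u : ℝ)| * τ ≤ B := by
      intro u
      simp only [hj]
      split_ifs with hu
      · have hdeg : degree R u ≤ 20 * D := (Finset.mem_filter.1 hu).2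
        have h2 := abs_cutSum_le h0 hp hN (S := S) (hL R) hdeg
        have h3 : |(w u : ℝ)| ≤ |2 * θ * cutSum p R S (h R) u / τ| := sq_le_sq.1 (hwle u)
        rw [abs_div, abs_mul, abs_of_pos hτ0, abs_of_pos (by positivity : 0 < 2 * θ),
          le_div_iff₀ hτ0] at h3
        refine h3.trans ?_
        calc _ ≤ 2 * θ * (21 * D * L) := by gcongr
          _ = B := by rw [hB]; ring
      · simp; exact hB0
    have hjS : ∀ u ∉ S, j u = 0 := fun u hu => by
      simp only [hj]; rw [if_neg fun h => hu (kept_subset _ _ _ h)]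
    refine ⟨j, ?_, hjB, hjS, ?_⟩
    · rw [latticeBoxOn, Fintype.mem_piFinset]
      intro u
      split_ifs with hu
      · have h2 : |(j u : ℝ)| ≤ m := by
          rw [← mul_le_mul_iff_left₀ hτ0]
          refine (hjB u).trans ?_
          rw [← div_le_iff₀ hτ0]; exact Nat.le_ceil _
        have h3 : |j u| ≤ (m : ℤ) := by exact_mod_cast h2
        rw [Finset.mem_Icc]; exact abs_le.1 h3
      · rw [Finset.mem_singleton]; exact hjS u hu
    · have hterm : ∀ u ∈ S, (if u ∈ kept D R S then θ * cutSum p R S (h R) u ^ 2 else 0) - 4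
          + 4 * (j u : ℝ) ^ 2 ≤ (τ * j u) * ∑ w ∈ Sᶜ, h R w * (edge R u w - p s(u, w)) := by
        intro u _
        simp only [hj]
        by_cases hu : u ∈ kept D R S
        · rw [if_pos hu, if_pos hu]
          exact sq_ge_of_trunc (Z := cutSum p R S (h R) u) hθ hτ hτ0 rfl (hwr u)
        · rw [if_neg hu, if_neg hu]; simp
      have h2 := Finset.sum_le_sum hterm
      rw [Finset.sum_add_distrib, Finset.sum_sub_distrib, Finset.sum_const, nsmul_eq_mul,
        ← Finset.mul_sum, Finset.sum_ite_mem, Finset.inter_eq_right.2 (kept_subset _ _ _),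
        ← Finset.mul_sum] at h2
      have h3 := mul_le_mul_of_nonneg_left hR' hθ.le
      linarith
  have hone : ∀ j : V → ℤ, (coins p).real {R | Q j R} ≤
      Real.exp (4 * S.card - θ * T) * Real.exp (-∑ u, (j u : ℝ) ^ 2) := by
    intro j
    by_cases hj : (∀ u, |(j u : ℝ)| * τ ≤ B) ∧ ∀ u ∉ S, j u = 0
    swap
    · have : {R : Sym2 V → Bool | Q j R} = ∅ := by
        ext R
        simp only [Set.mem_ofPred_eq, Set.mem_empty_iff_false, iff_false]
        exact fun hR => hj ⟨hR.1, hR.2.1⟩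
      rw [this, measureReal_empty]; positivity
    -- `hcond` says exactly that the moment exponent is at most Σ j². Against the threshold 4Σ j²
    -- this leaves more than the weight exp(-Σ j²) of the lattice union bound.
    have hK : ∀ R, ∑ u ∈ S, ∑ w ∈ Sᶜ, p s(u, w) * expRem ((τ * j u) * h R w)
        ≤ ∑ u ∈ S, (j u : ℝ) ^ 2 := by
      intro R
      refine Finset.sum_le_sum fun u _ => ?_
      have hterm : ∀ w ∈ Sᶜ, p s(u, w) * expRem ((τ * j u) * h R w) ≤
          D / N * Real.exp (B * L) * (τ * j u) ^ 2 * h R w ^ 2 := by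
        intro w _
        have hz : |τ * j u * h R w| ≤ B * L := by
          rw [abs_mul, abs_mul, abs_of_pos hτ0, mul_comm τ]
          exact mul_le_mul (hj.1 u) (hL R w) (abs_nonneg _) hB0
        calc _ ≤ D / N * ((τ * j u * h R w) ^ 2 * Real.exp (B * L)) := by
              refine mul_le_mul (hp _) ((expRem_le_sq_mul_exp _).trans ?_) (expRem_nonneg _)
                (by positivity)
              exact mul_le_mul_of_nonneg_left (Real.exp_le_exp.2 hz) (sq_nonneg _)
          _ = _ := by ring
      refine (Finset.sum_le_sum hterm).trans ?_
      rw [← Finset.mul_sum]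
      calc _ ≤ D / N * Real.exp (B * L) * (τ * j u) ^ 2 * (δ * N) :=
            mul_le_mul_of_nonneg_left (hδ R) (by positivity)
        _ = (D * δ * Real.exp (B * L)) * ((τ * j u) ^ 2) := by field_simp
        _ ≤ 1 / (16 * θ) * ((τ * j u) ^ 2) := by
            refine mul_le_mul_of_nonneg_right ?_ (sq_nonneg _)
            rw [hB]; exact hcond
        _ = _ := by rw [mul_pow, hτ]; field_simp
    have hc := cut_chernoff h0 h1 S (fun u => τ * j u) h hdep hK
      (θ * T - 4 * S.card + 4 * ∑ u ∈ S, (j u : ℝ) ^ 2)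
    refine (measureReal_mono (fun R hR => hR.2.2)).trans (hc.trans ?_)
    rw [← Real.exp_add]
    apply Real.exp_le_exp.2
    have e : ∑ u, (j u : ℝ) ^ 2 = ∑ u ∈ S, (j u : ℝ) ^ 2 := by
      rw [← Finset.sum_subset (Finset.subset_univ S)]
      intro u _ hu; rw [hj.2 u hu]; simp
    have : 0 ≤ ∑ u ∈ S, (j u : ℝ) ^ 2 := Finset.sum_nonneg fun _ _ => sq_nonneg _
    rw [e]
    linarith
  refine (measureReal_mono hsub).trans ((coins_exists_le p _ _).trans ?_)
  refine (Finset.sum_le_sum fun j _ => hone j).trans ?_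
  rw [← Finset.mul_sum]
  calc _ ≤ Real.exp (4 * S.card - θ * T) * Real.exp (2 * S.card) :=
        mul_le_mul_of_nonneg_left (sum_exp_neg_sq_latticeBoxOn_le S m) (Real.exp_pos _).le
    _ = _ := by rw [← Real.exp_add]; congr 1; ring

/-! ### Uniform versions -/

lemma entropy_le {N k t : ℝ} (hN : 0 < N) (hk : N * Real.exp (-t) ≤ k) :
    entropy N k ≤ k * (1 + t) := by
  have hk0 : 0 < k := lt_of_lt_of_le (by positivity) hk
  unfold entropy
  have : Real.log (N / k) ≤ t := by
    rw [Real.log_le_iff_le_exp (by positivity), div_le_iff₀ hk0]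
    calc N = N * Real.exp (-t) * Real.exp t := by
          rw [mul_assoc, ← Real.exp_add]; simp
      _ ≤ k * Real.exp t := by gcongr
      _ = _ := mul_comm _ _
  gcongr

/-- With high probability, the noise from a family of test functions is not large on any set that
is not too small. -/
lemma sum_sq_cutSum_uniform {p : Sym2 V → ℝ} (h0 : ∀ e, 0 ≤ p e) (h1 : ∀ e, p e ≤ 1) {D : ℝ}
    (hD : 0 < D) (hp : ∀ e, p e ≤ D / Fintype.card V) (hN : 0 < Fintype.card V) {ι : Type*}
    (s : Finset ι) (h : ι → Finset V → (Sym2 V → Bool) → V → ℝ)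
    (hdep : ∀ i S, ∀ R R' : Sym2 V → Bool, (∀ i ∉ S, ∀ j ∉ S, R s(i, j) = R' s(i, j)) →
      h i S R = h i S R')
    {L δ c x m : ℝ} (hL : ∀ i S R w, |h i S R w| ≤ L)
    (hδ : ∀ i S R, ∑ w ∈ Sᶜ, h i S R w ^ 2 ≤ δ * Fintype.card V)
    (hc : 0 < c) (hcond : δ * Real.exp (42 * L ^ 2 / c) ≤ c / 16) (hx : x * D = 4 * m ^ 2)
    (hx200 : 200 ≤ x) :
    (coins p).real {R | ∃ S : Finset V, Fintype.card V * Real.exp (-(13 / 100 * x)) ≤ S.card ∧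
      ∃ i ∈ s, c * m ^ 2 * S.card ≤ ∑ u ∈ kept D R S, cutSum p R S (h i S R) u ^ 2} ≤
    s.card * Real.exp (-(Fintype.card V * Real.exp (-(13 / 100 * x)))) * (Fintype.card V + 1) := by
  have hN' : (0 : ℝ) < Fintype.card V := by exact_mod_cast hN
  set k₀ := Fintype.card V * Real.exp (-(13 / 100 * x)) with hk₀
  refine coins_exists_set_le p _ fun S => ?_
  by_cases hS : k₀ ≤ S.card
  swap
  · simp only [hS, false_and]
    rw [show {R : Sym2 V → Bool | False} = ∅ from rfl, measureReal_empty]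
    positivity
  simp only [hS, true_and]
  refine (coins_exists_le p s _).trans ?_
  have hone : ∀ i ∈ s, (coins p).real
      {R | c * m ^ 2 * S.card ≤ ∑ u ∈ kept D R S, cutSum p R S (h i S R) u ^ 2} ≤
      Real.exp (-k₀) * Real.exp (-entropy (Fintype.card V) S.card) := by
    intro i _
    refine (sum_sq_cutSum_prob h0 h1 hD hp hN S (h i S) (hdep i S) (hL i S) (hδ i S)
      (θ := 1 / (c * D)) (by positivity) ?_ _).trans ?_
    · rw [show 42 * (1 / (c * D)) * D * L * L = 42 * L ^ 2 / c by field_simp,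
        show 1 / (16 * (1 / (c * D))) = D * (c / 16) by field_simp, mul_assoc]
      gcongr
    · rw [← Real.exp_add]
      apply Real.exp_le_exp.2
      have h2 := entropy_le hN' hS
      -- The gain is x/4 per vertex of `S`. The costs are 6 from the lattice, 1 + 0.13x of entropy
      -- and at most 1 for the final factor, which fit because x ≥ 200.
      have e : 1 / (c * D) * (c * m ^ 2 * S.card) = x / 4 * S.card := by
        have : m ^ 2 = x * D / 4 := by linarith
        rw [this, one_div_mul_eq_div, div_eq_iff (mul_pos hc hD).ne']; ring
      rw [e]
      have : (0 : ℝ) ≤ S.card := Nat.cast_nonneg _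
      nlinarith
  refine (Finset.sum_le_sum hone).trans_eq ?_
  rw [Finset.sum_const, nsmul_eq_mul, mul_assoc]

/-- In no set that is not too small, most vertices have an unexpected majority of neighbours of the
wrong sign. -/
def SignBound (σ : V → ℝ) (m k₀ : ℝ) (p : Sym2 V → ℝ) (R : Sym2 V → Bool) : Prop :=
  ∀ S : Finset V, k₀ ≤ S.card → ∀ J ⊆ S, (∀ u ∈ J, σ u * cutSum p R S σ u ≤ -(9 / 10 * m)) →
    (J.card : ℝ) < 95 / 100 * S.card

lemma cutSum_sign_prob {σ : V → ℝ} {d m : ℝ} {p : Sym2 V → ℝ} (H : Planted σ d m p)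
    (h0 : ∀ e, 0 ≤ p e) (h1 : ∀ e, p e ≤ 1) (S J : Finset V) (hJ : J ⊆ S) :
    (coins p).real {R | ∀ u ∈ J, σ u * cutSum p R S σ u ≤ -(9 / 10 * m)} ≤
      Real.exp (-(623 / 1000 * (m ^ 2 / d) * J.card)) := by
  have hm := H.pos
  have hd : 0 < d := by linarith [H.le]
  have hN := H.card_pos'
  -- The tilt nearly minimises (13/40)t² - (9/10)t, with θ = tm/d. At t = 7/5 the value is -0.623.
  -- The condition 2m ≤ d keeps θ ≤ 7/10, the range of `expRem_le_of_abs_le`.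
  set θ := 7 / 5 * m / d with hθ
  have hθ0 : 0 < θ := by positivity
  have hθ7 : θ ≤ 7 / 10 := by rw [hθ, div_le_iff₀ hd]; linarith [H.le]
  have hσ : ∀ i, |σ i| = 1 := fun i => by
    have := Real.sqrt_sq_eq_abs (σ i)
    rw [H.sq, Real.sqrt_one] at this; exact this.symm
  have hK : ∀ R : Sym2 V → Bool, ∑ u ∈ S, ∑ w ∈ Sᶜ,
      p s(u, w) * expRem ((if u ∈ J then -θ * σ u else 0) * σ w) ≤
      J.card * (13 / 20 * θ ^ 2 * (d / 2)) := by
    intro _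
    have hterm : ∀ u ∈ S, ∑ w ∈ Sᶜ, p s(u, w) * expRem ((if u ∈ J then -θ * σ u else 0) * σ w) ≤
        if u ∈ J then 13 / 20 * θ ^ 2 * (d / 2) else 0 := by
      intro u _
      split_ifs with hu
      · have hsum : ∑ w, p s(u, w) = d / 2 := by
          simp_rw [H.mean, Finset.sum_add_distrib, ← Finset.mul_sum, H.sum_eq_zero]
          simp; field_simp
        calc _ ≤ ∑ w ∈ Sᶜ, p s(u, w) * (13 / 20 * θ ^ 2) := by
              refine Finset.sum_le_sum fun w _ => mul_le_mul_of_nonneg_left ?_ (h0 _)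
              have e : |-θ * σ u * σ w| = θ := by
                rw [abs_mul, abs_mul, hσ, hσ, abs_neg, abs_of_pos hθ0]; ring
              refine (expRem_le_of_abs_le (by rw [e]; exact hθ7)).trans_eq ?_
              rw [← sq_abs, e]
          _ ≤ ∑ w, p s(u, w) * (13 / 20 * θ ^ 2) :=
              Finset.sum_le_sum_of_subset_of_nonneg (Finset.subset_univ _) fun w _ _ =>
                mul_nonneg (h0 _) (by positivity)
          _ = _ := by rw [← Finset.sum_mul, hsum]; ring
      · simp
    refine (Finset.sum_le_sum hterm).trans_eq ?_
    rw [Finset.sum_ite_mem, Finset.inter_eq_right.2 hJ, Finset.sum_const, nsmul_eq_mul]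
  have hc := cut_chernoff h0 h1 S (fun u => if u ∈ J then -θ * σ u else 0) (fun _ => σ)
    (fun _ _ _ => rfl) hK (J.card * (θ * (9 / 10 * m)))
  refine (measureReal_mono fun R hR => ?_).trans (hc.trans ?_)
  · have hR' : ∀ u ∈ J, σ u * cutSum p R S σ u ≤ -(9 / 10 * m) := hR
    simp only [Set.mem_ofPred_eq]
    have e : ∑ u ∈ S, (if u ∈ J then -θ * σ u else 0) * ∑ w ∈ Sᶜ, σ w * (edge R u w - p s(u, w))
        = ∑ u ∈ J, θ * (-(σ u * cutSum p R S σ u)) := by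
      simp only [ite_mul, zero_mul]
      rw [Finset.sum_ite_mem, Finset.inter_eq_right.2 hJ]
      exact Finset.sum_congr rfl fun u _ => by unfold cutSum; ring
    rw [e, ← nsmul_eq_mul, ← Finset.sum_const]
    refine Finset.sum_le_sum fun u hu => mul_le_mul_of_nonneg_left ?_ hθ0.le
    linarith [hR' u hu]
  · apply Real.exp_le_exp.2
    rw [hθ]
    have : ∀ k : ℝ, k * (13 / 20 * (7 / 5 * m / d) ^ 2 * (d / 2)) - k * (7 / 5 * m / d * (9 / 10 * m))
        = -(623 / 1000 * (m ^ 2 / d) * k) := fun k => by field_simp; ring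
    rw [this]

lemma signBound_prob {σ : V → ℝ} {d m x : ℝ} {p : Sym2 V → ℝ} (H : Planted σ d m p)
    (h0 : ∀ e, 0 ≤ p e) (h1 : ∀ e, p e ≤ 1) (hx : x * d = 4 * m ^ 2) (hx200 : 200 ≤ x) :
    (coins p).real {R | ¬ SignBound σ m (Fintype.card V * Real.exp (-(13 / 100 * x))) p R} ≤
      Real.exp (-(Fintype.card V * Real.exp (-(13 / 100 * x)))) * (Fintype.card V + 1) := by
  have hm := H.pos
  have hd : 0 < d := by linarith [H.le]
  have hN := H.card_pos'
  set k₀ := Fintype.card V * Real.exp (-(13 / 100 * x)) with hk₀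
  have hset : {R : Sym2 V → Bool | ¬ SignBound σ m k₀ p R} = {R | ∃ S : Finset V, k₀ ≤ S.card ∧
      ∃ J ∈ S.powerset, (∀ u ∈ J, σ u * cutSum p R S σ u ≤ -(9 / 10 * m)) ∧
        95 / 100 * (S.card : ℝ) ≤ J.card} := by
    ext R
    simp only [SignBound, Set.mem_ofPred_eq, Finset.mem_powerset]
    push Not
    rfl
  rw [hset]
  refine coins_exists_set_le p _ fun S => ?_
  by_cases hS : k₀ ≤ S.card
  swap
  · simp only [hS, false_and]
    rw [show {R : Sym2 V → Bool | False} = ∅ from rfl, measureReal_empty]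
    positivity
  simp only [hS, true_and]
  refine (coins_exists_le p _ _).trans ?_
  have hk : (0 : ℝ) ≤ S.card := Nat.cast_nonneg _
  have hone : ∀ J ∈ S.powerset, (coins p).real {R | (∀ u ∈ J, σ u * cutSum p R S σ u ≤ -(9 / 10 * m))
      ∧ 95 / 100 * (S.card : ℝ) ≤ J.card} ≤ Real.exp (-(1479 / 10000 * x * S.card)) := by
    intro J hJ
    by_cases hJS : 95 / 100 * (S.card : ℝ) ≤ J.card
    swap
    · simp only [hJS, and_false]
      rw [show {R : Sym2 V → Bool | False} = ∅ from rfl, measureReal_empty]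
      positivity
    simp only [hJS, and_true]
    refine (cutSum_sign_prob H h0 h1 S J (Finset.mem_powerset.1 hJ)).trans ?_
    apply Real.exp_le_exp.2
    have e : m ^ 2 / d = x / 4 := by rw [div_eq_div_iff hd.ne' (by norm_num)]; linarith
    rw [e]
    have : x * (95 / 100 * S.card) ≤ x * J.card := by gcongr
    nlinarith [mul_nonneg (by linarith : 0 ≤ x) hk]
  refine (Finset.sum_le_sum hone).trans ?_
  rw [Finset.sum_const, Finset.card_powerset, nsmul_eq_mul, ← Real.exp_add]
  -- The choice of `J` inside `S` costs log 2 < 0.7 per vertex. The gain 0.623 · 0.95 · x/4 =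
  -- 0.1479x exceeds the entropy 0.13x by enough to pay for it.
  have h2 : ((2 ^ S.card : ℕ) : ℝ) ≤ Real.exp (S.card * (7 / 10)) := by
    rw [Real.exp_nat_mul]
    push_cast
    refine pow_le_pow_left₀ (by norm_num) ?_ _
    rw [← Real.log_le_iff_le_exp (by norm_num)]
    linarith [Real.log_two_lt_d9]
  calc _ ≤ Real.exp (S.card * (7 / 10)) * Real.exp (-(1479 / 10000 * x * S.card)) := by gcongr
    _ ≤ _ := by
      rw [← Real.exp_add]
      apply Real.exp_le_exp.2
      have := entropy_le hN hS
      nlinarith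

end BlockModel

namespace BlockModel

open Matrix

/-! ### Truncation of real numbers -/

/-- The truncation of `t` to the interval `[-L, L]`. -/
def clip (L t : ℝ) : ℝ := max (-L) (min L t)

lemma abs_clip_le {L : ℝ} (hL : 0 ≤ L) (t : ℝ) : |clip L t| ≤ L :=
  abs_le.2 ⟨le_max_left _ _, max_le (by linarith) (min_le_left _ _)⟩

lemma clip_of_abs_le {L t : ℝ} (h : |t| ≤ L) : clip L t = t := by
  have := abs_le.1 h
  unfold clip
  rw [min_eq_right this.2, max_eq_right this.1]

lemma abs_clip_sub_clip_le (L s t : ℝ) : |clip L s - clip L t| ≤ |s - t| := by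
  unfold clip
  refine (abs_max_sub_max_le_max _ _ _ _).trans ?_
  rw [sub_self, abs_zero]
  refine max_le (abs_nonneg _) ((abs_min_sub_min_le_max _ _ _ _).trans ?_)
  rw [sub_self, abs_zero]
  exact max_le (abs_nonneg _) le_rfl

lemma abs_clip_le_abs {L : ℝ} (hL : 0 ≤ L) (t : ℝ) : |clip L t| ≤ |t| := by
  have := abs_clip_sub_clip_le L t 0
  rwa [clip_of_abs_le (t := 0) (by simpa using hL), sub_zero, sub_zero] at this

variable {V : Type*} [Fintype V] [DecidableEq V]

/-! ### Test functions that depend on the edges outside a set -/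

/-- The centred adjacency matrix on the complement of `S`. -/
noncomputable def outerNoise (p : Sym2 V → ℝ) (R : Sym2 V → Bool) (S : Finset V) : Matrix V V ℝ :=
  fun i j => if i ∈ S ∨ j ∈ S then 0 else edge R i j - p s(i, j)

/-- The solution `z` of `z = κ F z + a + b σ` on the complement of `S`, with `F` the noise. -/
noncomputable def outerSolution (σ : V → ℝ) (p : Sym2 V → ℝ) (R : Sym2 V → Bool) (S : Finset V)
    (q : ℝ × ℝ × ℝ) : V → ℝ :=
  (1 - q.1 • outerNoise p R S)⁻¹ *ᵥ ((S : Set V)ᶜ.indicator fun w => q.2.1 + q.2.2 * σ w)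

/-- The truncated deviation of the outer solution from its mean. -/
noncomputable def outerDeviation (σ : V → ℝ) (p : Sym2 V → ℝ) (L : ℝ) (R : Sym2 V → Bool)
    (S : Finset V) (q : ℝ × ℝ × ℝ) : V → ℝ :=
  (S : Set V)ᶜ.indicator fun w => clip L (outerSolution σ p R S q w - (q.2.1 + q.2.2 * σ w))

open scoped Classical in
/-- The truncated deviation of the outer solution from its mean, if it is small. -/
noncomputable def testFun (σ : V → ℝ) (p : Sym2 V → ℝ) (L δ : ℝ) (q : ℝ × ℝ × ℝ) (S : Finset V)
    (R : Sym2 V → Bool) : V → ℝ :=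
  if l2 (outerDeviation σ p L R S q) ^ 2 ≤ δ * Fintype.card V then outerDeviation σ p L R S q
  else 0

omit [Fintype V] in
lemma outerNoise_congr {p : Sym2 V → ℝ} {R R' : Sym2 V → Bool} {S : Finset V}
    (h : ∀ i ∉ S, ∀ j ∉ S, R s(i, j) = R' s(i, j)) : outerNoise p R S = outerNoise p R' S := by
  ext i j
  unfold outerNoise
  split_ifs with hij
  · rfl
  · push Not at hij
    unfold edge
    rw [h i hij.1 j hij.2]

/-- The solution is built from the matrix of edges with both ends outside `S`. So it is fixed by
conditioning on these edges, while the edges leaving `S` are still random. -/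
lemma testFun_congr {σ : V → ℝ} {p : Sym2 V → ℝ} {L δ : ℝ} {q : ℝ × ℝ × ℝ} {S : Finset V}
    {R R' : Sym2 V → Bool} (h : ∀ i ∉ S, ∀ j ∉ S, R s(i, j) = R' s(i, j)) :
    testFun σ p L δ q S R = testFun σ p L δ q S R' := by
  unfold testFun outerDeviation outerSolution
  rw [outerNoise_congr h]

lemma abs_testFun_le {σ : V → ℝ} {p : Sym2 V → ℝ} {L δ : ℝ} (hL : 0 ≤ L) (q : ℝ × ℝ × ℝ)
    (S : Finset V) (R : Sym2 V → Bool) (w : V) : |testFun σ p L δ q S R w| ≤ L := by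
  unfold testFun
  split_ifs
  · unfold outerDeviation
    by_cases hw : w ∈ (S : Set V)ᶜ
    · rw [Set.indicator_of_mem hw]; exact abs_clip_le hL _
    · rw [Set.indicator_of_notMem hw]; simpa using hL
  · simpa using hL

lemma sum_sq_testFun_le {σ : V → ℝ} {p : Sym2 V → ℝ} {L δ : ℝ} (hδ : 0 ≤ δ) (q : ℝ × ℝ × ℝ)
    (S : Finset V) (R : Sym2 V → Bool) :
    ∑ w ∈ Sᶜ, testFun σ p L δ q S R w ^ 2 ≤ δ * Fintype.card V := by
  refine (Finset.sum_le_sum_of_subset_of_nonneg (Finset.subset_univ _)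
    fun _ _ _ => sq_nonneg _).trans ?_
  rw [← l2_sq]
  unfold testFun
  split_ifs with h
  · exact h
  · rw [l2_zero, zero_pow two_ne_zero]; exact mul_nonneg hδ (Nat.cast_nonneg _)

omit [DecidableEq V] in
lemma trimmedEdge_of_le {D : ℝ} {R : Sym2 V → Bool} {i j : V} (hi : degree R i ≤ 20 * D)
    (hj : degree R j ≤ 20 * D) : trimmedEdge D R i j = edge R i j := by
  unfold trimmedEdge
  rw [if_neg (by push Not; exact ⟨hi, hj⟩)]

lemma outerNoise_mulVec {D : ℝ} {p : Sym2 V → ℝ} {R : Sym2 V → Bool} {S : Finset V}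
    (hS : ∀ u ∉ S, degree R u ≤ 20 * D) (z : V → ℝ) :
    outerNoise p R S *ᵥ z
      = (S : Set V)ᶜ.indicator (noise D p R *ᵥ ((S : Set V)ᶜ.indicator z)) := by
  ext i
  by_cases hi : i ∈ S
  · rw [Set.indicator_of_notMem (by simpa using hi)]
    simp [mulVec, dotProduct, outerNoise, hi]
  · rw [Set.indicator_of_mem (by simpa using hi)]
    simp only [mulVec, dotProduct]
    refine Finset.sum_congr rfl fun j _ => ?_
    by_cases hj : j ∈ S
    · rw [Set.indicator_of_notMem (by simpa using hj)]
      simp [outerNoise, hj]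
    · rw [Set.indicator_of_mem (by simpa using hj)]
      simp [outerNoise, noise, hi, hj, trimmedEdge_of_le (hS i hi) (hS j hj)]

/-- All trimmed vertices outside the kept ones lie in `S`, so between kept vertices and the
complement of `S` the trimmed and untrimmed edges agree. -/
lemma noise_mulVec_eq_cutSum {D : ℝ} {p : Sym2 V → ℝ} {R : Sym2 V → Bool} {S : Finset V}
    (hS : ∀ u ∉ S, degree R u ≤ 20 * D) (z : V → ℝ) {u : V} (hu : u ∈ kept D R S) :
    (noise D p R *ᵥ ((S : Set V)ᶜ.indicator z)) u = cutSum p R S z u := by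
  have hdeg : degree R u ≤ 20 * D := (Finset.mem_filter.1 hu).2
  simp only [mulVec, dotProduct, cutSum]
  rw [← Finset.sum_subset (Finset.subset_univ Sᶜ)]
  · refine Finset.sum_congr rfl fun j hj => ?_
    have hj' : j ∉ S := Finset.mem_compl.1 hj
    rw [Set.indicator_of_mem (by simpa using hj')]
    simp only [noise, trimmedEdge_of_le hdeg (hS j hj')]
    ring
  · intro j _ hj
    rw [Set.indicator_of_notMem (by simpa using hj), mul_zero]

omit [DecidableEq V] in
-- A trimmed row of the matrix is zero and the eigenvalue is positive.
lemma IsEigen.eq_zero {σ : V → ℝ} {d m : ℝ} {p : Sym2 V → ℝ} {R : Sym2 V → Bool} {X : V → ℝ}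
    {l a b : ℝ} (hX : IsEigen σ d m p R X l a b) (hm : 0 < m) {u : V} (hu : 20 * d < degree R u) :
    X u = 0 := by
  have h := congrFun hX.eig u
  have h0 : (trimmedMatrix d R *ᵥ X) u = 0 := by
    simp only [mulVec, dotProduct]
    refine Finset.sum_eq_zero fun j _ => ?_
    simp [trimmedMatrix, trimmedEdge, hu]
  rw [h0, Pi.smul_apply, smul_eq_mul] at h
  have hl : 0 < l := lt_of_lt_of_le (by positivity) hX.le
  exact (mul_eq_zero.1 h.symm).resolve_left hl.ne'

section OuterSolution

variable {σ : V → ℝ} {d m : ℝ} {p : Sym2 V → ℝ} {R : Sym2 V → Bool} {ε : ℝ} {S : Finset V}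

lemma l2_outerNoise_le (hnoise : ∀ z, l2 (noise d p R *ᵥ z) ≤ ε * m * l2 z) (hεm : 0 ≤ ε * m)
    (hS : ∀ u ∉ S, degree R u ≤ 20 * d) (z : V → ℝ) :
    l2 (outerNoise p R S *ᵥ z) ≤ ε * m * l2 z := by
  rw [outerNoise_mulVec hS]
  refine (l2_indicator_le _ _).trans ((hnoise _).trans ?_)
  exact mul_le_mul_of_nonneg_left (l2_indicator_le _ _) hεm

omit [DecidableEq V] in
lemma eq_zero_of_l2 {z : V → ℝ} (h : l2 z = 0) : z = 0 := by
  have h4 : (WithLp.toLp 2 z : EuclideanSpace ℝ V) = 0 := norm_eq_zero.1 h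
  have := congrArg WithLp.ofLp h4
  simpa using this

/-- The smallness of κF makes 1 - κF injective, hence invertible. Then the formal inverse in the
definition is a true inverse. -/
lemma outerSolution_eq (hF : ∀ z, l2 (outerNoise p R S *ᵥ z) ≤ ε * m * l2 z)
    {q : ℝ × ℝ × ℝ} (hq : |q.1| * (ε * m) < 1) :
    outerSolution σ p R S q = q.1 • (outerNoise p R S *ᵥ outerSolution σ p R S q)
      + (S : Set V)ᶜ.indicator fun w => q.2.1 + q.2.2 * σ w := by
  set F := outerNoise p R S with hFdef
  have hinj : Function.Injective (1 - q.1 • F).mulVec := by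
    intro y z hyz
    have h1 : (1 - q.1 • F) *ᵥ (y - z) = 0 := by
      rw [mulVec_sub, sub_eq_zero]; exact hyz
    rw [sub_mulVec, one_mulVec, smul_mulVec, sub_eq_zero] at h1
    have h2 : l2 (y - z) ≤ |q.1| * (ε * m) * l2 (y - z) := by
      conv_lhs => rw [h1, l2_smul]
      rw [mul_assoc]
      exact mul_le_mul_of_nonneg_left (hF _) (abs_nonneg _)
    have h3 : l2 (y - z) = 0 := by
      rcases (l2_nonneg (y - z)).eq_or_lt with h | h
      · exact h.symm
      · nlinarith
    exact sub_eq_zero.1 (eq_zero_of_l2 h3)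
  have hunit : IsUnit (1 - q.1 • F) := mulVec_injective_iff_isUnit.1 hinj
  have h : (1 - q.1 • F) *ᵥ outerSolution σ p R S q
      = (S : Set V)ᶜ.indicator fun w => q.2.1 + q.2.2 * σ w := by
    unfold outerSolution
    rw [mulVec_mulVec, Matrix.mul_nonsing_inv _ ((isUnit_iff_isUnit_det _).1 hunit), one_mulVec]
  rw [← h, sub_mulVec, one_mulVec, smul_mulVec]
  abel

end OuterSolution

omit [DecidableEq V] in
lemma l2_indicator_sqrt_le (G : Finset V) (z : V → ℝ) {c m k : ℝ} (hc : 0 ≤ c) (hm : 0 ≤ m)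
    (hk : 0 ≤ k) (h : ∑ u ∈ G, z u ^ 2 ≤ c ^ 2 * m ^ 2 * k) :
    l2 ((G : Set V).indicator z) ≤ c * m * √k := by
  refine le_of_sq_le_sq ?_ (by positivity)
  rw [l2_indicator_sq, mul_pow, Real.sq_sqrt hk, mul_pow]
  exact h

set_option maxHeartbeats 1000000 in
/-- The values of an eigenvector on a set `S` that contains all vertices where the eigenvector is
large are determined, up to a small error, by the numbers of edges to the two blocks. -/
lemma IsEigen.restrict {σ : V → ℝ} {d m : ℝ} {p : Sym2 V → ℝ} (H : Planted σ d m p)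
    {R : Sym2 V → Bool} {ε : ℝ} (hε0 : 0 ≤ ε) (hε : ε ≤ 1 / 10 ^ 6)
    (hnoise : ∀ z, l2 (noise d p R *ᵥ z) ≤ ε * m * l2 z) {X : V → ℝ} {l a b : ℝ}
    (hX : IsEigen σ d m p R X l a b) {S : Finset V} (hS : ∀ u ∉ S, degree R u ≤ 20 * d)
    (hSX : ∀ u ∉ S, |X u| ≤ 400) {η : ℝ} (hη1 : η ≤ 1)
    (hη : 8 * η * √(Fintype.card V) ≤ √S.card) {q : ℝ × ℝ × ℝ}
    (hq1 : |q.1 - 1 / l| ≤ η / m) (hq2 : |q.2.1 - a| ≤ η) (hq3 : |q.2.2 - b| ≤ η)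
    (h1 : ∑ u ∈ kept d R S, cutSum p R S (fun _ => 1) u ^ 2 ≤ 49 * m ^ 2 * S.card)
    (hσ : ∑ u ∈ kept d R S, cutSum p R S σ u ^ 2 ≤ 49 * m ^ 2 * S.card)
    (hq : ∑ u ∈ kept d R S, cutSum p R S (testFun σ p 404 (900 * ε ^ 2) q S R) u ^ 2
      ≤ 1 / 10 ^ 6 * m ^ 2 * S.card) :
    l2 ((S : Set V).indicator X) ≤ 40 * √S.card ∧
    l2 ((kept d R S : Set V).indicator fun u => (noise d p R *ᵥ X) u / l
      - (a * cutSum p R S (fun _ => 1) u + b * cutSum p R S σ u) / l) ≤ 2 / 1000 * √S.card := by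
  have hN := H.card_pos'
  have hm := H.pos
  set N : ℝ := (Fintype.card V : ℝ) with hNdef
  set k : ℝ := (S.card : ℝ) with hk
  have hk0 : 0 ≤ k := Nat.cast_nonneg _
  have hsk : 0 ≤ √k := Real.sqrt_nonneg _
  have hsN : 0 < √N := Real.sqrt_pos.2 hN
  have hlm := hX.le
  have hl : 0 < l := by linarith
  have hη0 : 0 ≤ η := (abs_nonneg _).trans hq2
  have hεm : 0 ≤ ε * m := by positivity
  have hml : m / l ≤ 100 / 99 := by rw [div_le_iff₀ hl]; linarith
  have ha := hX.abs_a_le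
  have hb := hX.abs_b_le
  set Δ := noise d p R with hΔ
  set F := outerNoise p R S with hFdef
  have hF : ∀ z, l2 (F *ᵥ z) ≤ ε * m * l2 z := l2_outerNoise_le hnoise hεm hS
  set G := kept d R S with hG
  have hGS : G ⊆ S := kept_subset _ _ _
  set C : Set V := (S : Set V)ᶜ with hC
  set XS : V → ℝ := (S : Set V).indicator X with hXS
  set XC : V → ℝ := C.indicator X with hXC
  have hXsplit : X = XS + XC := (Set.indicator_self_add_compl _ _).symm
  set I : V → ℝ := C.indicator fun w => a + b * σ w with hI
  set I' : V → ℝ := C.indicator fun w => q.2.1 + q.2.2 * σ w with hI'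
  set J : V → ℝ := fun w => (a - q.2.1) + (b - q.2.2) * σ w with hJ
  have hJ2 : l2 J ≤ 2 * η * √N := by
    refine (H.l2_comb_le _ _).trans ?_
    rw [abs_sub_comm] at hq2 hq3
    exact mul_le_mul_of_nonneg_right (by linarith) hsN.le
  have hκ : |q.1| * (ε * m) ≤ 3 * ε := by
    have h2 : |q.1| ≤ 1 / l + η / m := by
      have := abs_add_le (q.1 - 1 / l) (1 / l)
      rw [sub_add_cancel, abs_of_pos (by positivity : 0 < 1 / l)] at this
      linarith
    calc |q.1| * (ε * m) ≤ (1 / l + η / m) * (ε * m) := by gcongr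
      _ = ε * (m / l + η) := by field_simp
      _ ≤ ε * 3 := by gcongr; linarith
      _ = _ := by ring
  have hsol := outerSolution_eq (σ := σ) hF (q := q) (by linarith)
  set Xh := outerSolution σ p R S q with hXh
  rw [← hI'] at hsol
  have hκF : ∀ z, l2 (q.1 • (F *ᵥ z)) ≤ 3 * ε * l2 z := by
    intro z
    rw [l2_smul]
    calc _ ≤ |q.1| * (ε * m * l2 z) := mul_le_mul_of_nonneg_left (hF z) (abs_nonneg _)
      _ = |q.1| * (ε * m) * l2 z := by ring
      _ ≤ _ := mul_le_mul_of_nonneg_right hκ (l2_nonneg _)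
  -- the distance from `X` to the outer solution
  set E := XC - Xh with hE
  -- The eigenvector equation restricted to the complement of `S`: only the last term knows about
  -- the entries on `S`.
  have hXCeq : XC = I + (1 / l) • (F *ᵥ XC) + (1 / l) • C.indicator (Δ *ᵥ XS) := by
    ext w
    by_cases hw : w ∈ C
    · have e1 : (F *ᵥ XC) w = (Δ *ᵥ XC) w := by
        rw [hFdef, outerNoise_mulVec hS, Set.indicator_of_mem hw, hXC, Set.indicator_indicator,
          Set.inter_self]
      simp only [Pi.add_apply, Pi.smul_apply, smul_eq_mul, e1]
      rw [Set.indicator_of_mem hw]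
      have e2 : XC w = X w := Set.indicator_of_mem hw _
      have e3 : I w = a + b * σ w := Set.indicator_of_mem hw _
      rw [e2, e3, hX.decomp w]
      have e4 : (Δ *ᵥ X) w = (Δ *ᵥ XS) w + (Δ *ᵥ XC) w := by
        conv_lhs => rw [hXsplit]
        rw [mulVec_add]; rfl
      rw [e4]; ring
    · have e1 : (F *ᵥ XC) w = 0 := by
        rw [hFdef, outerNoise_mulVec hS, Set.indicator_of_notMem hw]
      simp only [Pi.add_apply, Pi.smul_apply, smul_eq_mul, e1]
      rw [Set.indicator_of_notMem hw]
      have e2 : XC w = 0 := Set.indicator_of_notMem hw _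
      have e3 : I w = 0 := Set.indicator_of_notMem hw _
      rw [e2, e3]; ring
  -- The difference solves the same contractive equation, with errors from rounding l, from rounding
  -- a and b, and from the entries of X on `S`.
  have hEeq : E = q.1 • (F *ᵥ E) + ((1 / l - q.1) • (F *ᵥ XC)) + C.indicator J
      + (1 / l) • C.indicator (Δ *ᵥ XS) := by
    have e1 : I = I' + C.indicator J := by
      rw [hI, hI', ← Set.indicator_add']
      congr 1; ext w; simp only [hJ, Pi.add_apply]; ring
    have e2 : E = I + (1 / l) • (F *ᵥ XC) + (1 / l) • C.indicator (Δ *ᵥ XS)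
        - (q.1 • (F *ᵥ Xh) + I') := by rw [← hXCeq, ← hsol]
    have e3 : F *ᵥ E = F *ᵥ XC - F *ᵥ Xh := by rw [hE, mulVec_sub]
    rw [e3]
    ext w
    have e1w := congrFun e1 w
    have e2w := congrFun e2 w
    simp only [Pi.add_apply, Pi.sub_apply, Pi.smul_apply, smul_eq_mul] at e1w e2w ⊢
    linear_combination e2w + e1w
  have hE2 : l2 E ≤ 4 * η * √N + 3 * ε * l2 XS := by
    have n1 := hκF E
    have n2 : l2 ((1 / l - q.1) • (F *ᵥ XC)) ≤ ε * η * √N := by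
      rw [l2_smul, abs_sub_comm]
      calc _ ≤ η / m * (ε * m * l2 XC) :=
            mul_le_mul hq1 (hF _) (l2_nonneg _) (by positivity)
        _ = ε * η * l2 XC := by field_simp
        _ ≤ _ := by
          gcongr
          rw [← hX.norm]; exact l2_indicator_le _ _
    have n3 : l2 (C.indicator J) ≤ 2 * η * √N := (l2_indicator_le _ _).trans hJ2
    have n4 : l2 ((1 / l) • C.indicator (Δ *ᵥ XS)) ≤ 2 * ε * l2 XS := by
      rw [l2_smul, abs_of_pos (by positivity)]
      calc _ ≤ 1 / l * (ε * m * l2 XS) := by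
            gcongr; exact (l2_indicator_le _ _).trans (hnoise _)
        _ = m / l * (ε * l2 XS) := by ring
        _ ≤ 100 / 99 * (ε * l2 XS) := by gcongr; exact mul_nonneg hε0 (l2_nonneg _)
        _ ≤ _ := by nlinarith [mul_nonneg hε0 (l2_nonneg XS)]
    have hEtri : l2 E ≤ 3 * ε * l2 E + ε * η * √N + 2 * η * √N + 2 * ε * l2 XS := by
      conv_lhs => rw [hEeq]
      refine (l2_add_le _ _).trans (add_le_add ((l2_add_le _ _).trans
        (add_le_add ((l2_add_le _ _).trans (add_le_add n1 n2)) n3)) n4)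
    have hp1 : 0 ≤ η * √N := by positivity
    have hp2 := mul_nonneg hε0 (l2_nonneg XS)
    have hp3 : ε * (η * √N) ≤ 1 / 10 ^ 6 * (η * √N) := by gcongr
    have hp4 : ε * l2 E ≤ 1 / 10 ^ 6 * l2 E := mul_le_mul_of_nonneg_right hε (l2_nonneg _)
    have := l2_nonneg E
    nlinarith
  -- the truncated deviation
  set g : V → ℝ := outerDeviation σ p 404 R S q with hg
  have hXhI : ∀ w ∈ C, Xh w - (q.2.1 + q.2.2 * σ w) = (q.1 • (F *ᵥ Xh)) w := by
    intro w hw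
    have e1 := congrFun hsol w
    have e2 : I' w = q.2.1 + q.2.2 * σ w := Set.indicator_of_mem hw _
    rw [Pi.add_apply, e2] at e1
    linarith
  -- The norm test in `testFun` is passed: the deviation is κ times the outer noise of the solution,
  -- of norm at most 3ε · 7√N, and 21² ≤ 900.
  have htest : testFun σ p 404 (900 * ε ^ 2) q S R = g := by
    unfold testFun
    rw [if_pos]
    have n1 : l2 I' ≤ 6 * √N := by
      refine (l2_indicator_le _ _).trans ((H.l2_comb_le _ _).trans ?_)
      refine mul_le_mul_of_nonneg_right ?_ hsN.le
      have m1 := abs_add_le (q.2.1 - a) a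
      have m2 := abs_add_le (q.2.2 - b) b
      rw [sub_add_cancel] at m1 m2
      linarith
    have n2 : l2 Xh ≤ 7 * √N := by
      have : l2 Xh ≤ 3 * ε * l2 Xh + 6 * √N := by
        conv_lhs => rw [hsol]
        exact (l2_add_le _ _).trans (add_le_add (hκF _) n1)
      have hp4 : ε * l2 Xh ≤ 1 / 10 ^ 6 * l2 Xh := mul_le_mul_of_nonneg_right hε (l2_nonneg _)
      nlinarith [l2_nonneg Xh]
    have n3 : l2 g ≤ 21 * ε * √N := by
      have : l2 g ≤ l2 (q.1 • (F *ᵥ Xh)) := by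
        refine l2_mono fun w => ?_
        by_cases hw : w ∈ C
        · have e : g w = clip 404 (Xh w - (q.2.1 + q.2.2 * σ w)) := Set.indicator_of_mem hw _
          rw [e, hXhI w hw]
          exact abs_clip_le_abs (by norm_num) _
        · have e : g w = 0 := Set.indicator_of_notMem hw _
          rw [e, abs_zero]; exact abs_nonneg _
      refine this.trans ((hκF _).trans ?_)
      nlinarith
    calc l2 g ^ 2 ≤ (21 * ε * √N) ^ 2 := pow_le_pow_left₀ (l2_nonneg _) n3 2
      _ = 441 * ε ^ 2 * N := by rw [mul_pow, Real.sq_sqrt hN.le]; ring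
      _ ≤ _ := by nlinarith [mul_nonneg (sq_nonneg ε) hN.le]
  rw [htest] at hq
  set r : V → ℝ := C.indicator (fun w => X w - (a + b * σ w)) - g with hr
  have hr2 : l2 r ≤ 6 * η * √N + 3 * ε * l2 XS := by
    have hle : l2 r ≤ l2 (E - J) := by
      refine l2_mono fun w => ?_
      rw [hr, Pi.sub_apply]
      by_cases hw : w ∈ C
      · have e : g w = clip 404 (Xh w - (q.2.1 + q.2.2 * σ w)) := Set.indicator_of_mem hw _
        have e2 : XC w = X w := Set.indicator_of_mem hw _
        have hσw : |σ w| = 1 := by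
          have := Real.sqrt_sq_eq_abs (σ w)
          rw [H.sq, Real.sqrt_one] at this; exact this.symm
        -- The level 404 is 400 + 2 + 2. Truncation does not act on X itself outside `S`, so being a
        -- contraction it can only bring the outer solution closer.
        have hb4 : |X w - (a + b * σ w)| ≤ 404 := by
          have t1 := abs_sub (X w) (a + b * σ w)
          have t2 := abs_add_le a (b * σ w)
          rw [abs_mul, hσw, mul_one] at t2
          have t3 := hSX w (by simpa [hC] using hw)
          linarith
        rw [Set.indicator_of_mem hw, e, ← clip_of_abs_le hb4]
        refine (abs_clip_sub_clip_le _ _ _).trans_eq ?_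
        congr 1
        simp only [hE, hJ, Pi.sub_apply, e2]; ring
      · have e : g w = 0 := Set.indicator_of_notMem hw _
        rw [Set.indicator_of_notMem hw, e, sub_zero, abs_zero]
        exact abs_nonneg _
    have := l2_sub_le E J
    linarith
  -- the decomposition of the noise
  have hXdec : X = I + g + (r + XS) := by
    ext w
    simp only [hr, Pi.add_apply, Pi.sub_apply]
    by_cases hw : w ∈ C
    · have e3 : I w = a + b * σ w := Set.indicator_of_mem hw _
      have e4 : XS w = 0 := Set.indicator_of_notMem (by simpa [hC] using hw) _
      rw [Set.indicator_of_mem hw, e3, e4]; ring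
    · have e3 : I w = 0 := Set.indicator_of_notMem hw _
      have e4 : XS w = X w := Set.indicator_of_mem (by simpa [hC] using hw) _
      rw [Set.indicator_of_notMem hw, e3, e4]; ring
  set e : V → ℝ := fun u => (Δ *ᵥ X) u / l
    - (a * cutSum p R S (fun _ => 1) u + b * cutSum p R S σ u) / l with he
  -- After the block counts are removed, the deviation `g` is controlled by the conditional moment
  -- bound. The rest, `r + XS`, is small enough for the operator norm.
  have hedec : (G : Set V).indicator e = (1 / l) • (G : Set V).indicator (cutSum p R S g)
      + (1 / l) • (G : Set V).indicator (Δ *ᵥ (r + XS)) := by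
    ext u
    by_cases hu : u ∈ (G : Set V)
    · simp only [Pi.add_apply, Pi.smul_apply, smul_eq_mul]
      rw [Set.indicator_of_mem hu, Set.indicator_of_mem hu, Set.indicator_of_mem hu]
      have e1 : (Δ *ᵥ I) u = a * cutSum p R S (fun _ => 1) u + b * cutSum p R S σ u := by
        rw [hI, hΔ, noise_mulVec_eq_cutSum hS _ (Finset.mem_coe.1 hu)]
        unfold cutSum
        rw [Finset.mul_sum, Finset.mul_sum, ← Finset.sum_add_distrib]
        exact Finset.sum_congr rfl fun w _ => by ring
      have e2 : (Δ *ᵥ g) u = cutSum p R S g u := by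
        have : g = C.indicator g := by
          rw [hg, outerDeviation, Set.indicator_indicator, Set.inter_self]
        conv_lhs => rw [this]
        rw [hΔ, noise_mulVec_eq_cutSum hS _ (Finset.mem_coe.1 hu)]
      have e3 : (Δ *ᵥ X) u = (Δ *ᵥ I) u + (Δ *ᵥ g) u + (Δ *ᵥ (r + XS)) u := by
        conv_lhs => rw [hXdec]
        rw [mulVec_add, mulVec_add]; rfl
      simp only [he]
      rw [e3, e1, e2]; ring
    · simp only [Pi.add_apply, Pi.smul_apply, smul_eq_mul]
      rw [Set.indicator_of_notMem hu, Set.indicator_of_notMem hu, Set.indicator_of_notMem hu]; ring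
  have hηk : 6 * η * √N ≤ √k := by nlinarith [mul_nonneg hη0 hsN.le]
  have hek : l2 ((G : Set V).indicator e) ≤ 11 / 10000 * √k + 2 * ε * √k + 2 * ε * l2 XS := by
    have n1 : l2 ((G : Set V).indicator (cutSum p R S g)) ≤ 1 / 1000 * m * √k :=
      l2_indicator_sqrt_le G _ (by norm_num) hm.le hk0 (hq.trans_eq (by ring))
    have n2 : l2 ((G : Set V).indicator (Δ *ᵥ (r + XS))) ≤
        ε * m * (√k + 3 * ε * l2 XS + l2 XS) := by
      refine (l2_indicator_le _ _).trans ((hnoise _).trans ?_)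
      refine mul_le_mul_of_nonneg_left ((l2_add_le _ _).trans ?_) hεm
      linarith
    rw [hedec]
    refine (l2_add_le _ _).trans ?_
    rw [l2_smul, l2_smul, abs_of_pos (by positivity)]
    have n3 : 1 / l * l2 ((G : Set V).indicator (cutSum p R S g)) ≤ 11 / 10000 * √k := by
      calc _ ≤ 1 / l * (1 / 1000 * m * √k) := by gcongr
        _ = m / l * (1 / 1000 * √k) := by ring
        _ ≤ 100 / 99 * (1 / 1000 * √k) :=
            mul_le_mul_of_nonneg_right hml (mul_nonneg (by norm_num) hsk)
        _ ≤ _ := by linarith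
    have n4 : 1 / l * l2 ((G : Set V).indicator (Δ *ᵥ (r + XS))) ≤ 2 * ε * √k + 2 * ε * l2 XS := by
      have hx0 := l2_nonneg XS
      have hp4 : ε * l2 XS ≤ 1 / 10 ^ 6 * l2 XS := mul_le_mul_of_nonneg_right hε hx0
      calc _ ≤ 1 / l * (ε * m * (√k + 3 * ε * l2 XS + l2 XS)) := by gcongr
        _ = m / l * (ε * (√k + 3 * (ε * l2 XS) + l2 XS)) := by ring
        _ ≤ 100 / 99 * (ε * (√k + 3 * (ε * l2 XS) + l2 XS)) :=
            mul_le_mul_of_nonneg_right hml (mul_nonneg hε0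
              (add_nonneg (add_nonneg hsk (mul_nonneg (by norm_num) (mul_nonneg hε0 hx0))) hx0))
        _ ≤ 100 / 99 * (ε * (√k + 3 * (1 / 10 ^ 6 * l2 XS) + l2 XS)) := by gcongr
        _ ≤ _ := by nlinarith [mul_nonneg hε0 hx0, mul_nonneg hε0 hsk]
    linarith
  have hXG : XS = (G : Set V).indicator (fun u => a + b * σ u)
      + (a / l) • (G : Set V).indicator (cutSum p R S fun _ => 1)
      + (b / l) • (G : Set V).indicator (cutSum p R S σ) + (G : Set V).indicator e := by
    ext u
    simp only [Pi.add_apply, Pi.smul_apply, smul_eq_mul]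
    by_cases hu : u ∈ (G : Set V)
    · have e4 : XS u = X u := Set.indicator_of_mem (Finset.mem_coe.2 (hGS (Finset.mem_coe.1 hu))) _
      rw [Set.indicator_of_mem hu, Set.indicator_of_mem hu, Set.indicator_of_mem hu,
        Set.indicator_of_mem hu, e4, hX.decomp u]
      simp only [he]; ring
    · rw [Set.indicator_of_notMem hu, Set.indicator_of_notMem hu, Set.indicator_of_notMem hu,
        Set.indicator_of_notMem hu]
      by_cases hu' : u ∈ (S : Set V)
      · have e4 : XS u = X u := Set.indicator_of_mem hu' _
        rw [e4, hX.eq_zero hm]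
        · ring
        · by_contra hcon
          exact hu (Finset.mem_coe.2 (Finset.mem_filter.2 ⟨Finset.mem_coe.1 hu', not_lt.1 hcon⟩))
      · have e4 : XS u = 0 := Set.indicator_of_notMem hu' _
        rw [e4]; ring
  -- The norm of X on `S` occurs on both sides, on the right with factor 2ε, and is absorbed. The
  -- main terms are 4 + 15 + 15.
  have hXS40 : l2 XS ≤ 40 * √k := by
    have n1 : l2 ((G : Set V).indicator fun u => a + b * σ u) ≤ 4 * 1 * √k := by
      refine l2_indicator_sqrt_le G _ (by norm_num) zero_le_one hk0 ?_
      calc _ ≤ ∑ u ∈ G, (16 : ℝ) := by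
            refine Finset.sum_le_sum fun u _ => ?_
            have hσu := H.sq u
            have h5 : |a + b * σ u| ≤ 4 := by
              have hσw : |σ u| = 1 := by
                have := Real.sqrt_sq_eq_abs (σ u)
                rw [H.sq, Real.sqrt_one] at this; exact this.symm
              have t2 := abs_add_le a (b * σ u)
              rw [abs_mul, hσw, mul_one] at t2
              linarith
            rw [← sq_abs]
            nlinarith [abs_nonneg (a + b * σ u)]
        _ = 16 * G.card := by rw [Finset.sum_const, nsmul_eq_mul, mul_comm]
        _ ≤ 16 * k := by
            have : (G.card : ℝ) ≤ k := by rw [hk]; exact_mod_cast Finset.card_le_card hGS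
            linarith
        _ = _ := by ring
    have hcoef : ∀ c : ℝ, |c| ≤ 2 → ∀ z : V → ℝ, l2 ((G : Set V).indicator z) ≤ 7 * m * √k →
        l2 ((c / l) • (G : Set V).indicator z) ≤ 15 * √k := by
      intro c hc z hz
      rw [l2_smul, abs_div, abs_of_pos hl]
      calc _ ≤ 2 / l * (7 * m * √k) := by gcongr; exact l2_nonneg _
        _ = m / l * (14 * √k) := by ring
        _ ≤ 100 / 99 * (14 * √k) :=
            mul_le_mul_of_nonneg_right hml (mul_nonneg (by norm_num) hsk)
        _ ≤ _ := by linarith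
    have n2 := hcoef a ha _ (l2_indicator_sqrt_le G (cutSum p R S fun _ => 1) (by norm_num) hm.le hk0
      (h1.trans_eq (by ring)))
    have n3 := hcoef b hb _ (l2_indicator_sqrt_le G (cutSum p R S σ) (by norm_num) hm.le hk0
      (hσ.trans_eq (by ring)))
    have htri : l2 XS ≤ 4 * 1 * √k + 15 * √k + 15 * √k
        + (11 / 10000 * √k + 2 * ε * √k + 2 * ε * l2 XS) := by
      conv_lhs => rw [hXG]
      exact (l2_add_le _ _).trans (add_le_add ((l2_add_le _ _).trans
        (add_le_add ((l2_add_le _ _).trans (add_le_add n1 n2)) n3)) hek)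
    have hp4 : ε * l2 XS ≤ 1 / 10 ^ 6 * l2 XS := mul_le_mul_of_nonneg_right hε (l2_nonneg _)
    have hp5 : ε * √k ≤ 1 / 10 ^ 6 * √k := mul_le_mul_of_nonneg_right hε hsk
    nlinarith [l2_nonneg XS]
  refine ⟨hXS40, hek.trans ?_⟩
  have hp4 : ε * l2 XS ≤ 1 / 10 ^ 6 * (40 * √k) := mul_le_mul hε hXS40 (l2_nonneg _) (by norm_num)
  have hp5 : ε * √k ≤ 1 / 10 ^ 6 * √k := mul_le_mul_of_nonneg_right hε hsk
  linarith

end BlockModel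

namespace BlockModel

open Matrix

variable {V : Type*} [Fintype V] [DecidableEq V]

/-! ### The vertices with the wrong sign -/

/-- A fine net for the parameters of the outer solutions. -/
noncomputable def paramNet (N : ℕ) (m : ℝ) : Finset (ℝ × ℝ × ℝ) :=
  (Finset.Icc (-(16 * N : ℤ)) (16 * N) ×ˢ Finset.Icc (-(16 * N : ℤ)) (16 * N) ×ˢ
    Finset.Icc (-(16 * N : ℤ)) (16 * N)).image
    fun z => ((z.1 : ℝ) * (1 / (8 * N)) / m, (z.2.1 : ℝ) * (1 / (8 * N)), (z.2.2 : ℝ) * (1 / (8 * N)))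

lemma card_paramNet_le (N : ℕ) (m : ℝ) : ((paramNet N m).card : ℝ) ≤ (32 * N + 1) ^ 3 := by
  have h : (paramNet N m).card ≤ (32 * N + 1) ^ 3 := by
    refine Finset.card_image_le.trans ?_
    rw [Finset.card_product, Finset.card_product, Int.card_Icc]
    have : ((16 * N + 1 - -(16 * N) : ℤ)).toNat = 32 * N + 1 := by omega
    rw [this]
    apply le_of_eq; ring
  exact_mod_cast h

lemma exists_grid {N : ℕ} (hN : 0 < N) {t : ℝ} (ht : |t| ≤ 2) :
    ∃ i ∈ Finset.Icc (-(16 * N : ℤ)) (16 * N), |(i : ℝ) * (1 / (8 * N)) - t| ≤ 1 / (8 * N) := by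
  have hN' : (0 : ℝ) < N := by exact_mod_cast hN
  obtain ⟨w, -, h1, h2⟩ := exists_int_trunc (t * (8 * N))
  have h3 : |(w : ℝ)| ≤ 16 * N := by
    refine (sq_le_sq.1 h1).trans ?_
    rw [abs_mul, abs_of_pos (by positivity : (0 : ℝ) < 8 * N)]
    nlinarith
  have h4 : |w| ≤ (16 * N : ℤ) := by exact_mod_cast h3
  refine ⟨w, Finset.mem_Icc.2 (abs_le.1 h4), ?_⟩
  have h5 : |t * (8 * N) - w| ≤ 1 := abs_le_of_sq_le_sq (by simpa using h2) zero_le_one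
  have e : (w : ℝ) * (1 / (8 * N)) - t = -((t * (8 * N) - w) * (1 / (8 * N))) := by field_simp; ring
  rw [e, abs_neg, abs_mul, abs_of_pos (by positivity : (0 : ℝ) < 1 / (8 * N))]
  exact mul_le_of_le_one_left (by positivity) h5

lemma exists_mem_paramNet {N : ℕ} (hN : 0 < N) {m l a b : ℝ} (hm : 0 < m) (hl : 99 / 100 * m ≤ l)
    (ha : |a| ≤ 2) (hb : |b| ≤ 2) : ∃ q ∈ paramNet N m, |q.1 - 1 / l| ≤ 1 / (8 * N) / m ∧
      |q.2.1 - a| ≤ 1 / (8 * N) ∧ |q.2.2 - b| ≤ 1 / (8 * N) := by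
  have hl0 : 0 < l := by linarith
  obtain ⟨i, hi, hi'⟩ := exists_grid hN (t := m / l) (by
    rw [abs_of_pos (by positivity), div_le_iff₀ hl0]; linarith)
  obtain ⟨j, hj, hj'⟩ := exists_grid hN ha
  obtain ⟨k, hk, hk'⟩ := exists_grid hN hb
  refine ⟨((i : ℝ) * (1 / (8 * N)) / m, (j : ℝ) * (1 / (8 * N)), (k : ℝ) * (1 / (8 * N))),
    Finset.mem_image.2 ⟨(i, j, k), by simp only [Finset.mem_product]; exact ⟨hi, hj, hk⟩, rfl⟩,
    ?_, hj', hk'⟩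
  have e : (i : ℝ) * (1 / (8 * N)) / m - 1 / l = ((i : ℝ) * (1 / (8 * N)) - m / l) / m := by
    field_simp
  simp only
  rw [e, abs_div, abs_of_pos hm]
  gcongr

/-- The noise from the constant function, the signs and the truncated outer deviations is not large
on any set that is not too small. -/
def SquaresBound (σ : V → ℝ) (d m k₀ ε : ℝ) (p : Sym2 V → ℝ) (R : Sym2 V → Bool) : Prop :=
  ∀ S : Finset V, k₀ ≤ S.card →
    ∑ u ∈ kept d R S, cutSum p R S (fun _ => 1) u ^ 2 ≤ 49 * m ^ 2 * S.card ∧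
    ∑ u ∈ kept d R S, cutSum p R S σ u ^ 2 ≤ 49 * m ^ 2 * S.card ∧
    ∀ q ∈ paramNet (Fintype.card V) m,
      ∑ u ∈ kept d R S, cutSum p R S (testFun σ p 404 (900 * ε ^ 2) q S R) u ^ 2
        ≤ 1 / 10 ^ 6 * m ^ 2 * S.card

lemma squaresBound_prob {σ : V → ℝ} {d m x ε : ℝ} {p : Sym2 V → ℝ} (H : Planted σ d m p)
    (h0 : ∀ e, 0 ≤ p e) (h1 : ∀ e, p e ≤ 1) (hp : ∀ e, p e ≤ d / Fintype.card V)
    (hx : x * d = 4 * m ^ 2) (hx200 : 200 ≤ x)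
    (hε : 900 * ε ^ 2 * Real.exp (42 * 404 ^ 2 / (1 / 10 ^ 6)) ≤ 1 / 10 ^ 6 / 16) :
    (coins p).real {R | ¬ SquaresBound σ d m (Fintype.card V * Real.exp (-(13 / 100 * x))) ε p R} ≤
      (2 + (32 * Fintype.card V + 1) ^ 3) *
        Real.exp (-(Fintype.card V * Real.exp (-(13 / 100 * x)))) * (Fintype.card V + 1) := by
  have hm := H.pos
  have hd : 0 < d := by linarith [H.le]
  set k₀ := Fintype.card V * Real.exp (-(13 / 100 * x)) with hk₀
  have hσ : ∀ i, |σ i| = 1 := fun i => by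
    have := Real.sqrt_sq_eq_abs (σ i)
    rw [H.sq, Real.sqrt_one] at this; exact this.symm
  set h : Bool → Finset V → (Sym2 V → Bool) → V → ℝ := fun i _ _ => if i then fun _ => 1 else σ with hh
  -- This is the condition of the uniform bound with L = δ = 1; the constant 49 gives the norm 7m√k
  -- used later.
  have e49 : Real.exp (42 * 1 ^ 2 / 49) ≤ 49 / 16 := by
    have : Real.exp (42 * 1 ^ 2 / 49) ≤ Real.exp 1 := Real.exp_le_exp.2 (by norm_num)
    linarith [Real.exp_one_lt_d9]
  have b1 := sum_sq_cutSum_uniform h0 h1 hd hp H.card_pos (Finset.univ : Finset Bool) h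
    (fun _ _ _ _ _ => rfl) (L := 1) (δ := 1) (c := 49) (x := x) (m := m)
    (fun i S R w => by
      cases i
      · simp [hh, hσ]
      · simp [hh])
    (fun i S R => by
      have : ∀ w, h i S R w ^ 2 = 1 := fun w => by cases i <;> simp [hh, H.sq]
      simp_rw [this]
      rw [Finset.sum_const, nsmul_eq_mul, mul_one, one_mul]
      exact_mod_cast Finset.card_le_univ _)
    (by norm_num) (by linarith) hx hx200
  have b2 := sum_sq_cutSum_uniform h0 h1 hd hp H.card_pos (paramNet (Fintype.card V) m)
    (fun q S R => testFun σ p 404 (900 * ε ^ 2) q S R)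
    (fun _ _ _ _ h => testFun_congr h) (L := 404) (δ := 900 * ε ^ 2) (c := 1 / 10 ^ 6) (x := x) (m := m)
    (fun q S R w => abs_testFun_le (by norm_num) q S R w)
    (fun q S R => sum_sq_testFun_le (by positivity) q S R) (by norm_num) hε hx hx200
  rw [← hk₀] at b1 b2
  have hsub : {R | ¬ SquaresBound σ d m k₀ ε p R} ⊆
      {R | ∃ S : Finset V, k₀ ≤ S.card ∧ ∃ i ∈ (Finset.univ : Finset Bool),
        49 * m ^ 2 * S.card ≤ ∑ u ∈ kept d R S, cutSum p R S (h i S R) u ^ 2} ∪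
      {R | ∃ S : Finset V, k₀ ≤ S.card ∧ ∃ q ∈ paramNet (Fintype.card V) m,
        1 / 10 ^ 6 * m ^ 2 * S.card ≤
          ∑ u ∈ kept d R S, cutSum p R S (testFun σ p 404 (900 * ε ^ 2) q S R) u ^ 2} := by
    intro R hR
    by_contra hcon
    rw [Set.mem_union, not_or] at hcon
    obtain ⟨c1, c2⟩ := hcon
    simp only [Set.mem_ofPred_eq, not_exists, not_and, not_le] at c1 c2
    refine hR fun S hS => ⟨?_, ?_, fun q hq => (c2 S hS q hq).le⟩
    · have := (c1 S hS true (Finset.mem_univ _)).le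
      simpa [hh] using this
    · have := (c1 S hS false (Finset.mem_univ _)).le
      simpa [hh] using this
  refine (measureReal_mono hsub).trans ((measureReal_union_le _ _).trans ((add_le_add b1 b2).trans ?_))
  rw [← add_mul, ← add_mul]
  gcongr
  · simp
  · exact card_paramNet_le _ _

lemma exp_neg_le_of_le {x d : ℝ} (hx : 200 ≤ x) (hxd : x ≤ d) :
    Real.exp (-d) ≤ 1 / 100 * Real.exp (-(13 / 100 * x)) := by
  have h1 := Real.add_one_le_exp (d - 13 / 100 * x)
  have h2 : Real.exp (-(13 / 100 * x)) = Real.exp (d - 13 / 100 * x) * Real.exp (-d) := by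
    rw [← Real.exp_add]; congr 1; ring
  rw [h2]
  nlinarith [Real.exp_pos (-d)]

set_option maxHeartbeats 1000000 in
/-- Few vertices have the wrong sign in the vector used by the spectral partition. -/
theorem card_wrong_sign_lt {σ : V → ℝ} {d m x : ℝ} {p : Sym2 V → ℝ} (H : Planted σ d m p)
    (hx : x * d = 4 * m ^ 2) (hx200 : 200 ≤ x)
    {R : Sym2 V → Bool} {ε : ℝ} (hε0 : 0 ≤ ε) (hε : ε ≤ 1 / 10 ^ 6)
    (hnoise : ∀ z, l2 (noise d p R *ᵥ z) ≤ ε * m * l2 z) (hfew : FewHighDegrees d R)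
    (hsign : SignBound σ m (Fintype.card V * Real.exp (-(13 / 100 * x))) p R)
    (hsq : SquaresBound σ d m (Fintype.card V * Real.exp (-(13 / 100 * x))) ε p R)
    {W : Submodule ℝ (EuclideanSpace ℝ V)} {v : EuclideanSpace ℝ V}
    (hW : IsTopTwoEigenspace (trimmedMatrix d R) W) (hv : v ∈ W) (hv1 : ‖v‖ = 1)
    (hperp : inner ℝ (W.starProjection allOnes) v = (0 : ℝ)) :
    ∃ s : ℝ, s ^ 2 = 1 ∧ ∀ S : Finset V, (∀ u ∈ S, s * σ u * v u ≤ 0) →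
      (S.card : ℝ) < Fintype.card V * Real.exp (-(13 / 100 * x)) := by
  classical
  obtain ⟨X, Y, l₁, l₂, a₁, b₁, a₂, b₂, α, β, s, hX, hY, hv2, hα, hβ, hs, hA, hB, hA', hB'⟩ :=
    spectral_coefficients H hε0 hε hnoise hW hv hv1 hperp
  refine ⟨s, hs, fun S' hS' => ?_⟩
  by_contra hcon
  rw [not_lt] at hcon
  have hm := H.pos
  have hd : 0 < d := by linarith [H.le]
  have hN := H.card_pos'
  have hxd : x ≤ d := by
    have : x * d ≤ d * d := by rw [hx]; nlinarith [H.le]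
    exact le_of_mul_le_mul_right this hd
  set N : ℝ := (Fintype.card V : ℝ) with hNdef
  set k₀ := N * Real.exp (-(13 / 100 * x)) with hk₀
  have hk₀0 : 0 < k₀ := by positivity
  have hsN : 0 < √N := Real.sqrt_pos.2 hN
  set Sv := Finset.univ.filter fun u => s * σ u * v u ≤ 0 with hSv
  have hSv' : S' ⊆ Sv := fun u hu => Finset.mem_filter.2 ⟨Finset.mem_univ _, hS' u hu⟩
  set SX := Finset.univ.filter fun u => 400 ≤ |X u| with hSX
  set SY := Finset.univ.filter fun u => 400 ≤ |Y u| with hSY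
  -- Vertices with large entries are added so that the truncation at 404 is harmless outside `S`.
  -- They will turn out to be a small part of `S`.
  set S := Sv ∪ SX ∪ SY with hS
  have hkS : k₀ ≤ S.card := by
    refine hcon.trans ?_
    exact_mod_cast Finset.card_le_card (hSv'.trans (Finset.subset_union_left.trans
      Finset.subset_union_left))
  have hk1 : (1 : ℝ) ≤ S.card := by
    have : (0 : ℝ) < S.card := lt_of_lt_of_le hk₀0 hkS
    exact_mod_cast this
  set k : ℝ := (S.card : ℝ) with hk
  -- Both eigenvectors vanish at trimmed vertices. Because the sign condition is not strict, these
  -- vertices belong to `Sv`, so nothing outside `S` is trimmed.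
  have hvz : ∀ u, 20 * d < degree R u → v u = 0 := by
    intro u hu
    have h1 := hv2 u
    rw [hX.eq_zero hm hu, hY.eq_zero hm hu, mul_zero, mul_zero, add_zero] at h1
    exact (mul_eq_zero.1 h1).resolve_left hsN.ne'
  have hnot : ∀ u ∉ S, u ∉ Sv ∧ u ∉ SX ∧ u ∉ SY := by
    intro u hu
    simp only [hS, Finset.mem_union, not_or] at hu
    exact ⟨hu.1.1, hu.1.2, hu.2⟩
  have hSdeg : ∀ u ∉ S, degree R u ≤ 20 * d := by
    intro u hu
    by_contra hc
    apply (hnot u hu).1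
    simp only [hSv, Finset.mem_filter, Finset.mem_univ, true_and]
    rw [hvz u (not_le.1 hc), mul_zero]
  have hSX' : ∀ u ∉ S, |X u| ≤ 400 := by
    intro u hu
    by_contra hc
    exact (hnot u hu).2.1 (Finset.mem_filter.2 ⟨Finset.mem_univ _, (not_le.1 hc).le⟩)
  have hSY' : ∀ u ∉ S, |Y u| ≤ 400 := by
    intro u hu
    by_contra hc
    exact (hnot u hu).2.2 (Finset.mem_filter.2 ⟨Finset.mem_univ _, (not_le.1 hc).le⟩)
  -- The mesh 1/(8N) makes the rounding error harmless even when `S` is a single vertex, and the net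
  -- still has polynomial size. A net is needed because l, a and b depend on the whole graph.
  have hη : 8 * (1 / (8 * N)) * √N ≤ √k := by
    have h1 : 1 ≤ √k := Real.one_le_sqrt.2 hk1
    have hN1 : 1 ≤ √N := Real.one_le_sqrt.2 (by rw [hNdef]; exact_mod_cast H.card_pos)
    have h2 : √N * √N = N := Real.mul_self_sqrt hN.le
    have e : 8 * (1 / (8 * N)) * √N = √N / N := by field_simp
    rw [e, div_le_iff₀ hN]
    nlinarith
  have hη1 : 1 / (8 * N) ≤ 1 := by
    have hN1 : 1 ≤ N := by rw [hNdef]; exact_mod_cast H.card_pos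
    rw [div_le_one (by positivity)]; linarith
  obtain ⟨s1, s2, s3⟩ := hsq S hkS
  obtain ⟨q, hqm, hq1, hq2, hq3⟩ := exists_mem_paramNet H.card_pos hm hX.le hX.abs_a_le hX.abs_b_le
  obtain ⟨q', hqm', hq1', hq2', hq3'⟩ :=
    exists_mem_paramNet H.card_pos hm hY.le hY.abs_a_le hY.abs_b_le
  obtain ⟨x1, x2⟩ := hX.restrict H hε0 hε hnoise hSdeg hSX' hη1 hη hq1 hq2 hq3 s1 s2 (s3 q hqm)
  obtain ⟨y1, y2⟩ := hY.restrict H hε0 hε hnoise hSdeg hSY' hη1 hη hq1' hq2' hq3' s1 s2 (s3 q' hqm')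
  set G := kept d R S with hG
  set eX : V → ℝ := fun u => (noise d p R *ᵥ X) u / l₁
      - (a₁ * cutSum p R S (fun _ => 1) u + b₁ * cutSum p R S σ u) / l₁ with heX
  set eY : V → ℝ := fun u => (noise d p R *ᵥ Y) u / l₂
      - (a₂ * cutSum p R S (fun _ => 1) u + b₂ * cutSum p R S σ u) / l₂ with heY
  set A := α * a₁ / l₁ + β * a₂ / l₂ with hAdef
  set B := α * b₁ / l₁ + β * b₂ / l₂ - s / m with hBdef
  -- This is everything in √N v beyond the block term a + bσ and the leading noise (s/m) Σ_{w ∉ S}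
  -- σ_w (edge - mean). The coefficients `A` and `B` are small by `spectral_coefficients`.
  set f : V → ℝ := α • eX + β • eY + A • cutSum p R S (fun _ => 1) + B • cutSum p R S σ with hf
  have hsk : 0 ≤ √k := Real.sqrt_nonneg _
  have hk0 : 0 ≤ k := by linarith
  have hsk2 : √k ^ 2 = k := Real.sq_sqrt hk0
  have hfl2 : l2 ((G : Set V).indicator f) ≤ 5 / 1000 * √k := by
    have e : (G : Set V).indicator f = α • (G : Set V).indicator eX + β • (G : Set V).indicator eY
        + A • (G : Set V).indicator (cutSum p R S fun _ => 1)
        + B • (G : Set V).indicator (cutSum p R S σ) := by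
      ext u
      by_cases hu : u ∈ (G : Set V)
      · simp only [hf, Pi.add_apply, Pi.smul_apply, Set.indicator_of_mem hu]
      · simp [Set.indicator_of_notMem hu]
    have n1 : l2 (α • (G : Set V).indicator eX) ≤ 2 / 1000 * √k := by
      rw [l2_smul]; exact (mul_le_of_le_one_left (l2_nonneg _) hα).trans x2
    have n2 : l2 (β • (G : Set V).indicator eY) ≤ 2 / 1000 * √k := by
      rw [l2_smul]; exact (mul_le_of_le_one_left (l2_nonneg _) hβ).trans y2
    have hc : ∀ c : ℝ, |c| ≤ 64 * ε / m → ∀ z : V → ℝ, l2 ((G : Set V).indicator z) ≤ 7 * m * √k →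
        l2 (c • (G : Set V).indicator z) ≤ 448 * ε * √k := by
      intro c hc z hz
      rw [l2_smul]
      calc _ ≤ 64 * ε / m * (7 * m * √k) :=
            mul_le_mul hc hz (l2_nonneg _) ((abs_nonneg _).trans hc)
        _ = _ := by field_simp; ring
    have n3 := hc A hA' _ (l2_indicator_sqrt_le G (cutSum p R S fun _ => 1) (by norm_num) hm.le hk0
      (s1.trans_eq (by ring)))
    have n4 := hc B hB' _ (l2_indicator_sqrt_le G (cutSum p R S σ) (by norm_num) hm.le hk0
      (s2.trans_eq (by ring)))
    rw [e]
    have h5 := (l2_add_le _ _).trans (add_le_add ((l2_add_le _ _).trans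
      (add_le_add ((l2_add_le _ _).trans (add_le_add n1 n2)) n3)) n4)
    refine h5.trans ?_
    have hp5 : ε * √k ≤ 1 / 10 ^ 6 * √k := mul_le_mul_of_nonneg_right hε hsk
    linarith
  -- the exceptional sets
  have cX : (SX.card : ℝ) ≤ 1 / 100 * k := by
    refine card_le_of_l2 (z := X) (t := 400) (c := 40 * √k) (by norm_num) SX
      (fun i hi => (Finset.mem_filter.1 hi).2) ?_ (by rw [mul_pow, hsk2]; linarith)
    refine le_trans (l2_mono fun i => ?_) x1
    by_cases hi : i ∈ (SX : Set V)
    · rw [Set.indicator_of_mem hi, Set.indicator_of_mem]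
      exact Finset.mem_coe.2 (Finset.mem_union_left _ (Finset.mem_union_right _ hi))
    · rw [Set.indicator_of_notMem hi, abs_zero]; exact abs_nonneg _
  have cY : (SY.card : ℝ) ≤ 1 / 100 * k := by
    refine card_le_of_l2 (z := Y) (t := 400) (c := 40 * √k) (by norm_num) SY
      (fun i hi => (Finset.mem_filter.1 hi).2) ?_ (by rw [mul_pow, hsk2]; linarith)
    refine le_trans (l2_mono fun i => ?_) y1
    by_cases hi : i ∈ (SY : Set V)
    · rw [Set.indicator_of_mem hi, Set.indicator_of_mem]
      exact Finset.mem_coe.2 (Finset.mem_union_right _ hi)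
    · rw [Set.indicator_of_notMem hi, abs_zero]; exact abs_nonneg _
  set SF := G.filter fun u => 9 / 100 ≤ |f u| with hSF
  have cF : (SF.card : ℝ) ≤ 1 / 100 * k := by
    refine card_le_of_l2 (z := f) (t := 9 / 100) (c := 5 / 1000 * √k) (by norm_num) SF
      (fun i hi => (Finset.mem_filter.1 hi).2) ?_ (by rw [mul_pow, hsk2]; linarith)
    refine le_trans (l2_mono fun i => ?_) hfl2
    by_cases hi : i ∈ (SF : Set V)
    · rw [Set.indicator_of_mem hi, Set.indicator_of_mem]
      exact Finset.mem_coe.2 (Finset.mem_filter.1 (Finset.mem_coe.1 hi)).1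
    · rw [Set.indicator_of_notMem hi, abs_zero]; exact abs_nonneg _
  set ST := Finset.univ.filter fun u => 20 * d < degree R u with hST
  have cT : (ST.card : ℝ) ≤ 1 / 100 * k := by
    have h1 := hfew ST fun u hu => by
      have := (Finset.mem_filter.1 hu).2
      linarith
    have h2 := exp_neg_le_of_le hx200 hxd
    have h3 : N * Real.exp (-d) ≤ N * (1 / 100 * Real.exp (-(13 / 100 * x))) := by gcongr
    have h4 : N * (1 / 100 * Real.exp (-(13 / 100 * x))) = 1 / 100 * k₀ := by rw [hk₀]; ring
    linarith
  -- Four exceptional sets of at most k/100 each are removed, leaving 96 percent of `S`. The sign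
  -- bound allows fewer than 95 percent.
  set J := S \ (SX ∪ SY ∪ SF ∪ ST) with hJ
  have hJcard : 96 / 100 * k ≤ J.card := by
    have h1 : S.card ≤ J.card + (SX ∪ SY ∪ SF ∪ ST).card := by
      rw [hJ]; exact Nat.le_add_of_sub_le (Finset.le_card_sdiff _ _)
    have h2 : (SX ∪ SY ∪ SF ∪ ST).card ≤ SX.card + SY.card + SF.card + ST.card :=
      (Finset.card_union_le _ _).trans (Nat.add_le_add_right ((Finset.card_union_le _ _).trans
        (Nat.add_le_add_right (Finset.card_union_le _ _) _)) _)
    have h3 : k ≤ J.card + (SX.card + SY.card + SF.card + ST.card : ℝ) := by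
      rw [hk]; exact_mod_cast h1.trans (Nat.add_le_add_left h2 _)
    linarith
  have hJs : ∀ u ∈ J, σ u * cutSum p R S σ u ≤ -(9 / 10 * m) := by
    intro u hu
    rw [hJ, Finset.mem_sdiff] at hu
    obtain ⟨huS, hu⟩ := hu
    simp only [Finset.mem_union, not_or] at hu
    obtain ⟨⟨⟨hu1, hu2⟩, hu3⟩, hu4⟩ := hu
    have huv : s * σ u * v u ≤ 0 := by
      simp only [hS, Finset.mem_union] at huS
      have : u ∈ Sv := by tauto
      exact (Finset.mem_filter.1 this).2
    have huG : u ∈ G := by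
      refine Finset.mem_filter.2 ⟨huS, ?_⟩
      by_contra hc
      exact hu4 (Finset.mem_filter.2 ⟨Finset.mem_univ _, not_le.1 hc⟩)
    have hfu : |f u| ≤ 9 / 100 := by
      by_contra hc
      exact hu3 (Finset.mem_filter.2 ⟨huG, (not_le.1 hc).le⟩)
    have hvu : √N * v u = (α * a₁ + β * a₂) + (α * b₁ + β * b₂) * σ u + f u
        + s / m * cutSum p R S σ u := by
      rw [hv2 u, hX.decomp u, hY.decomp u]
      simp only [hf, heX, heY, hAdef, hBdef, Pi.add_apply, Pi.smul_apply, smul_eq_mul]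
      ring
    have hneg : s * σ u * (√N * v u) ≤ 0 := by
      rw [show s * σ u * (√N * v u) = √N * (s * σ u * v u) by ring]
      exact mul_nonpos_of_nonneg_of_nonpos hsN.le huv
    set a := α * a₁ + β * a₂ with hadef
    set b := α * b₁ + β * b₂ with hbdef
    set z := cutSum p R S σ u with hz
    have hsσ : |s * σ u| = 1 := by
      have := Real.sqrt_sq_eq_abs (s * σ u)
      rw [mul_pow, hs, H.sq, mul_one, Real.sqrt_one] at this; exact this.symm
    have e1 : s * σ u * (√N * v u) = s * σ u * (a + f u) + (1 + s * (b - s)) + σ u * z / m := by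
      rw [hvu]
      linear_combination (s * b) * H.sq u + (σ u * z / m) * hs + hs
    have t1 : |s * σ u * (a + f u)| ≤ 4 * ε + 9 / 100 := by
      rw [abs_mul, hsσ, one_mul]
      exact (abs_add_le _ _).trans (add_le_add hA hfu)
    have hsabs : |s| = 1 := by
      have := Real.sqrt_sq_eq_abs s
      rw [hs, Real.sqrt_one] at this; exact this.symm
    have t2 : |s * (b - s)| ≤ 8 * ε := by rw [abs_mul, hsabs, one_mul]; exact hB
    rw [e1] at hneg
    have h3 : σ u * z / m ≤ -(9 / 10) := by linarith [(abs_le.1 t1).1, (abs_le.1 t2).1]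
    rw [div_le_iff₀ hm] at h3
    linarith
  have := hsign S hkS J Finset.sdiff_subset hJs
  linarith

end BlockModel

namespace BlockModel

variable {V : Type*} [Fintype V]

/-! ### From the wrong signs to the spectral partition -/

lemma Planted.card_pos_sign {σ : V → ℝ} {d m : ℝ} {p : Sym2 V → ℝ} (H : Planted σ d m p) {s : ℝ}
    (hs : s ^ 2 = 1) : 2 * (Finset.univ.filter fun u => 0 < s * σ u).card = Fintype.card V := by
  have h1 : ∀ u, s * σ u = (if 0 < s * σ u then 2 else 0) - 1 := by
    intro u
    have h2 : (s * σ u) ^ 2 = 1 := by rw [mul_pow, hs, H.sq, one_mul]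
    rcases sq_eq_one_iff.1 h2 with h | h
    · rw [h]; norm_num
    · rw [h]; norm_num
  have h3 : ∑ u, s * σ u = 0 := by rw [← Finset.mul_sum, H.sum_eq_zero, mul_zero]
  rw [Finset.sum_congr rfl fun u _ => h1 u, Finset.sum_sub_distrib, ← Finset.sum_filter] at h3
  simp only [Finset.sum_const, nsmul_eq_mul, Finset.card_univ, mul_one] at h3
  have h4 : ((2 * (Finset.univ.filter fun u => 0 < s * σ u).card : ℕ) : ℝ) = Fintype.card V := by
    push_cast; linarith
  exact_mod_cast h4

lemma Planted.sign_cases {σ : V → ℝ} {d m : ℝ} {p : Sym2 V → ℝ} (H : Planted σ d m p) {s : ℝ}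
    (hs : s ^ 2 = 1) (u : V) : s * σ u = 1 ∨ s * σ u = -1 := by
  apply sq_eq_one_iff.1
  rw [mul_pow, hs, H.sq, one_mul]

variable [DecidableEq V]

/-- If few vertices have the wrong sign in `v`, then few vertices are misclassified. -/
lemma misclassified_lt {σ : V → ℝ} {d m : ℝ} {p : Sym2 V → ℝ} (H : Planted σ d m p) {s k₀ : ℝ}
    (hs : s ^ 2 = 1) {v : V → ℝ}
    (hsmall : ∀ S : Finset V, (∀ u ∈ S, s * σ u * v u ≤ 0) → (S.card : ℝ) < k₀) {T : Finset V}
    (hT : 2 * T.card = Fintype.card V) (hv : ∀ u ∈ T, ∀ w ∉ T, v w ≤ v u) :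
    ((T.filter fun u => s * σ u < 0).card : ℝ) < k₀ ∧
      ((Tᶜ.filter fun u => 0 < s * σ u).card : ℝ) < k₀ := by
  have hsign := H.sign_cases hs
  have hP := H.card_pos_sign hs
  have e1 : (T.filter fun u => s * σ u < 0).card + (T.filter fun u => 0 < s * σ u).card = T.card := by
    rw [← Finset.card_filter_add_card_filter_not (s := T) fun u => s * σ u < 0]
    congr 2
    ext u
    simp only [Finset.mem_filter, not_lt, and_congr_right_iff]
    intro _
    rcases hsign u with h | h <;> rw [h] <;> norm_num
  have e2 : (Tᶜ.filter fun u => 0 < s * σ u).card + (T.filter fun u => 0 < s * σ u).card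
      = (Finset.univ.filter fun u => 0 < s * σ u).card := by
    rw [← Finset.card_union_of_disjoint]
    · congr 1
      ext u
      simp only [Finset.mem_union, Finset.mem_filter, Finset.mem_compl, Finset.mem_univ, true_and]
      tauto
    · rw [Finset.disjoint_left]
      intro u hu hu'
      exact (Finset.mem_compl.1 (Finset.mem_filter.1 hu).1) (Finset.mem_filter.1 hu').1
  -- Since T and the true block both have half of the vertices, the two kinds of error are equally
  -- many, so it suffices to bound one kind.
  have e3 : (T.filter fun u => s * σ u < 0).card = (Tᶜ.filter fun u => 0 < s * σ u).card := by omega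
  -- If some value outside T is positive, all values on T are positive. Otherwise all values outside
  -- T are at most 0. In either case one kind of error consists of vertices with the wrong sign.
  by_cases h : ∃ w, w ∉ T ∧ 0 < v w
  · obtain ⟨w, hw, hvw⟩ := h
    have : ((T.filter fun u => s * σ u < 0).card : ℝ) < k₀ := hsmall _ fun u hu => by
      obtain ⟨huT, hu⟩ := Finset.mem_filter.1 hu
      have := hv u huT w hw
      exact mul_nonpos_of_nonpos_of_nonneg hu.le (by linarith)
    exact ⟨this, by rw [← e3]; exact this⟩
  · push Not at h
    have : ((Tᶜ.filter fun u => 0 < s * σ u).card : ℝ) < k₀ := hsmall _ fun u hu => by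
      obtain ⟨huT, hu⟩ := Finset.mem_filter.1 hu
      exact mul_nonpos_of_nonneg_of_nonpos hu.le (h u (Finset.mem_compl.1 huT))
    exact ⟨by rw [e3]; exact this, this⟩

/-! ### The correction stage -/

/-- The Chernoff exponent for a deviation from the mean `μ` to `K`. -/
lemma chernoff_exponent_le {K μ : ℝ} (hμ : 0 < μ) (hμK : μ ≤ K) :
    μ * (Real.exp (Real.log (K / μ)) - 1) - Real.log (K / μ) * K ≤ -((K - μ) ^ 2 / (2 * K)) := by
  have hK : 0 < K := hμ.trans_le hμK
  rw [Real.exp_log (by positivity)]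
  -- The inequality log(1 + t) ≥ 2t/(t + 2) gives the exponent (K - μ)²/(K + μ), and K + μ ≤ 2K.
  have h := Real.le_log_one_add_of_nonneg (x := (K - μ) / μ) (div_nonneg (by linarith) hμ.le)
  have e1 : 1 + (K - μ) / μ = K / μ := by field_simp; ring
  have e2 : 2 * ((K - μ) / μ) / ((K - μ) / μ + 2) = 2 * (K - μ) / (K + μ) := by
    have : (K - μ) / μ + 2 = (K + μ) / μ := by field_simp; ring
    rw [this]; field_simp
  rw [e1, e2] at h
  have h2 : 2 * (K - μ) / (K + μ) * K ≤ Real.log (K / μ) * K := by gcongr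
  have e3 : μ * (K / μ - 1) = K - μ := by field_simp
  rw [e3]
  have h3 : K - μ - 2 * (K - μ) / (K + μ) * K ≤ -((K - μ) ^ 2 / (2 * K)) := by
    have e4 : K - μ - 2 * (K - μ) / (K + μ) * K = -((K - μ) ^ 2 / (K + μ)) := by
      field_simp; ring
    rw [e4, neg_le_neg_iff]
    apply div_le_div_of_nonneg_left (sq_nonneg _) (by positivity) (by linarith)
  linarith

/-- All vertices of a given set being bad, for a given partition with few errors, is unlikely. -/
lemma bad_prob {σ : V → ℝ} {d m κ : ℝ} {p : Sym2 V → ℝ} (H : Planted σ d m p)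
    (h0 : ∀ e, 0 ≤ p e) (h1 : ∀ e, p e ≤ 1) (hκ0 : 0 < κ) (hκ : κ ≤ 1 / 8) {c : ℝ}
    (hc : c ^ 2 = 1) {T : Finset V} (hT : 2 * T.card = Fintype.card V)
    (hB : ((Tᶜ.filter fun u => 0 < c * σ u).card : ℝ) ≤ Fintype.card V * κ) {J : Finset V}
    (hJT : J ⊆ T) (hJ : ∀ u ∈ J, 0 < c * σ u) :
    (coins p).real {R | ∀ u ∈ J, d / 4 ≤ ∑ w ∈ Tᶜ, edge R u w} ≤
      Real.exp (-(m ^ 2 / (2 * d) * (1 - 4 * κ) ^ 2 * J.card)) := by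
  have hm := H.pos
  have hd : 0 < d := by linarith [H.le]
  have hN := H.card_pos'
  have hsign := H.sign_cases hc
  set N : ℝ := (Fintype.card V : ℝ) with hNdef
  set K := d / 4 with hK
  -- This bounds the expected number of neighbours across: d/4 - m/2 for a perfect bisection, plus
  -- the effect of at most κN misplaced vertices in the other part.
  set μ := d / 4 - m / 2 * (1 - 4 * κ) with hμ
  have hμ0 : 0 < μ := by rw [hμ]; nlinarith [H.le]
  have hμK : μ ≤ K := by rw [hμ, hK]; nlinarith
  set θ := Real.log (K / μ) with hθ
  have hθ0 : 0 ≤ θ := Real.log_nonneg (by rw [le_div_iff₀ hμ0]; linarith)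
  have hTc : (2 : ℝ) * (Tᶜ.card : ℝ) = N := by
    have : 2 * Tᶜ.card = Fintype.card V := by rw [Finset.card_compl]; omega
    rw [hNdef]; exact_mod_cast this
  set M : V → ℝ := fun u => ∑ w ∈ Tᶜ, p s(u, w) with hM
  have hMμ : ∀ u ∈ J, M u ≤ μ := by
    intro u hu
    have hu1 : c * σ u = 1 := (hsign u).resolve_right fun h => by
      have := hJ u hu; rw [h] at this; linarith
    have e : M u = d / (2 * N) * Tᶜ.card + m / N * ∑ w ∈ Tᶜ, c * σ w := by
      simp only [hM, H.mean]
      rw [Finset.sum_add_distrib, Finset.sum_const, nsmul_eq_mul, ← Finset.mul_sum, mul_comm]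
      congr 2
      refine Finset.sum_congr rfl fun w _ => ?_
      linear_combination (c * σ w) * hu1 - (σ u * σ w) * hc
    have h2 : ∑ w ∈ Tᶜ, c * σ w ≤ 2 * (N * κ) - Tᶜ.card := by
      have h3 : ∀ w ∈ Tᶜ, c * σ w ≤ (if 0 < c * σ w then 2 else 0) - 1 := by
        intro w _
        rcases hsign w with h | h <;> rw [h] <;> norm_num
      refine (Finset.sum_le_sum h3).trans ?_
      rw [Finset.sum_sub_distrib, ← Finset.sum_filter]
      simp only [Finset.sum_const, nsmul_eq_mul, mul_one]
      linarith
    rw [e]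
    have hTc' : (Tᶜ.card : ℝ) = N / 2 := by linarith
    have hmN : 0 < m / N := by positivity
    have h4 := mul_le_mul_of_nonneg_left h2 hmN.le
    have e2 : d / (2 * N) * Tᶜ.card = d / 4 := by rw [hTc']; field_simp; ring
    have e3 : m / N * (2 * (N * κ) - Tᶜ.card) = -(m / 2 * (1 - 4 * κ)) := by
      rw [hTc']; field_simp; ring
    rw [e2, hμ]
    linarith
  have hM0 : ∀ u, 0 ≤ M u := fun u => Finset.sum_nonneg fun w _ => h0 _
  have hsubT : Tᶜ ⊆ Jᶜ := Finset.compl_subset_compl.2 hJT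
  have hsum : ∀ f : V → ℝ, ∑ w ∈ Jᶜ, (if w ∈ Tᶜ then f w else 0) = ∑ w ∈ Tᶜ, f w := fun f => by
    rw [Finset.sum_ite_mem, Finset.inter_eq_right.2 hsubT]
  -- The sum runs over edges leaving `J` only, so every pair is seen once and the vertices of `J`
  -- contribute independent exponents.
  have hchern := cut_chernoff h0 h1 J (fun _ => θ) (fun _ w => if w ∈ Tᶜ then 1 else 0)
    (fun _ _ _ => rfl) (K := ∑ u ∈ J, M u * expRem θ) (fun _ => by
      refine Finset.sum_le_sum fun u _ => ?_
      rw [hM, Finset.sum_mul, ← hsum]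
      refine Finset.sum_le_sum fun w _ => ?_
      by_cases hw : w ∈ Tᶜ
      · rw [if_pos hw, if_pos hw, mul_one]
      · rw [if_neg hw, if_neg hw, mul_zero, expRem_zero, mul_zero]) (∑ u ∈ J, θ * (K - M u))
  refine (measureReal_mono fun R hR => ?_).trans (hchern.trans ?_)
  · have hR' : ∀ u ∈ J, K ≤ ∑ w ∈ Tᶜ, edge R u w := hR
    simp only [Set.mem_ofPred_eq]
    refine Finset.sum_le_sum fun u hu => mul_le_mul_of_nonneg_left ?_ hθ0
    simp only [ite_mul, one_mul, zero_mul]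
    rw [hsum fun w => edge R u w - p s(u, w), Finset.sum_sub_distrib]
    linarith [hR' u hu]
  · apply Real.exp_le_exp.2
    rw [← Finset.sum_sub_distrib]
    have hexp := chernoff_exponent_le hμ0 hμK
    rw [← hθ] at hexp
    have e5 : (K - μ) ^ 2 / (2 * K) = m ^ 2 / (2 * d) * (1 - 4 * κ) ^ 2 := by
      rw [hK, hμ]; field_simp; ring
    rw [e5] at hexp
    have hterm : ∀ u ∈ J, M u * expRem θ - θ * (K - M u) ≤ -(m ^ 2 / (2 * d) * (1 - 4 * κ) ^ 2) := by
      intro u hu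
      refine le_trans ?_ hexp
      have h2 : M u * (Real.exp θ - 1) ≤ μ * (Real.exp θ - 1) :=
        mul_le_mul_of_nonneg_right (hMμ u hu) (by linarith [Real.one_le_exp hθ0])
      unfold expRem
      linarith
    refine (Finset.sum_le_sum hterm).trans_eq ?_
    rw [Finset.sum_const, nsmul_eq_mul]; ring

/-- Every bisection with few errors has few bad vertices among the vertices that are correctly
classified. -/
def FewBad (σ : V → ℝ) (d k₀ m₀ : ℝ) (R : Sym2 V → Bool) : Prop :=
  ∀ c : ℝ, c ^ 2 = 1 → ∀ T : Finset V, 2 * T.card = Fintype.card V →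
    ((T.filter fun u => c * σ u < 0).card : ℝ) ≤ k₀ →
    ((Tᶜ.filter fun u => 0 < c * σ u).card : ℝ) ≤ k₀ → ∀ J ⊆ T, (∀ u ∈ J, 0 < c * σ u) →
    (∀ u ∈ J, d / 4 ≤ ∑ w ∈ Tᶜ, edge R u w) → (J.card : ℝ) < m₀

lemma entropy_le_of_le {N k k₀ t : ℝ} (hN : 0 < N) (ht : 0 ≤ t) (hk₀ : k₀ = N * Real.exp (-t))
    (hk0 : 0 ≤ k) (hk : k ≤ k₀) : entropy N k ≤ k₀ * (1 + t) := by
  rcases hk0.eq_or_lt with h | h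
  · rw [← h]
    have : 0 ≤ k₀ := by rw [hk₀]; positivity
    unfold entropy
    rw [zero_mul]; positivity
  · refine (entropy_mono h hk ?_).trans (entropy_le hN hk₀.ge)
    rw [hk₀]
    exact mul_le_of_le_one_right hN.le (Real.exp_le_one_iff.2 (by linarith))

/-- The entropies of the two error sets together are at most the size N exp(-0.124x) of the bad set.
The factor exp(0.006x) beats the linear factor. -/
lemma two_mul_entropy_le {N x : ℝ} (hN : 0 < N) (hx : 10 ^ 5 ≤ x) :
    2 * (N * Real.exp (-(13 / 100 * x)) * (1 + 13 / 100 * x)) ≤ N * Real.exp (-(124 / 1000 * x)) := by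
  have h := Real.quadratic_le_exp_of_nonneg (x := 6 / 1000 * x) (by linarith)
  have e : Real.exp (-(124 / 1000 * x)) = Real.exp (6 / 1000 * x) * Real.exp (-(13 / 100 * x)) := by
    rw [← Real.exp_add]; congr 1; ring
  rw [e]
  have h2 : 2 * (1 + 13 / 100 * x) ≤ Real.exp (6 / 1000 * x) := by nlinarith
  have h3 : 0 < N * Real.exp (-(13 / 100 * x)) := by positivity
  calc _ = 2 * (1 + 13 / 100 * x) * (N * Real.exp (-(13 / 100 * x))) := by ring
    _ ≤ Real.exp (6 / 1000 * x) * (N * Real.exp (-(13 / 100 * x))) := by gcongr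
    _ = _ := by ring

lemma fewBad_prob_aux {σ : V → ℝ} {d m x : ℝ} {p : Sym2 V → ℝ} (H : Planted σ d m p)
    (h0 : ∀ e, 0 ≤ p e) (h1 : ∀ e, p e ≤ 1) (hx : x * d = 4 * m ^ 2) (hx5 : 10 ^ 5 ≤ x) {c : ℝ}
    (hc : c ^ 2 = 1) :
    (coins p).real {R | ∃ A B J : Finset V, ∃ T : Finset V, 2 * T.card = Fintype.card V ∧
      (T.filter fun u => c * σ u < 0) = A ∧ (Tᶜ.filter fun u => 0 < c * σ u) = B ∧
      (A.card : ℝ) ≤ Fintype.card V * Real.exp (-(13 / 100 * x)) ∧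
      (B.card : ℝ) ≤ Fintype.card V * Real.exp (-(13 / 100 * x)) ∧ J ⊆ T ∧
      (∀ u ∈ J, 0 < c * σ u) ∧ (∀ u ∈ J, d / 4 ≤ ∑ w ∈ Tᶜ, edge R u w) ∧
      Fintype.card V * Real.exp (-(124 / 1000 * x)) ≤ (J.card : ℝ)} ≤
    (Fintype.card V + 1) ^ 3 * Real.exp (-(Fintype.card V * Real.exp (-(124 / 1000 * x)))) := by
  have hm := H.pos
  have hd : 0 < d := by linarith [H.le]
  have hN := H.card_pos'
  have hsign := H.sign_cases hc
  set N : ℝ := (Fintype.card V : ℝ) with hNdef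
  set k₀ := N * Real.exp (-(13 / 100 * x)) with hk₀
  set m₀ := N * Real.exp (-(124 / 1000 * x)) with hm₀
  have hκ : Real.exp (-(13 / 100 * x)) ≤ 1 / 10 ^ 4 := by
    rw [Real.exp_neg, inv_eq_one_div]
    apply one_div_le_one_div_of_le (by norm_num)
    have := Real.add_one_le_exp (13 / 100 * x)
    linarith
  set κ := Real.exp (-(13 / 100 * x)) with hκdef
  have hκ0 : 0 < κ := Real.exp_pos _
  set P : Finset V → Finset V → Finset V → (Sym2 V → Bool) → Prop := fun A B J R =>
    ∃ T : Finset V, 2 * T.card = Fintype.card V ∧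
      (T.filter fun u => c * σ u < 0) = A ∧ (Tᶜ.filter fun u => 0 < c * σ u) = B ∧
      (A.card : ℝ) ≤ k₀ ∧ (B.card : ℝ) ≤ k₀ ∧ J ⊆ T ∧
      (∀ u ∈ J, 0 < c * σ u) ∧ (∀ u ∈ J, d / 4 ≤ ∑ w ∈ Tᶜ, edge R u w) ∧
      m₀ ≤ (J.card : ℝ) with hP
  -- the bisection is determined by its errors
  have huniq : ∀ T T' : Finset V, (T.filter fun u => c * σ u < 0) = (T'.filter fun u => c * σ u < 0) →
      (Tᶜ.filter fun u => 0 < c * σ u) = (T'ᶜ.filter fun u => 0 < c * σ u) → T = T' := by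
    intro T T' hA hB
    ext u
    have e1 := congrArg (u ∈ ·) hA
    have e2 := congrArg (u ∈ ·) hB
    simp only [Finset.mem_filter, Finset.mem_compl, eq_iff_iff] at e1 e2
    rcases hsign u with h | h <;> rw [h] at e1 e2 <;> norm_num at e1 e2 <;> tauto
  have hJ : ∀ A B J, (coins p).real {R | P A B J R} ≤
      Real.exp (-(2 * m₀)) * Real.exp (-entropy N J.card) := by
    intro A B J
    by_cases hT : ∃ T : Finset V, 2 * T.card = Fintype.card V ∧
      (T.filter fun u => c * σ u < 0) = A ∧ (Tᶜ.filter fun u => 0 < c * σ u) = B ∧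
      (A.card : ℝ) ≤ k₀ ∧ (B.card : ℝ) ≤ k₀ ∧ J ⊆ T ∧
      (∀ u ∈ J, 0 < c * σ u) ∧ m₀ ≤ (J.card : ℝ)
    swap
    · have : {R : Sym2 V → Bool | P A B J R} = ∅ := by
        ext R
        simp only [Set.mem_ofPred_eq, Set.mem_empty_iff_false, iff_false]
        rintro ⟨T, t1, t2, t3, t4, t5, t6, t7, -, t8⟩
        exact hT ⟨T, t1, t2, t3, t4, t5, t6, t7, t8⟩
      rw [this, measureReal_empty]; positivity
    obtain ⟨T, t1, t2, t3, t4, t5, t6, t7, t8⟩ := hT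
    have hb := bad_prob H h0 h1 hκ0 (hκ.trans (by norm_num)) hc t1 (by rw [t3]; exact t5) t6 t7
    refine (measureReal_mono fun R hR => ?_).trans (hb.trans ?_)
    · obtain ⟨T', r1, r2, r3, r4, r5, r6, r7, r8, r9⟩ := hR
      have : T = T' := huniq T T' (t2.trans r2.symm) (t3.trans r3.symm)
      rw [this]; exact r8
    · rw [← Real.exp_add]
      apply Real.exp_le_exp.2
      have h2 := entropy_le hN t8
      have e : m ^ 2 / (2 * d) = x / 8 := by
        rw [div_eq_div_iff (by positivity) (by norm_num)]; linarith
      rw [e]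
      -- The exponent is x/8 · 0.9992 = 0.1249x per vertex, against an entropy 1 + 0.124x and 2 for
      -- the target. The margin 0.0009x is the reason for requiring x ≥ 10⁵.
      have h3 : 9992 / 10000 ≤ (1 - 4 * κ) ^ 2 := by nlinarith
      have hk0 : (0 : ℝ) ≤ J.card := Nat.cast_nonneg _
      have h4 : x / 8 * (9992 / 10000) * J.card ≤ x / 8 * (1 - 4 * κ) ^ 2 * J.card := by gcongr
      nlinarith
  have hJ' : ∀ A B, (coins p).real {R | ∃ J, P A B J R} ≤ Real.exp (-(2 * m₀)) * (N + 1) :=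
    fun A B => coins_exists_set_le p (P A B) (hJ A B)
  have hent : ∀ A : Finset V, (A.card : ℝ) ≤ k₀ → entropy N A.card ≤ k₀ * (1 + 13 / 100 * x) :=
    fun A hA => entropy_le_of_le hN (by linarith) hk₀ (Nat.cast_nonneg _) hA
  set ω := k₀ * (1 + 13 / 100 * x) with hω
  have hB : ∀ A, (coins p).real {R | ∃ B J, P A B J R} ≤
      Real.exp (-(2 * m₀)) * (N + 1) * Real.exp ω * (N + 1) := by
    intro A
    refine coins_exists_set_le p (fun B R => ∃ J, P A B J R) fun B => ?_
    by_cases hBk : (B.card : ℝ) ≤ k₀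
    · refine (hJ' A B).trans ?_
      rw [mul_assoc (Real.exp (-(2 * m₀)) * (N + 1)), ← Real.exp_add]
      refine le_mul_of_one_le_right (by positivity) (Real.one_le_exp ?_)
      linarith [hent B hBk]
    · have : {R : Sym2 V → Bool | ∃ J, P A B J R} = ∅ := by
        ext R
        simp only [Set.mem_ofPred_eq, Set.mem_empty_iff_false, iff_false]
        rintro ⟨J, T, t1, t2, t3, t4, t5, -⟩
        exact hBk t5
      rw [this, measureReal_empty]; positivity
  have hA : (coins p).real {R | ∃ A B J, P A B J R} ≤
      Real.exp (-(2 * m₀)) * (N + 1) * Real.exp ω * (N + 1) * Real.exp ω * (N + 1) := by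
    refine coins_exists_set_le p (fun A R => ∃ B J, P A B J R) fun A => ?_
    by_cases hAk : (A.card : ℝ) ≤ k₀
    · refine (hB A).trans ?_
      rw [mul_assoc (Real.exp (-(2 * m₀)) * (N + 1) * Real.exp ω * (N + 1)), ← Real.exp_add]
      refine le_mul_of_one_le_right (by positivity) (Real.one_le_exp ?_)
      linarith [hent A hAk]
    · have : {R : Sym2 V → Bool | ∃ B J, P A B J R} = ∅ := by
        ext R
        simp only [Set.mem_ofPred_eq, Set.mem_empty_iff_false, iff_false]
        rintro ⟨B, J, T, t1, t2, t3, t4, -⟩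
        exact hAk t4
      rw [this, measureReal_empty]; positivity
  refine hA.trans ?_
  -- Each of the error sets `A` and `B` costs a factor exp ω. Together they use at most one of the
  -- two factors exp(-m₀) that were kept in reserve.
  have h2 : 2 * ω ≤ m₀ := two_mul_entropy_le hN hx5
  calc _ = (N + 1) ^ 3 * Real.exp (-(2 * m₀) + ω + ω) := by
        rw [Real.exp_add, Real.exp_add]; ring
    _ ≤ _ := by
        gcongr
        linarith

lemma fewBad_prob {σ : V → ℝ} {d m x : ℝ} {p : Sym2 V → ℝ} (H : Planted σ d m p)
    (h0 : ∀ e, 0 ≤ p e) (h1 : ∀ e, p e ≤ 1) (hx : x * d = 4 * m ^ 2) (hx5 : 10 ^ 5 ≤ x) :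
    (coins p).real {R | ¬ FewBad σ d (Fintype.card V * Real.exp (-(13 / 100 * x)))
      (Fintype.card V * Real.exp (-(124 / 1000 * x))) R} ≤
    2 * ((Fintype.card V + 1) ^ 3 * Real.exp (-(Fintype.card V * Real.exp (-(124 / 1000 * x))))) := by
  have b1 := fewBad_prob_aux H h0 h1 hx hx5 (c := 1) (by norm_num)
  have b2 := fewBad_prob_aux H h0 h1 hx hx5 (c := -1) (by norm_num)
  refine (measureReal_mono (fun R hR => ?_)).trans ((measureReal_union_le _ _).trans
    ((add_le_add b1 b2).trans (by linarith)))
  have hR' : ¬ FewBad σ d (Fintype.card V * Real.exp (-(13 / 100 * x)))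
      (Fintype.card V * Real.exp (-(124 / 1000 * x))) R := hR
  unfold FewBad at hR'
  push Not at hR'
  obtain ⟨c, hc, T, t1, t2, t3, J, t4, t5, t6, t7⟩ := hR'
  rcases sq_eq_one_iff.1 hc with rfl | rfl
  · exact Or.inl ⟨_, _, J, T, t1, rfl, rfl, t2, t3, t4, t5, t6, t7⟩
  · exact Or.inr ⟨_, _, J, T, t1, rfl, rfl, t2, t3, t4, t5, t6, t7⟩

end BlockModel

namespace BlockModel

/-! ### The laws of the Red and Blue graphs -/

lemma coin_real_true {p : ℝ} (h0 : 0 ≤ p) (h1 : p ≤ 1) : (coin p).real {true} = p := by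
  unfold coin
  rw [bernoulliMeasure_real_apply_of_mem_of_notMem _ (s := {true}) (MeasurableSet.singleton _) rfl (fun h => Bool.false_ne_true h),
    Set.projIcc_of_mem _ ⟨h0, h1⟩]

lemma eq_of_real_true {μ ν : Measure Bool} [IsProbabilityMeasure μ] [IsProbabilityMeasure ν]
    (h : μ.real {true} = ν.real {true}) : μ = ν := by
  have hf : ∀ (ρ : Measure Bool) [IsProbabilityMeasure ρ], ρ.real {false} = 1 - ρ.real {true} := by
    intro ρ _
    rw [← probReal_compl_eq_one_sub (MeasurableSet.singleton _)]
    congr 1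
    ext b; cases b <;> simp
  apply Measure.ext_of_singleton
  intro b
  rw [← measureReal_eq_measureReal_iff]
  cases b
  · rw [hf μ, hf ν, h]
  · exact h

lemma map_coin_prod {p : ℝ} (h0 : 0 ≤ p) (h1 : p ≤ 1) (k : Bool) :
    ((coin p).prod (coin (1 / 2))).map (fun z => z.1 && (z.2 == k)) = coin (p / 2) := by
  have hmeas : Measurable fun z : Bool × Bool => z.1 && (z.2 == k) :=
    measurable_of_finite _
  have := Measure.isProbabilityMeasure_map (μ := (coin p).prod (coin (1 / 2))) hmeas.aemeasurable
  apply eq_of_real_true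
  rw [coin_real_true (by linarith) (by linarith), map_measureReal_apply hmeas (MeasurableSet.singleton _)]
  have : (fun z : Bool × Bool => z.1 && (z.2 == k)) ⁻¹' {true} = {true} ×ˢ {k} := by
    ext z; simp [Prod.ext_iff]
  rw [this, measureReal_prod_prod, coin_real_true h0 h1]
  have ht := coin_real_true (p := 1 / 2) (by norm_num) (by norm_num)
  cases k
  · have : ({false} : Set Bool) = {true}ᶜ := by rw [Bool.compl_singleton]; rfl
    rw [this, probReal_compl_eq_one_sub (MeasurableSet.singleton _), ht]; ring
  · rw [ht]; ring

/-- The edges of colour `k`. -/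
def colourPart {E : Type*} (k : Bool) (ω : (E → Bool) × (E → Bool)) : E → Bool :=
  fun e => ω.1 e && (ω.2 e == k)

lemma map_colourPart {E : Type*} [Fintype E] {p : E → ℝ} (h0 : ∀ e, 0 ≤ p e) (h1 : ∀ e, p e ≤ 1)
    (k : Bool) : ((coins p).prod (coins fun _ => 1 / 2)).map (colourPart k) =
      coins fun e => p e / 2 := by
  have h := measurePreserving_arrowProdEquivProdArrow Bool Bool E (fun e => coin (p e))
    (fun _ => coin (1 / 2))
  have hm : Measurable (colourPart k : (E → Bool) × (E → Bool) → E → Bool) :=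
    measurable_of_finite _
  unfold coins
  rw [← h.map_eq, Measure.map_map hm h.measurable]
  have hf : ∀ e : E, ((coin (p e)).prod (coin (1 / 2))).map (fun z => z.1 && (z.2 == k))
      = coin (p e / 2) := fun e => map_coin_prod (h0 e) (h1 e) k
  rw [← funext hf]
  have : ∀ e : E, IsProbabilityMeasure
      (((coin (p e)).prod (coin (1 / 2))).map (fun z => z.1 && (z.2 == k))) :=
    fun e => by rw [hf e]; infer_instance
  rw [← Measure.pi_map_pi fun e => (measurable_of_finite _).aemeasurable]
  rfl

/-- Only the two marginal laws are needed, because the failure probabilities of the Red and the Blue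
properties are simply added. -/
lemma real_colourPart {E : Type*} [Fintype E] {p : E → ℝ} (h0 : ∀ e, 0 ≤ p e) (h1 : ∀ e, p e ≤ 1)
    (k : Bool) (S : Set (E → Bool)) :
    ((coins p).prod (coins fun _ => 1 / 2)).real {ω | colourPart k ω ∈ S} =
      (coins fun e => p e / 2).real S := by
  rw [← map_colourPart h0 h1 k, map_measureReal_apply (measurable_of_finite _)
    (Set.toFinite S).measurableSet]
  rfl

/-! ### The graphs of edge indicators -/

section Graph

variable {V : Type*}

lemma colourClass_eq (ω : (Sym2 V → Bool) × (Sym2 V → Bool)) (k : Bool) :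
    colourClass (graphOf ω.1) ω.2 k = graphOf (colourPart k ω) := by
  ext u v
  simp only [colourClass, graphOf, SimpleGraph.fromEdgeSet_adj, colourPart,
    SimpleGraph.mem_edgeSet, Set.mem_ofPred_eq, Bool.and_eq_true, beq_iff_eq]
  tauto

lemma graphOf_adj (R : Sym2 V → Bool) (u v : V) :
    (graphOf R).Adj u v ↔ R s(u, v) = true ∧ u ≠ v := by
  simp [graphOf]

open scoped Classical in
lemma edge_eq_ite (R : Sym2 V → Bool) (u v : V) :
    edge R u v = if (graphOf R).Adj u v then 1 else 0 := by
  rw [edge, graphOf_adj]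
  by_cases h : u = v
  · simp [h]
  · cases hR : R s(u, v) <;> simp [h]

lemma sum_edge_eq_ncard (R : Sym2 V → Bool) (u : V) (T : Finset V) :
    ∑ w ∈ T, edge R u w = (((graphOf R).neighborSet u ∩ T).ncard : ℝ) := by
  classical
  have : (graphOf R).neighborSet u ∩ T = (T.filter fun w => (graphOf R).Adj u w : Finset V) := by
    ext w; simp [and_comm]
  rw [this, Set.ncard_coe_finset, Finset.card_filter]
  push_cast
  exact Finset.sum_congr rfl fun w _ => edge_eq_ite R u w

variable [Fintype V]

lemma degree_eq_ncard (R : Sym2 V → Bool) (u : V) :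
    degree R u = (((graphOf R).neighborSet u).ncard : ℝ) := by
  rw [degree, sum_edge_eq_ncard, Finset.coe_univ, Set.inter_univ]

lemma trimmed_graphOf (R : Sym2 V → Bool) (d : ℝ) : trimmed (graphOf R) d = trimmedMatrix d R := by
  ext u v
  simp only [trimmed, trimmedMatrix, trimmedEdge, degree_eq_ncard, edge_eq_ite]

end Graph

/-! ### The algorithm has an output -/

section Existence

variable {V : Type*} [Fintype V]

/-- One linear condition on a plane has a nonzero solution, which is then normalised. -/
lemma exists_unit_orthogonal {A : Matrix V V ℝ} {W : Submodule ℝ (EuclideanSpace ℝ V)}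
    (hW : IsTopTwoEigenspace A W) (q : EuclideanSpace ℝ V) :
    ∃ v ∈ W, ‖v‖ = 1 ∧ inner ℝ q v = (0 : ℝ) := by
  obtain ⟨x, y, -, -, hxy, -, -, -, rfl, -⟩ := hW
  obtain ⟨s, t, hst, h0⟩ : ∃ s t : ℝ, s * inner ℝ q x + t * inner ℝ q y = 0 ∧ (s ≠ 0 ∨ t ≠ 0) := by
    by_cases h : inner ℝ q x = (0 : ℝ)
    · exact ⟨1, 0, by rw [h]; ring, Or.inl one_ne_zero⟩
    · exact ⟨-inner ℝ q y, inner ℝ q x, by ring, Or.inr h⟩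
  have hmem : s • x + t • y ∈ Submodule.span ℝ {x, y} :=
    Submodule.mem_span_pair.2 ⟨s, t, rfl⟩
  have hne : s • x + t • y ≠ 0 := by
    intro h
    have := LinearIndependent.pair_iff.1 hxy.linearIndependent s t h
    tauto
  refine ⟨‖s • x + t • y‖⁻¹ • (s • x + t • y), Submodule.smul_mem _ _ hmem, ?_, ?_⟩
  · rw [norm_smul, norm_inv, norm_norm, inv_mul_cancel₀ (norm_ne_zero_iff.2 hne)]
  · rw [inner_smul_right, inner_add_right, inner_smul_right, inner_smul_right, hst, mul_zero]

variable [DecidableEq V]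

/-- Take the eigenbasis vectors of the largest and the next eigenvalue. Any eigenvector orthogonal
to both has a nonzero coordinate at a third index, and symmetry identifies its eigenvalue with the
one at that index. -/
lemma exists_isTopTwoEigenspace {A : Matrix V V ℝ} (hA : A.IsHermitian) (hV : 2 ≤ Fintype.card V) :
    ∃ W, IsTopTwoEigenspace A W := by
  obtain ⟨i, -, hi⟩ := Finset.exists_max_image (Finset.univ : Finset V) hA.eigenvalues
    (Finset.card_pos.1 (by rw [Finset.card_univ]; omega))
  obtain ⟨j, hj, hjmax⟩ := Finset.exists_max_image (Finset.univ.erase i) hA.eigenvalues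
    (Finset.card_pos.1 (by
      rw [Finset.card_erase_of_mem (Finset.mem_univ i), Finset.card_univ]; omega))
  have hji : j ≠ i := Finset.ne_of_mem_erase hj
  set b := hA.eigenvectorBasis with hb
  have hmul : ∀ k, A.mulVec (b k).ofLp = hA.eigenvalues k • (b k).ofLp := hA.mulVec_eigenvectorBasis
  refine ⟨Submodule.span ℝ {b i, b j}, b i, b j, hA.eigenvalues i, hA.eigenvalues j, ?_, hmul i,
    hmul j, hi j (Finset.mem_univ j), rfl, ?_⟩
  · have := b.orthonormal.comp ![i, j] (by
      intro k l hkl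
      fin_cases k <;> fin_cases l <;> simp_all)
    have e : ![b i, b j] = b ∘ ![i, j] := by
      funext k
      fin_cases k <;> rfl
    rw [e]
    exact this
  · intro z l hz hz0 hzl
    obtain ⟨k, hk⟩ : ∃ k, inner ℝ (b k) z ≠ 0 := by
      by_contra! h
      rw [← b.sum_repr' z] at hz0
      exact hz0 (Finset.sum_eq_zero fun k _ => by rw [h k, zero_smul])
    have horth : ∀ y ∈ ({b i, b j} : Set (EuclideanSpace ℝ V)), inner ℝ y z = 0 := fun y hy =>
      Submodule.inner_right_of_mem_orthogonal (Submodule.subset_span hy) hz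
    have hki : k ≠ i := fun h => hk (h ▸ horth _ (by simp))
    have hkj : k ≠ j := fun h => hk (h ▸ horth _ (by simp))
    have hsymm : inner ℝ (b k) (WithLp.toLp 2 (A.mulVec z.ofLp) : EuclideanSpace ℝ V)
        = inner ℝ (WithLp.toLp 2 (A.mulVec (b k).ofLp) : EuclideanSpace ℝ V) z := by
      have hT : A.transpose = A := hA
      simp only [EuclideanSpace.inner_eq_star_dotProduct, star_trivial]
      rw [dotProduct_comm, Matrix.dotProduct_mulVec, ← Matrix.mulVec_transpose, hT,
        dotProduct_comm]
    rw [hzl, hmul, WithLp.toLp_smul, WithLp.toLp_smul, inner_smul_left, inner_smul_right] at hsymm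
    have : l = hA.eigenvalues k := mul_right_cancel₀ hk hsymm
    rw [this]
    exact hjmax k (Finset.mem_erase.2 ⟨hki, Finset.mem_univ k⟩)

lemma exists_top_values (f : V → ℝ) {k : ℕ} (hk : k ≤ Fintype.card V) :
    ∃ T : Finset V, T.card = k ∧ ∀ u ∈ T, ∀ w ∉ T, f w ≤ f u := by
  induction k with
  | zero => exact ⟨∅, rfl, by simp⟩
  | succ k ih =>
    obtain ⟨T, hT, h⟩ := ih (by omega)
    obtain ⟨i, hi, hmax⟩ := Finset.exists_max_image Tᶜ f
      (Finset.card_pos.1 (by rw [Finset.card_compl]; omega))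
    rw [Finset.mem_compl] at hi
    refine ⟨insert i T, by rw [Finset.card_insert_of_notMem hi, hT], fun u hu w hw => ?_⟩
    rw [Finset.mem_insert, not_or] at hw
    rcases Finset.mem_insert.1 hu with rfl | hu
    · exact hmax w (Finset.mem_compl.2 hw.2)
    · exact h u hu w hw.2

lemma exists_isPartitionOutput {n : ℕ} (hn : 1 ≤ n) (a b : ℝ)
    (ω : (Sym2 (Vertex n) → Bool) × (Sym2 (Vertex n) → Bool)) :
    ∃ U₁ U₂, IsPartitionOutput (graphOf ω.1) a b ω.2 U₁ U₂ := by
  have hV : Fintype.card (Vertex n) = 2 * n := by simp [two_mul]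
  obtain ⟨W, hW⟩ := exists_isTopTwoEigenspace
    (trimmedMatrix_isHermitian (a + b) (colourPart true ω)) (by omega)
  obtain ⟨v, hvW, hv1, hv⟩ := exists_unit_orthogonal hW (W.starProjection allOnes)
  obtain ⟨T, hT, htop⟩ := exists_top_values v (k := n) (by omega)
  refine ⟨_, _, T, (T : Set (Vertex n))ᶜ, ⟨W, v, ?_, hvW, hv1, hv, rfl, ?_, ?_⟩, rfl, rfl⟩
  · rw [colourClass_eq, trimmed_graphOf]; exact hW
  · rw [Set.ncard_coe_finset, hT, hV]
  · exact fun u hu w hw => htop u hu w hw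

end Existence

end BlockModel

namespace BlockModel

/-! ### The output is correct -/

lemma NormBound.l2_noise_le {V : Type*} [Fintype V] {D : ℝ} {p : Sym2 V → ℝ} {R : Sym2 V → Bool}
    (h : NormBound D p R) (z : V → ℝ) : l2 ((noise D p R).mulVec z) ≤ 17000 * √D * l2 z :=
  l2_mulVec_le (noise_symm D p R) h z

section Corrected

variable {V : Type*}

lemma corrected_union_compl (B : SimpleGraph V) (θ : ℝ) (U : Set V) :
    corrected B θ U Uᶜ ∪ corrected B θ Uᶜ U = Set.univ := by
  ext u
  simp only [corrected, bad, Set.mem_union, Set.mem_sdiff, Set.mem_ofPred_eq, Set.mem_compl_iff,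
    Set.mem_univ, iff_true]
  tauto

lemma corrected_disjoint_compl (B : SimpleGraph V) (θ : ℝ) (U : Set V) :
    Disjoint (corrected B θ U Uᶜ) (corrected B θ Uᶜ U) := by
  rw [Set.disjoint_left]
  intro u
  simp only [corrected, bad, Set.mem_union, Set.mem_sdiff, Set.mem_ofPred_eq, Set.mem_compl_iff]
  tauto

variable [Fintype V] [DecidableEq V]

/-- A vertex of the block can be lost only by being bad though correctly placed, or by starting in
the wrong part. Rescues by the correction are ignored. -/
lemma le_ncard_inter_corrected {σ : V → ℝ} {d m k₀ m₀ : ℝ} {p : Sym2 V → ℝ} (H : Planted σ d m p)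
    {R : Sym2 V → Bool} (hbad : FewBad σ d k₀ m₀ R) {c : ℝ} (hc : c ^ 2 = 1) {T : Finset V}
    (hT : 2 * T.card = Fintype.card V) (hA : ((T.filter fun u => c * σ u < 0).card : ℝ) ≤ k₀)
    (hB : ((Tᶜ.filter fun u => 0 < c * σ u).card : ℝ) ≤ k₀) :
    Fintype.card V / 2 - (m₀ + k₀) ≤
      (({u | 0 < c * σ u} ∩ corrected (graphOf R) (d / 4) T (T : Set V)ᶜ).ncard : ℝ) := by
  have hP := H.card_pos_sign hc
  set P : Set V := {u | 0 < c * σ u} with hPdef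
  set U := corrected (graphOf R) (d / 4) T (T : Set V)ᶜ with hU
  have hPcard : (P.ncard : ℝ) = Fintype.card V / 2 := by
    have : P = ((Finset.univ.filter fun u => 0 < c * σ u : Finset V) : Set V) := by
      ext u; simp [hPdef]
    rw [this, Set.ncard_coe_finset, ← hP]
    push_cast; ring
  have hsplit : ((P ∩ U).ncard : ℝ) + ((P \ U).ncard : ℝ) = P.ncard := by
    exact_mod_cast Set.ncard_inter_add_ncard_sdiff_eq_ncard P U
  set J := T.filter fun u => 0 < c * σ u ∧ d / 4 ≤ ∑ w ∈ Tᶜ, edge R u w with hJ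
  have hJcard : (J.card : ℝ) < m₀ := hbad c hc T hT hA hB J (Finset.filter_subset _ _)
    (fun u hu => (Finset.mem_filter.1 hu).2.1) fun u hu => (Finset.mem_filter.1 hu).2.2
  have hsub : P \ U ⊆ ((J ∪ Tᶜ.filter fun u => 0 < c * σ u : Finset V) : Set V) := by
    rintro u ⟨hu, huU⟩
    have hu' : 0 < c * σ u := hu
    rw [Finset.mem_coe, Finset.mem_union]
    by_cases huT : u ∈ T
    · left
      rw [hJ, Finset.mem_filter]
      refine ⟨huT, hu', ?_⟩
      by_contra hlt
      refine huU (Or.inl ⟨huT, fun hb => hlt ?_⟩)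
      have := hb.2
      rwa [← Finset.coe_compl, ← sum_edge_eq_ncard] at this
    · exact Or.inr (Finset.mem_filter.2 ⟨Finset.mem_compl.2 huT, hu'⟩)
  have hcard : ((P \ U).ncard : ℝ) ≤ J.card + (Tᶜ.filter fun u => 0 < c * σ u).card := by
    have h1 := Set.ncard_le_ncard hsub (Set.toFinite _)
    rw [Set.ncard_coe_finset] at h1
    exact_mod_cast h1.trans (Finset.card_union_le _ _)
  linarith

end Corrected

/-- The planted bisection as a vector of signs. -/
def blockSign (n : ℕ) : Vertex n → ℝ := Sum.elim (fun _ => 1) fun _ => -1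

lemma block₁_eq (n : ℕ) : block₁ n = {u | 0 < 1 * blockSign n u} := by
  ext u
  rcases u with i | i <;> simp [block₁, blockSign]

lemma block₂_eq (n : ℕ) : block₂ n = {u | 0 < -1 * blockSign n u} := by
  ext u
  rcases u with i | i <;> simp [block₂, blockSign]

lemma card_vertex (n : ℕ) : (Fintype.card (Vertex n) : ℝ) = 2 * n := by
  rw [Fintype.card_sum, Fintype.card_fin]; push_cast; ring

lemma edgeProb_mk (n : ℕ) (a b : ℝ) (i j : Vertex n) :
    edgeProb n a b s(i, j) = if i.isLeft = j.isLeft then a / n else b / n := by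
  unfold edgeProb
  congr 1

lemma planted_blockSign {n : ℕ} (hn : 1 ≤ n) {a b : ℝ} (hb : 0 < b) (hab : b < a) :
    Planted (blockSign n) (a + b) ((a - b) / 2) fun e => edgeProb n a b e / 2 where
  sq i := by rcases i with i | i <;> simp [blockSign]
  sum_eq_zero := by simp [blockSign]
  mean i j := by
    have : (0 : ℝ) < n := by exact_mod_cast hn
    simp only [edgeProb_mk, card_vertex]
    rcases i with i | i <;> rcases j with j | j <;> simp [blockSign] <;> field_simp <;> ring
  pos := by linarith
  le := by linarith
  card_pos := by rw [Fintype.card_sum, Fintype.card_fin]; omega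

/-- The output is correct for good Red and Blue graphs. -/
lemma isCorrectPartition_of_bounds {n : ℕ} (hn : 1 ≤ n) {a b γ x ε : ℝ} (hb : 0 < b) (hab : b < a)
    (hx : x * (a + b) = 4 * ((a - b) / 2) ^ 2) (hx200 : 200 ≤ x) (hε0 : 0 ≤ ε)
    (hε : ε ≤ 1 / 10 ^ 6) (hεd : 17000 * √(a + b) ≤ ε * ((a - b) / 2))
    (hγ : 4 * Real.exp (-(124 / 1000 * x)) ≤ γ)
    {ω : (Sym2 (Vertex n) → Bool) × (Sym2 (Vertex n) → Bool)}
    (hnorm : NormBound (a + b) (fun e => edgeProb n a b e / 2) (colourPart true ω))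
    (hfew : FewHighDegrees (a + b) (colourPart true ω))
    (hsign : SignBound (blockSign n) ((a - b) / 2)
      (Fintype.card (Vertex n) * Real.exp (-(13 / 100 * x))) (fun e => edgeProb n a b e / 2)
      (colourPart true ω))
    (hsq : SquaresBound (blockSign n) (a + b) ((a - b) / 2)
      (Fintype.card (Vertex n) * Real.exp (-(13 / 100 * x))) ε (fun e => edgeProb n a b e / 2)
      (colourPart true ω))
    (hbad : FewBad (blockSign n) (a + b) (Fintype.card (Vertex n) * Real.exp (-(13 / 100 * x)))
      (Fintype.card (Vertex n) * Real.exp (-(124 / 1000 * x))) (colourPart false ω))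
    {U₁ U₂ : Set (Vertex n)} (hU : IsPartitionOutput (graphOf ω.1) a b ω.2 U₁ U₂) :
    IsCorrectPartition n γ U₁ U₂ := by
  have H := planted_blockSign hn hb hab
  have hnoise : ∀ z, l2 ((noise (a + b) (fun e => edgeProb n a b e / 2)
      (colourPart true ω)).mulVec z) ≤ ε * ((a - b) / 2) * l2 z := fun z =>
    (hnorm.l2_noise_le z).trans
      (mul_le_mul_of_nonneg_right hεd (l2_nonneg z))
  obtain ⟨T₁, T₂, ⟨W, v, hW, hvW, hv1, hv, rfl, hcard, htop⟩, rfl, rfl⟩ := hU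
  rw [colourClass_eq] at hW ⊢
  rw [trimmed_graphOf] at hW
  obtain ⟨s, hs, hsmall⟩ := card_wrong_sign_lt H hx hx200 hε0 hε hnoise hfew
    hsign hsq hW hvW hv1 hv
  obtain ⟨T, rfl⟩ : ∃ T : Finset (Vertex n), T₁ = (T : Set (Vertex n)) :=
    ⟨(Set.toFinite T₁).toFinset, by simp⟩
  rw [Set.ncard_coe_finset] at hcard
  obtain ⟨hA, hB⟩ := misclassified_lt H hs hsmall hcard htop
  have hcard' : 2 * Tᶜ.card = Fintype.card (Vertex n) := by rw [Finset.card_compl]; omega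
  have c1 := le_ncard_inter_corrected H hbad hs hcard hA.le hB.le
  -- The second part is the same statement for the complement and the opposite sign, so the two
  -- error sets exchange their roles.
  have c2 := le_ncard_inter_corrected H hbad (c := -s) (by rw [neg_sq, hs]) hcard'
    (by simpa using hB.le) (by simpa using hA.le)
  rw [Finset.coe_compl, compl_compl] at c2
  have hexp : Real.exp (-(13 / 100 * x)) ≤ Real.exp (-(124 / 1000 * x)) :=
    Real.exp_le_exp.2 (by linarith)
  -- The loss is at most 2N exp(-0.124x), and N = 2n turns this into 4n exp(-0.124x) ≤ γn.
  have hle : (1 - γ) * n ≤ (Fintype.card (Vertex n) : ℝ) / 2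
      - (Fintype.card (Vertex n) * Real.exp (-(124 / 1000 * x))
        + Fintype.card (Vertex n) * Real.exp (-(13 / 100 * x))) := by
    rw [card_vertex]
    have hn0 : (0 : ℝ) ≤ n := Nat.cast_nonneg _
    nlinarith [mul_le_mul_of_nonneg_left hexp hn0, mul_le_mul_of_nonneg_left hγ hn0]
  refine ⟨corrected_union_compl _ _ _, corrected_disjoint_compl _ _ _, ?_⟩
  rcases sq_eq_one_iff.1 hs with rfl | rfl
  · left
    exact ⟨by rw [block₁_eq]; exact hle.trans c1, by rw [block₂_eq]; exact hle.trans c2⟩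
  · right
    rw [neg_neg] at c2
    exact ⟨by rw [block₁_eq]; exact hle.trans c2, by rw [block₂_eq]; exact hle.trans c1⟩

/-! ### The probability of success -/

/-- An upper bound on the probability of failure, where `N` is the number of vertices. -/
noncomputable def failureBound (N d x : ℝ) : ℝ :=
  ((Real.exp (-(N * Real.exp (-d))) * (N + 1) + 8 / N + 2 * Real.exp (-N)) +
    Real.exp (-(N * Real.exp (-d))) * (N + 1) +
    Real.exp (-(N * Real.exp (-(13 / 100 * x)))) * (N + 1) +
    (2 + (32 * N + 1) ^ 3) * Real.exp (-(N * Real.exp (-(13 / 100 * x)))) * (N + 1)) +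
    2 * ((N + 1) ^ 3 * Real.exp (-(N * Real.exp (-(124 / 1000 * x)))))

lemma one_sub_failureBound_le {n : ℕ} (hn : 1 ≤ n) {a b γ x ε : ℝ} (hb : 1 < b) (hab : b < a)
    (han : a + b ≤ n) (hx : x * (a + b) = 4 * ((a - b) / 2) ^ 2) (hx5 : 10 ^ 5 ≤ x) (hε0 : 0 ≤ ε)
    (hε : ε ≤ 1 / 10 ^ 6) (hεd : 17000 * √(a + b) ≤ ε * ((a - b) / 2))
    (hεexp : 900 * ε ^ 2 * Real.exp (42 * 404 ^ 2 / (1 / 10 ^ 6)) ≤ 1 / 10 ^ 6 / 16)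
    (hγ : 4 * Real.exp (-(124 / 1000 * x)) ≤ γ) :
    1 - failureBound (Fintype.card (Vertex n)) (a + b) x ≤
      ((sbm n a b).prod (colouring (Vertex n))).real (success n a b γ) := by
  have hn0 : (0 : ℝ) < n := by exact_mod_cast hn
  have H := planted_blockSign hn (by linarith : (0 : ℝ) < b) hab
  have q0 : ∀ e, 0 ≤ edgeProb n a b e := fun e => by
    unfold edgeProb; split_ifs <;> apply div_nonneg <;> linarith
  have qa : ∀ e, edgeProb n a b e ≤ a / n := fun e => by
    unfold edgeProb; split_ifs
    · exact le_rfl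
    · exact div_le_div_of_nonneg_right hab.le hn0.le
  have q1 : ∀ e, edgeProb n a b e ≤ 1 := fun e =>
    (qa e).trans ((div_le_one hn0).2 (by linarith))
  set p : Sym2 (Vertex n) → ℝ := fun e => edgeProb n a b e / 2 with hp
  have p0 : ∀ e, 0 ≤ p e := fun e => div_nonneg (q0 e) (by norm_num)
  have p1 : ∀ e, p e ≤ 1 := fun e => by have := q1 e; have := q0 e; simp only [hp]; linarith
  have pd : ∀ e, p e ≤ (a + b) / Fintype.card (Vertex n) := fun e => by
    have h1 : p e ≤ a / n / 2 := div_le_div_of_nonneg_right (qa e) (by norm_num)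
    refine h1.trans ?_
    rw [card_vertex, div_div, mul_comm]
    exact div_le_div_of_nonneg_right (by linarith) (by positivity)
  have hdN : a + b ≤ Fintype.card (Vertex n) := by rw [card_vertex]; linarith
  have hd1 : 1 ≤ a + b := by linarith
  set N : ℝ := (Fintype.card (Vertex n) : ℝ) with hN
  set BadRed : Set (Sym2 (Vertex n) → Bool) := {R | ¬ NormBound (a + b) p R} ∪
    {R | ¬ FewHighDegrees (a + b) R} ∪
    {R | ¬ SignBound (blockSign n) ((a - b) / 2) (N * Real.exp (-(13 / 100 * x))) p R} ∪
    {R | ¬ SquaresBound (blockSign n) (a + b) ((a - b) / 2) (N * Real.exp (-(13 / 100 * x))) ε p R}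
    with hBadR
  set BadBlue : Set (Sym2 (Vertex n) → Bool) := {R | ¬ FewBad (blockSign n) (a + b)
    (N * Real.exp (-(13 / 100 * x))) (N * Real.exp (-(124 / 1000 * x))) R} with hBadB
  set μ := (sbm n a b).prod (colouring (Vertex n)) with hμ
  have hμ' : μ = (coins (edgeProb n a b)).prod (coins fun _ => 1 / 2) := rfl
  have : IsProbabilityMeasure μ := by rw [hμ']; infer_instance
  have hcompl : (success n a b γ)ᶜ ⊆
      {ω | colourPart true ω ∈ BadRed} ∪ {ω | colourPart false ω ∈ BadBlue} := by
    intro ω hω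
    by_contra hgood
    rw [Set.mem_union, not_or] at hgood
    obtain ⟨h1, h2⟩ := hgood
    simp only [hBadR, hBadB, Set.mem_ofPred_eq, Set.mem_union, not_or, not_not] at h1 h2
    obtain ⟨⟨⟨g1, g2⟩, g3⟩, g4⟩ := h1
    exact hω ⟨exists_isPartitionOutput hn a b ω, fun U₁ U₂ hU => isCorrectPartition_of_bounds hn
      (by linarith) hab hx (by linarith) hε0 hε hεd hγ g1 g2 g3 g4 h2 hU⟩
  have hle : μ.real (success n a b γ)ᶜ ≤ failureBound N (a + b) x := by
    unfold failureBound
    refine (measureReal_mono hcompl).trans ((measureReal_union_le _ _).trans (add_le_add ?_ ?_))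
    · rw [hμ', real_colourPart q0 q1]
      refine (measureReal_union_le _ _).trans (add_le_add ((measureReal_union_le _ _).trans
        (add_le_add ((measureReal_union_le _ _).trans (add_le_add ?_ ?_)) ?_)) ?_)
      · exact normBound_prob p0 p1 hd1 pd hdN
      · exact fewHighDegrees_prob p0 p1 hd1 pd
      · exact signBound_prob H p0 p1 hx (by linarith)
      · exact squaresBound_prob H p0 p1 pd hx (by linarith) hεexp
    · rw [hμ', real_colourPart q0 q1]
      exact fewBad_prob H p0 p1 hx hx5
  rw [probReal_compl_eq_one_sub (Set.toFinite _).measurableSet] at hle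
  linarith

lemma tendsto_pow_mul_exp_neg {c : ℝ} (hc : 0 < c) (k : ℕ) :
    Tendsto (fun N : ℝ => (N + 1) ^ k * Real.exp (-(N * c))) atTop (𝓝 0) := by
  have h := (Real.tendsto_pow_mul_exp_neg_atTop_nhds_zero k).comp
    ((tendsto_atTop_add_const_right atTop (1 : ℝ) tendsto_id).const_mul_atTop hc)
  have h2 := h.const_mul (Real.exp c / c ^ k)
  rw [mul_zero] at h2
  refine h2.congr fun N => ?_
  simp only [Function.comp, id]
  have e : Real.exp (-(N * c)) = Real.exp c * Real.exp (-(c * (N + 1))) := by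
    rw [← Real.exp_add]; congr 1; ring
  rw [e, mul_pow]
  field_simp

lemma tendsto_failureBound (d x : ℝ) : Tendsto (fun N => failureBound N d x) atTop (𝓝 0) := by
  have t1 := tendsto_pow_mul_exp_neg (Real.exp_pos (-d)) 1
  have t2 := fun k => tendsto_pow_mul_exp_neg (Real.exp_pos (-(13 / 100 * x))) k
  have t3 := tendsto_pow_mul_exp_neg (Real.exp_pos (-(124 / 1000 * x))) 3
  have t4 : Tendsto (fun N : ℝ => 8 / N) atTop (𝓝 0) := tendsto_const_nhds.div_atTop tendsto_id
  have t5 := tendsto_pow_mul_exp_neg one_pos 0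
  -- The net factor is expanded in powers of N + 1 through 32N + 1 = 32(N + 1) - 31, which explains
  -- the coefficients. Each summand is a power of N + 1 times a decaying exponential.
  have h := (((((t1.add t4).add (t5.const_mul 2)).add t1).add (t2 1)).add
    (((((t2 4).const_mul (32 ^ 3)).add ((t2 3).const_mul (-(93 * 32 ^ 2)))).add
      ((t2 2).const_mul (93 * 31 * 32))).add ((t2 1).const_mul (2 - 31 ^ 3)))).add
    (t3.const_mul 2)
  simp only [mul_zero, add_zero] at h
  refine h.congr fun N => ?_
  unfold failureBound
  rw [mul_one]
  ring

end BlockModel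

theorem corollary1p3 :
    ∃ C₀ ε : ℝ, 0 < C₀ ∧ 0 < ε ∧
      ∀ a b γ : ℝ, C₀ < b → b < a → 0 < γ → γ < ε →
        8.1 * Real.log (2 / γ) ≤ (a - b) ^ 2 / (a + b) →
        Tendsto
          (fun n : ℕ =>
            ((BlockModel.sbm n a b).prod
              (BlockModel.colouring (BlockModel.Vertex n))).real (BlockModel.success n a b γ))
          atTop (𝓝 1) := by
  set E := Real.exp (42 * 404 ^ 2 / (1 / 10 ^ 6)) with hE
  have hE1 : 1000 ≤ E := by
    have := Real.add_one_le_exp (42 * 404 ^ 2 / (1 / 10 ^ 6))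
    refine le_trans ?_ this
    norm_num
  -- The relative noise is ε = 34000/√x. This K is the value of x from which 900ε²E ≤ 10⁻⁶/16.
  -- Bounding γ by 2 exp(-K/8.1) forces x ≥ K, and since E ≥ 1000 this also gives ε ≤ 10⁻⁶.
  set K : ℝ := 900 * 34000 ^ 2 * (16 * 10 ^ 6) * E with hK
  refine ⟨1, 2 * Real.exp (-(K / 8.1)), one_pos, by positivity, ?_⟩
  intro a b γ hb hab hγ0 hγ hlog
  set x := (a - b) ^ 2 / (a + b) with hxdef
  have hd : 0 < a + b := by linarith
  have hx : x * (a + b) = 4 * ((a - b) / 2) ^ 2 := by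
    rw [hxdef, div_mul_cancel₀ _ hd.ne']; ring
  have hγx : 2 * Real.exp (-(x / 8.1)) ≤ γ := by
    have h1 : Real.log (2 / γ) ≤ x / 8.1 := by rw [le_div_iff₀ (by norm_num)]; linarith
    rw [Real.log_le_iff_le_exp (by positivity), div_le_iff₀ hγ0] at h1
    have h2 := mul_le_mul_of_nonneg_left h1 (Real.exp_pos (-(x / 8.1))).le
    rw [← mul_assoc, ← Real.exp_add, neg_add_cancel, Real.exp_zero, one_mul] at h2
    linarith
  have hKx : K ≤ x := by
    have h1 := hγx.trans_lt hγ
    have h2 := Real.exp_lt_exp.1 (lt_of_mul_lt_mul_left h1 (by norm_num))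
    have h3 : K / 8.1 ≤ x / 8.1 := by linarith
    rwa [div_le_div_iff_of_pos_right (by norm_num)] at h3
  have hx22 : (34000 * 10 ^ 6) ^ 2 ≤ x := by
    refine le_trans ?_ hKx
    rw [hK]
    linarith
  have hx0 : 0 < x := by linarith
  have hsx : 0 < √x := Real.sqrt_pos.2 hx0
  -- The gap between 0.124 and 1/8.1 = 0.12345… absorbs the factor 2 once x is large.
  have hγ' : 4 * Real.exp (-(124 / 1000 * x)) ≤ γ := by
    refine le_trans ?_ hγx
    have h1 : 2 ≤ Real.exp (124 / 1000 * x - x / 8.1) := by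
      have h3 := Real.add_one_le_exp (124 / 1000 * x - x / 8.1)
      have h4 : x / 8.1 = 10 / 81 * x := by ring
      rw [h4] at h3 ⊢
      linarith
    have h2 : Real.exp (-(x / 8.1)) =
        Real.exp (124 / 1000 * x - x / 8.1) * Real.exp (-(124 / 1000 * x)) := by
      rw [← Real.exp_add]; congr 1; ring
    rw [h2]
    nlinarith [Real.exp_pos (-(124 / 1000 * x))]
  have hε : 34000 / √x ≤ 1 / 10 ^ 6 := by
    rw [div_le_div_iff₀ hsx (by norm_num), one_mul]
    exact Real.le_sqrt_of_sq_le hx22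
  have hεd : 17000 * √(a + b) ≤ 34000 / √x * ((a - b) / 2) := by
    have h1 : √x * √(a + b) = a - b := by
      rw [← Real.sqrt_mul hx0.le, hx, show 4 * ((a - b) / 2) ^ 2 = (a - b) ^ 2 by ring,
        Real.sqrt_sq (by linarith)]
    rw [← h1]
    apply le_of_eq
    field_simp
    norm_num
  have hεexp : 900 * (34000 / √x) ^ 2 * E ≤ 1 / 10 ^ 6 / 16 := by
    rw [div_pow, Real.sq_sqrt hx0.le]
    have : 900 * (34000 ^ 2 / x) * E = 900 * 34000 ^ 2 * E / x := by ring
    rw [this, div_le_iff₀ hx0]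
    linarith
  have hcard : Tendsto (fun n : ℕ => (Fintype.card (BlockModel.Vertex n) : ℝ)) atTop atTop := by
    simp only [BlockModel.card_vertex]
    exact tendsto_natCast_atTop_atTop.const_mul_atTop (by norm_num)
  have hlim := ((BlockModel.tendsto_failureBound (a + b) x).comp hcard).const_sub 1
  rw [sub_zero] at hlim
  refine tendsto_of_tendsto_of_tendsto_of_le_of_le' hlim tendsto_const_nhds ?_ ?_
  · filter_upwards [eventually_ge_atTop 1, eventually_ge_atTop ⌈a + b⌉₊] with n hn1 hn2
    exact BlockModel.one_sub_failureBound_le hn1 hb hab (Nat.ceil_le.1 hn2) hx (by linarith)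
      (by positivity) hε hεd hεexp hγ'
  · refine Eventually.of_forall fun n => ?_
    have : IsProbabilityMeasure
        ((BlockModel.sbm n a b).prod (BlockModel.colouring (BlockModel.Vertex n))) := by
      change IsProbabilityMeasure ((BlockModel.coins (BlockModel.edgeProb n a b)).prod
        (BlockModel.coins fun _ => 1 / 2))
      infer_instance
    exact measureReal_le_one
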